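/- Let $Z$ be a connected two-dimensional topological manifold (Hausdorff, with countable base, possibly with boundary), and let $\Delta$ be a one-dimensional foliation of $Z$ such that each connected component of $\partial Z$ is a leaf, and each leaf is homeomorphic to $\mathbb{R}$ and is a closed subset of $Z$. A leaf $\omega\subset \mathrm{Int}\,Z$ (respectively $\omega\subset\partial Z$) is called *regular* if it has a saturated neighbourhood $U$ (that is, a neighbourhood that is a union of leaves) such that the pair $(\overline{U},U)$ is homeomorphic to $(\mathbb{R}\times[-1,1],\ \mathbb{R}\times(-1,1))$ (respectively $(\mathbb{R}\times[0,1],\ \mathbb{R}\times[0,1))$) by a homeomorphism sending leaves of $\Delta$ onto lines $\mathbb{R}\times\{t\}$ and sending $\omega$ onto $\mathbb{R}\times\{0\}$. A leaf that is not regular is called *singular*. Suppose that the family of all singular leaves is locally finite and that every singular leaf is contained in $\partial Z$. Then $(Z,\Delta)$ is foliated homeomorphic (that is, homeomorphic by a map sending leaves onto leaves) to one of the following foliated surfaces: 1. the standard cylinder, that is the quotient of $\mathbb{R}\times[0,1]$ by the identification $(x,0)\sim(x,1)$, foliated by the images of the lines $\mathbb{R}\times\{t\}$; 2. the standard Möbius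 band, that is the quotient of $\mathbb{R}\times[0,1]$ by the identification $(x,0)\sim(-x,1)$, foliated by the images of the lines $\mathbb{R}\times\{t\}$; 3. a strip, that is a set $S$ with $\mathbb{R}\times(u,v)\subset S\subset\mathbb{R}\times[u,v]$ for some real $u<v$ that is open in $\mathbb{R}\times[u,v]$, foliated by the lines $\mathbb{R}\times\{t\}$, $u<t<v$, and the connected components of $S\cap(\mathbb{R}\times\{u,v\})$. -/

import Mathlib

open Set Topology

namespace Striped

/-- The boundary `∂Z` of a topological surface `Z`: the points having no open neighbourhood
homeomorphic to an open subset of the plane. -/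
def surfaceBoundary (Z : Type*) [TopologicalSpace Z] : Set Z :=
  {z | ¬ ∃ W : Set Z, IsOpen W ∧ z ∈ W ∧ ∃ V : Set (ℝ × ℝ), IsOpen V ∧ Nonempty (W ≃ₜ V)}

/-- The interior `Int Z` of a topological surface `Z`. -/
def surfaceInterior (Z : Type*) [TopologicalSpace Z] : Set Z := (surfaceBoundary Z)ᶜ

/-- `φ : (-1,1) × J → Z` is a foliated chart for the family `L` of leaves: it is an open embedding
with image `W`, and for each leaf `ω` the connected components of `ω ∩ W` are images of horizontal
segments `(-1,1) × {t}`. -/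
def IsFoliatedChart {Z : Type*} [TopologicalSpace Z] (L : Set (Set Z)) (J : Set ℝ)
    (φ : Ioo (-1 : ℝ) 1 × J → Z) : Prop :=
  IsOpenEmbedding φ ∧
    ∀ ω ∈ L, ∀ p, φ p ∈ ω →
      connectedComponentIn (ω ∩ range φ) (φ p) = φ '' {q | q.2 = p.2}

/-- A one-dimensional foliation of a surface such that each connected component of the boundary is
a leaf: a partition into path connected leaves, such that each point lies in the image of a foliated
chart modelled on `(-1,1) × (-1,1)` or on `(-1,1) × [0,1)`. The existence of the charts also
says that `Z` is locally homeomorphic to a half-plane, so that a (second countable) foliated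
surface is a (second countable) Hausdorff space `Z` with such a foliation. -/
structure Foliation (Z : Type*) [TopologicalSpace Z] where
  /-- the family of all leaves -/
  leaves : Set (Set Z)
  isPartition : Setoid.IsPartition leaves
  isPathConnected : ∀ ω ∈ leaves, IsPathConnected ω
  exists_chart : ∀ z : Z, ∃ J : Set ℝ, (J = Ioo (-1 : ℝ) 1 ∨ J = Ico (0 : ℝ) 1) ∧
    ∃ φ : Ioo (-1 : ℝ) 1 × J → Z, IsFoliatedChart leaves J φ ∧ z ∈ range φ
  boundary_component_mem : ∀ z ∈ surfaceBoundary Z,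
    connectedComponentIn (surfaceBoundary Z) z ∈ leaves

namespace Foliation

variable {Z : Type*} [TopologicalSpace Z] (F : Foliation Z)

/-- A set is saturated if it contains every leaf that it meets. -/
def IsSaturated (U : Set Z) : Prop := ∀ ω ∈ F.leaves, (ω ∩ U).Nonempty → ω ⊆ U

/-- The leaf `ω` has a saturated neighbourhood `U` such that the pair `(closure U, U)` is foliated
homeomorphic to `(ℝ × I, ℝ × I₀)`, for `I₀ ⊆ I ⊆ ℝ`, by a homeomorphism sending `ω` onto `ℝ × {0}`.
Here `f` is the inverse of that homeomorphism, followed by the inclusion of `closure U`. -/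
def HasModelNeighbourhood (I I₀ : Set ℝ) (ω : Set Z) : Prop :=
  ∃ U : Set Z, F.IsSaturated U ∧ ω ⊆ interior U ∧
    ∃ f : ℝ × I → Z, IsEmbedding f ∧
      range f = closure U ∧
      f '' {p | (p.2 : ℝ) ∈ I₀} = U ∧
      (∀ t : I, f '' {p | p.2 = t} ∈ F.leaves) ∧
      f '' {p | (p.2 : ℝ) = 0} = ω

/-- Regular leaves. -/
def IsRegular (ω : Set Z) : Prop :=
  (ω ⊆ surfaceInterior Z ∧ F.HasModelNeighbourhood (Icc (-1) 1) (Ioo (-1) 1) ω) ∨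
  (ω ⊆ surfaceBoundary Z ∧ F.HasModelNeighbourhood (Icc 0 1) (Ico 0 1) ω)

/-- The family of all singular (that is, not regular) leaves. -/
def singularLeaves : Set (Set Z) := {ω | ω ∈ F.leaves ∧ ¬ F.IsRegular ω}

end Foliation

/-- `X` and `Y`, partitioned into the leaves `L` and `L'`, are foliated homeomorphic: some
homeomorphism sends each leaf of `X` onto a leaf of `Y`. -/
def FoliatedHomeomorphic {X Y : Type*} [TopologicalSpace X] [TopologicalSpace Y]
    (L : Set (Set X)) (L' : Set (Set Y)) : Prop :=
  ∃ h : X ≃ₜ Y, ∀ ω ∈ L, h '' ω ∈ L'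

/-- The gluing `(x, 0) ∼ (ε x, 1)` of the sides of `ℝ × [0,1]`, where `ε = ±1`. -/
def glueRel (ε : ℤˣ) (p q : ℝ × Icc (0 : ℝ) 1) : Prop :=
  p.2 = 0 ∧ q.2 = 1 ∧ q.1 = ((ε : ℤ) : ℝ) * p.1

/-- The quotient of `ℝ × [0,1]` by the gluing, with the quotient topology: the standard (open)
cylinder for `ε = 1`, the standard Möbius band for `ε = -1`. -/
abbrev GluedBand (ε : ℤˣ) : Type := Quot (glueRel ε)

/-- The leaves of the canonical foliation of the standard cylinder or Möbius band: the images of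
the lines `ℝ × {t}`. -/
def bandLeaves (ε : ℤˣ) : Set (Set (GluedBand ε)) :=
  {ω | ∃ t : Icc (0 : ℝ) 1, ω = Quot.mk (glueRel ε) '' {p | p.2 = t}}

/-- `S` is a strip with levels `u < v`: `ℝ × (u,v) ⊆ S ⊆ ℝ × [u,v]`, and `S` is open in
`ℝ × [u,v]`. -/
def IsStrip (u v : ℝ) (S : Set (ℝ × ℝ)) : Prop :=
  u < v ∧ univ ×ˢ Ioo u v ⊆ S ∧ S ⊆ univ ×ˢ Icc u v ∧
    ∃ O : Set (ℝ × ℝ), IsOpen O ∧ S = O ∩ (univ ×ˢ Icc u v)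

/-- The boundary `∂S` of a strip. -/
def stripBoundary (u v : ℝ) (S : Set (ℝ × ℝ)) : Set (ℝ × ℝ) := S ∩ (univ ×ˢ {u, v})

/-- The leaves of the canonical foliation of a strip: the lines `ℝ × {t}`, `u < t < v`, and the
boundary intervals, that is the connected components of `∂S`. -/
def stripLeaves (u v : ℝ) (S : Set (ℝ × ℝ)) : Set (Set S) :=
  {ω | (∃ t ∈ Ioo u v, Subtype.val '' ω = (univ : Set ℝ) ×ˢ {t}) ∨
    ∃ p ∈ stripBoundary u v S, Subtype.val '' ω = connectedComponentIn (stripBoundary u v S) p}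

end Striped

open Filter
open scoped NNReal
set_option linter.unusedSectionVars false

namespace Striped

/-! ### One-dimensional facts -/

/-! Every leaf through an interior point is regular, so it is the core of an open tube foliated as
`ℝ × ℝ` whose narrower closed tubes are closed in `Z` (`exists_tube`). Hence interior leaves are
separated from all other points by saturated open sets (`exists_separation`). It follows that the
space of interior leaves is a connected, Hausdorff, second countable 1-manifold without boundary,
and that the projection of `Int Z` onto it is a locally trivial bundle with fibre `ℝ`.

The base is classified together with the bundle. An `Arc` is a locally injective compact path in the
base with a continuous parametrization of the fibres over it. It can be continued past its ends, and
its continuations reach every point. If all arcs are injective, a countable chain of them exhausts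
the base and gives `Int Z ≅ ℝ × ℝ` (`exists_homeomorph_of_injOn`). Otherwise a shortest double point
yields a simple loop, whose image is open and closed (`exists_loop`).

Over a loop the leaf space is compact. Leaves approaching a boundary point would then accumulate at
an interior leaf, which the separation forbids, so `∂Z` is empty. The return map of the fibre is a
homeomorphism of `ℝ`, and it is isotoped linearly to `x ↦ x` or `x ↦ -x` (`exists_linear_gluing`):
the cylinder or the Möbius band.

Over a line, let `(x, t)` be the coordinates on the interior. In a half-plane chart at a boundary
point the level `t` is monotone in the height and has no finite limit, so it tends to `-∞` or `+∞`
at the boundary (`isLower_or_isUpper`). It remains to replace `x` by a fibre coordinate `H (x, t)`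
with limits at all boundary points, distinct limits at distinct points of the same end. Near the
lower end, `endCoord` is a sum of three terms. The first is `∑ 2⁻ⁿ clampUnit (ρ n)`, where `ρ n` is
the fibre coordinate of the `n`-th of countably many boundary charts. Each summand has limits,
because a boundary point off a chart box lies on one side of it. The second, `exp t * arctan x`,
makes the coordinate strictly increasing and dies out as `t → -∞`. The third makes it surjective and
vanishes near every lower boundary point. The upper end is treated by reversing `t`, and the two
coordinates are matched at `t = 0`. The map `(H, arctan t)` then extends to an embedding of `Z` onto
a strip between the levels `±π/2` (`exists_stripMap`, `StripMap.isStrip`). -/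

/-- A continuous, locally injective real function on an interval is injective. -/
theorem injOn_of_locally_injOn {f : ℝ → ℝ} {I : Set ℝ} (hI : I.OrdConnected)
    (hf : ContinuousOn f I) (hloc : ∀ t ∈ I, ∃ N ∈ 𝓝[I] t, InjOn f N) : InjOn f I := by
  have key : ∀ a ∈ I, ∀ b ∈ I, a < b → f a ≠ f b := by
    intro a ha b hb hab heq
    have hsub : Icc a b ⊆ I := hI.out ha hb
    -- As in Rolle's theorem, equal end values force an interior local extremum. Near it `f` is
    -- injective, hence strictly monotone, which is absurd.
    obtain ⟨c, hc, hext⟩ := exists_isLocalExtr_Ioo hab (hf.mono hsub) heq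
    obtain ⟨N, hN, hinj⟩ := hloc c (hsub ⟨hc.1.le, hc.2.le⟩)
    have hIc : I ∈ 𝓝 c := mem_of_superset (Icc_mem_nhds hc.1 hc.2) hsub
    rw [nhdsWithin_eq_nhds.2 hIc] at hN
    have hf' : ∀ᶠ x in 𝓝 c, x ∈ N ∧ x ∈ I := by
      filter_upwards [hN, hIc] with x h1 h2 using ⟨h1, h2⟩
    rcases hext with h | h
    · obtain ⟨ε, hε, hball⟩ := Metric.eventually_nhds_iff_ball.1 (hf'.and h)
      have hsub' : Icc (c - ε / 2) (c + ε / 2) ⊆ Metric.ball c ε := by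
        rw [Real.ball_eq_Ioo]
        intro x hx
        exact ⟨by linarith [hx.1], by linarith [hx.2]⟩
      have hcont : ContinuousOn f (Icc (c - ε / 2) (c + ε / 2)) :=
        hf.mono fun x hx => (hball x (hsub' hx)).1.2
      have hi : InjOn f (Icc (c - ε / 2) (c + ε / 2)) :=
        hinj.mono fun x hx => (hball x (hsub' hx)).1.1
      have h1 := (hball (c - ε / 2) (hsub' ⟨le_rfl, by linarith⟩)).2
      have h2 := (hball (c + ε / 2) (hsub' ⟨by linarith, le_rfl⟩)).2
      rcases hcont.strictMonoOn_of_injOn_Icc' (by linarith) hi with hm | hm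
      · have := hm (a := c - ε / 2) (b := c) ⟨le_rfl, by linarith⟩ ⟨by linarith, by linarith⟩
          (by linarith)
        linarith
      · have := hm (a := c) (b := c + ε / 2) ⟨by linarith, by linarith⟩ ⟨by linarith, le_rfl⟩
          (by linarith)
        linarith
    · obtain ⟨ε, hε, hball⟩ := Metric.eventually_nhds_iff_ball.1 (hf'.and h)
      have hsub' : Icc (c - ε / 2) (c + ε / 2) ⊆ Metric.ball c ε := by
        rw [Real.ball_eq_Ioo]
        intro x hx
        exact ⟨by linarith [hx.1], by linarith [hx.2]⟩
      have hcont : ContinuousOn f (Icc (c - ε / 2) (c + ε / 2)) :=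
        hf.mono fun x hx => (hball x (hsub' hx)).1.2
      have hi : InjOn f (Icc (c - ε / 2) (c + ε / 2)) :=
        hinj.mono fun x hx => (hball x (hsub' hx)).1.1
      have h1 := (hball (c - ε / 2) (hsub' ⟨le_rfl, by linarith⟩)).2
      have h2 := (hball (c + ε / 2) (hsub' ⟨by linarith, le_rfl⟩)).2
      rcases hcont.strictMonoOn_of_injOn_Icc' (by linarith) hi with hm | hm
      · have := hm (a := c) (b := c + ε / 2) ⟨by linarith, by linarith⟩ ⟨by linarith, le_rfl⟩
          (by linarith)
        linarith
      · have := hm (a := c - ε / 2) (b := c) ⟨le_rfl, by linarith⟩ ⟨by linarith, by linarith⟩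
          (by linarith)
        linarith
  intro a ha b hb hab
  rcases lt_trichotomy a b with h | h | h
  · exact (key a ha b hb h hab).elim
  · exact h
  · exact (key b hb a ha h hab.symm).elim

/-- A continuous injective real function on an interval is strictly monotone. -/
theorem strictMonoOn_or_strictAntiOn_of_injOn {f : ℝ → ℝ} {I : Set ℝ} (hI : I.OrdConnected)
    (hf : ContinuousOn f I) (hinj : InjOn f I) : StrictMonoOn f I ∨ StrictAntiOn f I := by
  by_contra! hcon
  obtain ⟨h1, h2⟩ := hcon
  simp only [StrictMonoOn, StrictAntiOn, not_forall] at h1 h2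
  obtain ⟨a, ha, b, hb, hab, hfab⟩ := h1
  obtain ⟨c, hc, d, hd, hcd, hfcd⟩ := h2
  -- Both failures of monotonicity take place in one compact interval, where the result for `Icc`
  -- applies.
  have hm : min a c ∈ I := by rcases min_choice a c with h | h <;> rw [h] <;> assumption
  have hM : max b d ∈ I := by rcases max_choice b d with h | h <;> rw [h] <;> assumption
  have hsub : Icc (min a c) (max b d) ⊆ I := hI.out hm hM
  have hle : min a c ≤ max b d := (min_le_left _ _).trans (hab.le.trans (le_max_left _ _))
  have h1 : a ∈ Icc (min a c) (max b d) := ⟨min_le_left _ _, hab.le.trans (le_max_left _ _)⟩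
  have h2 : b ∈ Icc (min a c) (max b d) := ⟨(min_le_left _ _).trans hab.le, le_max_left _ _⟩
  have h3 : c ∈ Icc (min a c) (max b d) := ⟨min_le_right _ _, hcd.le.trans (le_max_right _ _)⟩
  have h4 : d ∈ Icc (min a c) (max b d) := ⟨(min_le_right _ _).trans hcd.le, le_max_right _ _⟩
  rcases (hf.mono hsub).strictMonoOn_of_injOn_Icc' hle (hinj.mono hsub) with h | h
  · exact hfab (h h1 h2 hab)
  · exact hfcd (h h3 h4 hcd)

/-- A map of a product with `ℝ` that is fibrewise injective and continuous is open. -/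
theorem nhds_prod_le_map {T T' : Type*} [TopologicalSpace T] {r : ℝ × T → ℝ} {s : T → T'}
    {x₀ : ℝ} {t₀ : T} {l : Filter T'} (hr : ∀ᶠ q in 𝓝 (x₀, t₀), ContinuousAt r q)
    (hinj : ∃ N ∈ 𝓝 x₀, InjOn (fun x => r (x, t₀)) N) (hs : l ≤ map s (𝓝 t₀)) :
    𝓝 (r (x₀, t₀)) ×ˢ l ≤ map (fun q : ℝ × T => (r q, s q.2)) (𝓝 (x₀, t₀)) := by
  intro V hV
  obtain ⟨N, hN, hinj⟩ := hinj
  have hV' := (mem_map.1 hV)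
  have h1 := hr.and hV'
  rw [nhds_prod_eq] at h1
  obtain ⟨pa, hpa, pb, hpb, hab⟩ := eventually_prod_iff.1 h1
  obtain ⟨δ, hδ, hball⟩ := Metric.eventually_nhds_iff_ball.1 (hpa.and hN)
  set u := x₀ - δ / 2 with hu
  set v := x₀ + δ / 2 with hv
  have huv : u ≤ v := by linarith
  have hsub : Icc u v ⊆ Metric.ball x₀ δ := by
    rw [Real.ball_eq_Ioo]
    intro x hx
    exact ⟨by linarith [hx.1], by linarith [hx.2]⟩
  have hux : x₀ ∈ Icc u v := ⟨by linarith, by linarith⟩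
  have huu : u ∈ Icc u v := ⟨le_rfl, huv⟩
  have hvv : v ∈ Icc u v := ⟨huv, le_rfl⟩
  have hct : ∀ t, pb t → ContinuousOn (fun x => r (x, t)) (Icc u v) := by
    intro t ht x hx
    have := (hab (hball x (hsub hx)).1 ht).1
    exact (this.comp (f := fun x => (x, t)) (by fun_prop)).continuousWithinAt
  have hpb0 := hpb.self_of_nhds
  have hcu : ContinuousAt (fun t => r (u, t)) t₀ :=
    ((hab (hball u (hsub huu)).1 hpb0).1).comp (f := fun t => (u, t)) (by fun_prop)
  have hcv : ContinuousAt (fun t => r (v, t)) t₀ :=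
    ((hab (hball v (hsub hvv)).1 hpb0).1).comp (f := fun t => (v, t)) (by fun_prop)
  have hinj' : InjOn (fun x => r (x, t₀)) (Icc u v) := hinj.mono fun x hx => (hball x (hsub hx)).2
  -- If on every nearby fibre the values at `u` and `v` bracket `[lo, hi]`, the intermediate value
  -- theorem on the fibre yields every value in `[lo, hi]`. Injectivity is needed on the fibre over
  -- `t₀` only: the strict inequalities that it gives there persist by continuity.
  have fin : ∀ lo hi : ℝ, lo < r (x₀, t₀) → r (x₀, t₀) < hi →
      (∀ᶠ t in 𝓝 t₀, Icc lo hi ⊆ uIcc (r (u, t)) (r (v, t))) → V ∈ 𝓝 (r (x₀, t₀)) ×ˢ l := by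
    intro lo hi hlo hhi hev
    have h2 : s '' {t | pb t ∧ Icc lo hi ⊆ uIcc (r (u, t)) (r (v, t))} ∈ l :=
      hs (image_mem_map (hpb.and hev))
    refine mem_of_superset (prod_mem_prod (Icc_mem_nhds hlo hhi) h2) ?_
    rintro ⟨ρ, σ⟩ ⟨hρ, t, ⟨htb, ht⟩, rfl⟩
    have h3 := intermediate_value_uIcc (a := u) (b := v) (f := fun x => r (x, t))
      (by rw [uIcc_of_le huv]; exact hct t htb)
    obtain ⟨x, hx, hxρ⟩ := h3 (ht hρ)
    rw [uIcc_of_le huv] at hx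
    have := (hab (hball x (hsub hx)).1 htb).2
    have e : r (x, t) = ρ := hxρ
    rw [← e]
    exact this
  rcases (hct t₀ hpb0).strictMonoOn_of_injOn_Icc' huv hinj' with hm | hm
  · have e1 : r (u, t₀) < r (x₀, t₀) := hm huu hux (by linarith)
    have e2 : r (x₀, t₀) < r (v, t₀) := hm hux hvv (by linarith)
    refine fin ((r (u, t₀) + r (x₀, t₀)) / 2) ((r (x₀, t₀) + r (v, t₀)) / 2)
      (by linarith) (by linarith) ?_
    filter_upwards [hcu.eventually_lt_const (show r (u, t₀) < (r (u, t₀) + r (x₀, t₀)) / 2 by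
      linarith), hcv.eventually_const_lt (show (r (x₀, t₀) + r (v, t₀)) / 2 < r (v, t₀) by
      linarith)] with t h5 h6
    exact (Icc_subset_Icc h5.le h6.le).trans Icc_subset_uIcc
  · have e1 : r (x₀, t₀) < r (u, t₀) := hm huu hux (by linarith)
    have e2 : r (v, t₀) < r (x₀, t₀) := hm hux hvv (by linarith)
    refine fin ((r (v, t₀) + r (x₀, t₀)) / 2) ((r (x₀, t₀) + r (u, t₀)) / 2)
      (by linarith) (by linarith) ?_
    filter_upwards [hcv.eventually_lt_const (show r (v, t₀) < (r (v, t₀) + r (x₀, t₀)) / 2 by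
      linarith), hcu.eventually_const_lt (show (r (x₀, t₀) + r (u, t₀)) / 2 < r (u, t₀) by
      linarith)] with t h5 h6
    exact (Icc_subset_Icc h5.le h6.le).trans Icc_subset_uIcc'

/-- A continuous, locally injective real function is open. -/
theorem nhds_le_map_of_injOn {f : ℝ → ℝ} {t₀ : ℝ} (hf : ∀ᶠ t in 𝓝 t₀, ContinuousAt f t)
    (hinj : ∃ N ∈ 𝓝 t₀, InjOn f N) : 𝓝 (f t₀) ≤ map f (𝓝 t₀) := by
  have := nhds_prod_le_map (T := Unit) (T' := Unit) (r := fun q => f q.1) (s := id) (x₀ := t₀)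
    (t₀ := ()) (l := pure ()) ?_ hinj (by simp)
  · have h := map_mono (m := Prod.fst) this
    rw [map_map, prod_pure, map_map] at h
    have e : (Prod.fst ∘ fun a : ℝ => (a, ())) = id := rfl
    rw [e, map_id] at h
    refine h.trans ?_
    rw [show (Prod.fst ∘ fun q : ℝ × Unit => (f q.1, id q.2)) = f ∘ Prod.fst from rfl, ← map_map]
    exact map_mono continuousAt_fst
  · have : Tendsto Prod.fst (𝓝 (t₀, ())) (𝓝 t₀) := continuousAt_fst
    filter_upwards [this.eventually hf] with q hq
    exact ContinuousAt.comp (g := f) hq continuousAt_fst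

theorem continuousAt_invFun {X Y : Type*} [TopologicalSpace X] [TopologicalSpace Y] [Nonempty X]
    {f : X → Y} (hf : IsOpenEmbedding f) (x : X) : ContinuousAt (Function.invFun f) (f x) := by
  have h : Function.invFun f (f x) = x := Function.leftInverse_invFun hf.injective x
  rw [ContinuousAt, h, ← hf.map_nhds_eq, tendsto_map'_iff,
    Function.invFun_comp hf.injective]
  exact tendsto_id

/-! ### Line bundles over one-dimensional manifolds -/

section LineBundle

variable {E B : Type*} [TopologicalSpace E] [TopologicalSpace B]

/-- `f` is a trivialization of `p` over the open arc parametrized by `c`. -/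
structure LocTriv (p : E → B) (f : ℝ × ℝ → E) (c : ℝ → B) : Prop where
  emb : IsOpenEmbedding f
  base : IsOpenEmbedding c
  comm : ∀ x t, p (f (x, t)) = c t
  surj : ∀ t e, p e = c t → ∃ x, f (x, t) = e

/-- `F` is a continuous family of parametrizations of the fibres of `p` over the locally injective
path `γ : I → B`. -/
structure Dev (p : E → B) (I : Set ℝ) (γ : ℝ → B) (F : ℝ × ℝ → E) : Prop where
  cont : ContinuousOn F (univ ×ˢ I)
  comm : ∀ t ∈ I, ∀ x, p (F (x, t)) = γ t
  inj : ∀ t ∈ I, Function.Injective fun x => F (x, t)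
  surj : ∀ t ∈ I, ∀ e, p e = γ t → ∃ x, F (x, t) = e
  locinj : ∀ t ∈ I, ∃ N ∈ 𝓝[I] t, InjOn γ N

variable {p : E → B} {f : ℝ × ℝ → E} {c : ℝ → B} {I J : Set ℝ} {γ : ℝ → B} {F : ℝ × ℝ → E}

theorem LocTriv.comp (h : LocTriv p f c) (k : ℝ ≃ₜ ℝ) :
    LocTriv p (fun q => f (q.1, k q.2)) (c ∘ k) where
  emb := h.emb.comp ((Homeomorph.refl ℝ).prodCongr k).isOpenEmbedding
  base := h.base.comp k.isOpenEmbedding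
  comm x t := h.comm x (k t)
  surj t e he := h.surj (k t) e he

theorem Dev.comp (h : Dev p I γ F) (k : ℝ ≃ₜ ℝ) :
    Dev p (k ⁻¹' I) (γ ∘ k) (fun q => F (q.1, k q.2)) where
  cont := h.cont.comp (by fun_prop) fun q hq => ⟨mem_univ _, hq.2⟩
  comm t ht x := h.comm (k t) ht x
  inj t ht := h.inj (k t) ht
  surj t ht e he := h.surj (k t) ht e he
  locinj t ht := by
    obtain ⟨N, hN, hinj⟩ := h.locinj (k t) ht
    refine ⟨k ⁻¹' N, ?_, ?_⟩
    · exact (k.continuous.continuousWithinAt.tendsto_nhdsWithin fun x hx => hx) hN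
    · exact fun x hx y hy hxy => k.injective (hinj hx hy hxy)

theorem Dev.mono (h : Dev p I γ F) (hJ : J ⊆ I) : Dev p J γ F where
  cont := h.cont.mono (prod_mono le_rfl hJ)
  comm t ht x := h.comm t (hJ ht) x
  inj t ht := h.inj t (hJ ht)
  surj t ht e he := h.surj t (hJ ht) e he
  locinj t ht := by
    obtain ⟨N, hN, hinj⟩ := h.locinj t (hJ ht)
    exact ⟨N, nhdsWithin_mono _ hJ hN, hinj⟩

theorem Dev.congr (h : Dev p I γ F) {γ' : ℝ → B} {F' : ℝ × ℝ → E} (hγ : EqOn γ' γ I)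
    (hF : EqOn F' F (univ ×ˢ I)) : Dev p I γ' F' where
  cont := h.cont.congr hF
  comm t ht x := by rw [hF ⟨mem_univ _, ht⟩, hγ ht, h.comm t ht]
  inj t ht x y hxy := h.inj t ht (by
    simpa only [hF (show (x, t) ∈ univ ×ˢ I from ⟨mem_univ _, ht⟩),
      hF (show (y, t) ∈ univ ×ˢ I from ⟨mem_univ _, ht⟩)] using hxy)
  surj t ht e he := by
    obtain ⟨x, hx⟩ := h.surj t ht e (by rw [he, hγ ht])
    exact ⟨x, by rw [hF ⟨mem_univ _, ht⟩, hx]⟩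
  locinj t ht := by
    obtain ⟨N, hN, hinj⟩ := h.locinj t ht
    refine ⟨N ∩ I, inter_mem hN self_mem_nhdsWithin, fun x hx y hy hxy => hinj hx.1 hy.1 ?_⟩
    rwa [hγ hx.2, hγ hy.2] at hxy

theorem Dev.continuousOn (h : Dev p I γ F) (hp : Continuous p) : ContinuousOn γ I := by
  have : ContinuousOn (fun t => p (F (0, t))) I :=
    hp.comp_continuousOn (h.cont.comp (by fun_prop) fun t ht => ⟨mem_univ _, ht⟩)
  exact this.congr fun t ht => (h.comm t ht 0).symm

theorem LocTriv.invFun_apply (h : LocTriv p f c) (q : ℝ × ℝ) : Function.invFun f (f q) = q :=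
  Function.leftInverse_invFun h.emb.injective q

theorem LocTriv.invFun_base_apply (h : LocTriv p f c) (t : ℝ) : Function.invFun c (c t) = t :=
  Function.leftInverse_invFun h.base.injective t

theorem LocTriv.mem_range (h : LocTriv p f c) {e : E} (he : p e ∈ range c) :
    f (Function.invFun f e) = e ∧ (Function.invFun f e).2 = Function.invFun c (p e) := by
  obtain ⟨t, ht⟩ := he
  obtain ⟨x, rfl⟩ := h.surj t e ht.symm
  rw [h.invFun_apply, h.comm, h.invFun_base_apply]
  exact ⟨rfl, rfl⟩

theorem LocTriv.continuousAt (h : LocTriv p f c) {e : E} (he : p e ∈ range c) :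
    ContinuousAt (Function.invFun f) e := by
  rw [← (h.mem_range he).1]
  exact continuousAt_invFun h.emb _

/-- In a family of parametrizations of fibres, the position in the fibre depends continuously on
the point. -/
theorem Dev.tendsto_fst (h : Dev p I γ F) (hp : Continuous p)
    (hloc : ∀ b, ∃ f c, LocTriv p f c ∧ c 0 = b) {t₀ x₀ : ℝ} (ht₀ : t₀ ∈ I) {ι : Type*}
    {l : Filter ι} {q : ι → ℝ × ℝ} (h1 : Tendsto (fun i => F (q i)) l (𝓝 (F (x₀, t₀))))
    (h2 : Tendsto (fun i => (q i).2) l (𝓝[I] t₀)) : Tendsto (fun i => (q i).1) l (𝓝 x₀) := by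
  obtain ⟨f, c, hfc, hc0⟩ := hloc (γ t₀)
  have hγ := h.continuousOn hp
  have hrange : range c ∈ 𝓝 (γ t₀) := hfc.base.isOpen_range.mem_nhds ⟨0, hc0⟩
  set g := Function.invFun f with hg
  have hmem0 : p (F (x₀, t₀)) ∈ range c := by rw [h.comm t₀ ht₀, ← hc0]; exact ⟨0, rfl⟩
  -- By openness, `F (q i)` is also the image of a point `(x', (q i).2)` with `x'` close to `x₀`.
  -- Injectivity on the fibre then forces `x' = (q i).1`.
  have key := nhds_prod_le_map (T := I) (r := fun q => (g (F (q.1, q.2))).1) (x₀ := x₀)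
    (t₀ := ⟨t₀, ht₀⟩) (s := Subtype.val) (l := 𝓝[I] t₀) ?_ ?_ (by rw [map_nhds_subtype_val])
  · intro V hV
    rw [mem_map]
    have hW := key (image_mem_map (prod_mem_nhds hV univ_mem))
    have hlim : Tendsto (fun i => ((g (F (q i))).1, (q i).2)) l
        (𝓝 (g (F (x₀, t₀))).1 ×ˢ 𝓝[I] t₀) :=
      Tendsto.prodMk ((continuousAt_fst.tendsto.comp (hfc.continuousAt hmem0).tendsto).comp h1) h2
    have hpr : ∀ᶠ i in l, p (F (q i)) ∈ range c := by
      refine (hp.continuousAt.tendsto.comp h1).eventually ?_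
      rw [h.comm t₀ ht₀]
      exact hrange
    filter_upwards [hlim hW, h2 self_mem_nhdsWithin, hpr] with i hi hiI hir
    obtain ⟨⟨x', t', ht'⟩, ⟨hx', -⟩, heq⟩ := hi
    simp only [Prod.mk.injEq] at heq
    obtain ⟨heq1, rfl⟩ := heq
    have e1 : p (F (x', (q i).2)) = p (F (q i)) := by
      rw [h.comm _ hiI, ← h.comm _ hiI (q i).1]
    have e2 := hfc.mem_range hir
    have e3 := hfc.mem_range (e := F (x', (q i).2)) (by rwa [e1])
    have e4 : g (F (x', (q i).2)) = g (F (q i)) := by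
      refine Prod.ext heq1 ?_
      rw [e2.2, e3.2, e1]
    have e5 : F (x', (q i).2) = F (q i) := by rw [← e2.1, ← e3.1, ← hg, e4]
    have : x' = (q i).1 := h.inj _ hiI e5
    rw [mem_preimage, ← this]
    exact hx'
  · have h3 : ∀ᶠ t : I in 𝓝 ⟨t₀, ht₀⟩, γ t ∈ range c :=
      (hγ.domRestrict.continuousAt (x := ⟨t₀, ht₀⟩)).tendsto
        (show range c ∈ 𝓝 (I.domRestrict γ ⟨t₀, ht₀⟩) from hrange)
    have h4 : Tendsto Prod.snd (𝓝 (x₀, (⟨t₀, ht₀⟩ : I))) (𝓝 ⟨t₀, ht₀⟩) := continuousAt_snd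
    have hF : Continuous fun q : ℝ × I => F (q.1, q.2) :=
      h.cont.comp_continuous (by fun_prop) fun q => ⟨mem_univ _, q.2.2⟩
    filter_upwards [h4.eventually h3] with q' hq'
    refine continuousAt_fst.comp (ContinuousAt.comp (g := g) (hfc.continuousAt ?_)
      hF.continuousAt)
    rwa [h.comm _ q'.2.2]
  · refine ⟨univ, univ_mem, fun x _ y _ hxy => h.inj t₀ ht₀ ?_⟩
    have e2 := hfc.mem_range (e := F (x, t₀)) (by rwa [h.comm _ ht₀, ← h.comm _ ht₀ x₀])
    have e3 := hfc.mem_range (e := F (y, t₀)) (by rwa [h.comm _ ht₀, ← h.comm _ ht₀ x₀])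
    have e4 : g (F (x, t₀)) = g (F (y, t₀)) := by
      refine Prod.ext hxy ?_
      rw [e2.2, e3.2, h.comm _ ht₀, h.comm _ ht₀]
    change F (x, t₀) = F (y, t₀)
    rw [← e2.1, ← e3.1, ← hg, e4]

theorem Dev.invFun_injOn (h : Dev p I γ F) (hfc : LocTriv p f c) {t₀ : ℝ} (ht₀ : t₀ ∈ I)
    (hp : Continuous p) (hr : γ t₀ ∈ range c) :
    ∃ N ∈ 𝓝[I] t₀, N ⊆ I ∧ ContinuousOn (Function.invFun c ∘ γ) N ∧
      InjOn (Function.invFun c ∘ γ) N ∧ (∀ t ∈ N, c (Function.invFun c (γ t)) = γ t) := by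
  obtain ⟨N, hN, hinj⟩ := h.locinj t₀ ht₀
  have hγ := h.continuousOn hp
  have h1 : γ ⁻¹' range c ∈ 𝓝[I] t₀ := hγ t₀ ht₀ (hfc.base.isOpen_range.mem_nhds hr)
  have hs : ∀ t, γ t ∈ range c → c (Function.invFun c (γ t)) = γ t := by
    rintro t ⟨u, hu⟩
    rw [← hu, hfc.invFun_base_apply]
  refine ⟨N ∩ I ∩ γ ⁻¹' range c, inter_mem (inter_mem hN self_mem_nhdsWithin) h1,
    fun t ht => ht.1.2, ?_, ?_, fun t ht => hs t ht.2⟩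
  · intro t ht
    refine ContinuousAt.comp_continuousWithinAt (g := Function.invFun c) ?_
      ((hγ t ht.1.2).mono fun t ht => ht.1.2)
    rw [← hs t ht.2]
    exact continuousAt_invFun hfc.base _
  · intro t ht t' ht' heq
    refine hinj ht.1.1 ht'.1.1 ?_
    rw [← hs t ht.2, ← hs t' ht'.2]
    exact congrArg c heq

/-- In a trivialization `F` takes the form `(x, t) ↦ (r (x, t), s t)` with `s` locally injective and
`r` injective on the fibre, so `nhds_prod_le_map` applies. The parameter must be interior to `I`,
since `s` is open only there. -/
theorem Dev.nhds_le_map (h : Dev p I γ F) (hp : Continuous p)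
    (hloc : ∀ b, ∃ f c, LocTriv p f c ∧ c 0 = b) {t₀ x₀ : ℝ} (ht₀ : I ∈ 𝓝 t₀) :
    𝓝 (F (x₀, t₀)) ≤ map F (𝓝 (x₀, t₀)) ∧ 𝓝 (γ t₀) ≤ map γ (𝓝 t₀) := by
  obtain ⟨f, c, hfc, hc0⟩ := hloc (γ t₀)
  have ht₀I := mem_of_mem_nhds ht₀
  obtain ⟨N, hN, hNI, hcont, hinj, hcN⟩ := h.invFun_injOn hfc ht₀I hp ⟨0, hc0⟩
  rw [nhdsWithin_eq_nhds.2 ht₀] at hN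
  have hs : 𝓝 (Function.invFun c (γ t₀)) ≤ map (Function.invFun c ∘ γ) (𝓝 t₀) := by
    refine nhds_le_map_of_injOn (f := Function.invFun c ∘ γ) ?_ ⟨N, hN, hinj⟩
    filter_upwards [eventually_mem_nhds_iff.2 hN] with t ht using hcont.continuousAt ht
  constructor
  · have key := nhds_prod_le_map (T := ℝ) (r := fun q => (Function.invFun f (F q)).1) (x₀ := x₀)
      (t₀ := t₀) (s := Function.invFun c ∘ γ) ?_ ?_ hs
    · have hr : p (F (x₀, t₀)) ∈ range c := by
        rw [h.comm _ ht₀I, ← hc0]; exact ⟨0, rfl⟩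
      have h1 := map_mono (m := f) key
      rw [← nhds_prod_eq, hfc.emb.map_nhds_eq, map_map] at h1
      have e : F (x₀, t₀) = f ((Function.invFun f (F (x₀, t₀))).1, Function.invFun c (γ t₀)) := by
        conv_lhs => rw [← (hfc.mem_range hr).1]
        congr 1
        refine Prod.ext rfl ?_
        rw [(hfc.mem_range hr).2, h.comm _ ht₀I]
      have h4 : Tendsto Prod.snd (𝓝 (x₀, t₀)) (𝓝 t₀) := continuousAt_snd
      have e2 : (f ∘ fun q : ℝ × ℝ => ((Function.invFun f (F q)).1, (Function.invFun c ∘ γ) q.2))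
          =ᶠ[𝓝 (x₀, t₀)] F := by
        filter_upwards [h4 hN] with q hq
        have hr : p (F q) ∈ range c := by
          rw [h.comm _ (hNI hq), ← hcN _ hq]; exact ⟨_, rfl⟩
        conv_rhs => rw [← (hfc.mem_range hr).1]
        simp only [Function.comp]
        congr 1
        refine Prod.ext rfl ?_
        simp only
        rw [(hfc.mem_range hr).2, h.comm _ (hNI hq)]
      rw [map_congr e2] at h1
      rw [e]
      exact h1
    · have h4 : Tendsto Prod.snd (𝓝 (x₀, t₀)) (𝓝 t₀) := continuousAt_snd
      filter_upwards [h4.eventually (eventually_mem_nhds_iff.2 hN)] with q hq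
      refine continuousAt_fst.comp (ContinuousAt.comp (hfc.continuousAt ?_) ?_)
      · have hq' := mem_of_mem_nhds hq
        rw [h.comm _ (hNI hq'), ← hcN _ hq']; exact ⟨_, rfl⟩
      · refine h.cont.continuousAt ?_
        rw [← Prod.mk.eta (p := q)]
        exact prod_mem_nhds univ_mem (mem_of_superset hq hNI)
    · refine ⟨univ, univ_mem, fun x _ y _ hxy => h.inj t₀ ht₀I ?_⟩
      have hr : ∀ x, p (F (x, t₀)) ∈ range c := fun x => by
        rw [h.comm _ ht₀I, ← hc0]; exact ⟨0, rfl⟩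
      have e2 := hfc.mem_range (hr x)
      have e3 := hfc.mem_range (hr y)
      change F (x, t₀) = F (y, t₀)
      rw [← e2.1, ← e3.1]
      congr 1
      refine Prod.ext hxy ?_
      rw [e2.2, e3.2, h.comm _ ht₀I, h.comm _ ht₀I]
  · have h1 := map_mono (m := c) hs
    rw [hfc.base.map_nhds_eq, map_map, hcN t₀ (mem_of_mem_nhds hN)] at h1
    rwa [map_congr (show c ∘ (Function.invFun c ∘ γ) =ᶠ[𝓝 t₀] γ from
      by filter_upwards [hN] with t ht using hcN t ht)] at h1

end LineBundle

/-! ### Arcs in the base with parametrized fibres, and their continuation. -/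

section Arc

variable {E B : Type*} [TopologicalSpace E] [TopologicalSpace B]
variable {p : E → B} {f : ℝ × ℝ → E} {c : ℝ → B}

/-- A trivialized locally injective compact path in the base of `p`. -/
structure Arc (p : E → B) where
  a : ℝ
  b : ℝ
  γ : ℝ → B
  F : ℝ × ℝ → E
  lt : a < b
  dev : Dev p (Icc a b) γ F

/-- The arc `D'` extends the arc `D`. -/
structure Arc.Le (D D' : Arc p) : Prop where
  ha : D'.a ≤ D.a
  hb : D.b ≤ D'.b
  hγ : EqOn D'.γ D.γ (Icc D.a D.b)
  hF : EqOn D'.F D.F (univ ×ˢ Icc D.a D.b)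

/-- The underlying set of an arc. -/
def Arc.carrier (D : Arc p) : Set B := D.γ '' Icc D.a D.b

theorem Arc.Le.refl (D : Arc p) : D.Le D := ⟨le_rfl, le_rfl, fun _ _ => rfl, fun _ _ => rfl⟩

theorem Arc.Le.trans {D D' D'' : Arc p} (h : D.Le D') (h' : D'.Le D'') : D.Le D'' where
  ha := h'.ha.trans h.ha
  hb := h.hb.trans h'.hb
  hγ := fun _ ht => (h'.hγ (Icc_subset_Icc h.ha h.hb ht)).trans (h.hγ ht)
  hF := fun _ hq => (h'.hF ⟨hq.1, Icc_subset_Icc h.ha h.hb hq.2⟩).trans (h.hF hq)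

theorem Arc.Le.carrier_subset {D D' : Arc p} (h : D.Le D') : D.carrier ⊆ D'.carrier := by
  rintro _ ⟨t, ht, rfl⟩
  exact ⟨t, Icc_subset_Icc h.ha h.hb ht, h.hγ ht⟩

/-- The arc traversed backwards. -/
def Arc.reverse (D : Arc p) : Arc p where
  a := -D.b
  b := -D.a
  γ := D.γ ∘ Homeomorph.neg ℝ
  F := fun q => D.F (q.1, Homeomorph.neg ℝ q.2)
  lt := neg_lt_neg D.lt
  dev := (D.dev.comp (Homeomorph.neg ℝ)).mono fun t ht => by
    simp only [mem_Icc, mem_preimage, Homeomorph.coe_neg] at ht ⊢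
    exact ⟨by linarith [ht.2], by linarith [ht.1]⟩

theorem Arc.Le.reverse {D D' : Arc p} (h : D.reverse.Le D') : D.Le D'.reverse where
  ha := neg_le.1 h.hb
  hb := le_neg.1 h.ha
  hγ := fun t ht => by
    have := h.hγ (x := -t) ⟨neg_le_neg ht.2, neg_le_neg ht.1⟩
    simpa [Arc.reverse] using this
  hF := fun q hq => by
    have := h.hF (x := (q.1, -q.2)) ⟨mem_univ _, neg_le_neg hq.2.2, neg_le_neg hq.2.1⟩
    simpa [Arc.reverse] using this

theorem Arc.carrier_reverse (D : Arc p) : D.reverse.carrier = D.carrier := by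
  ext y
  constructor
  · rintro ⟨t, ht, rfl⟩
    exact ⟨-t, ⟨by linarith [ht.2, show D.reverse.b = -D.a from rfl],
      by linarith [ht.1, show D.reverse.a = -D.b from rfl]⟩, rfl⟩
  · rintro ⟨t, ht, rfl⟩
    exact ⟨-t, ⟨neg_le_neg ht.2, neg_le_neg ht.1⟩, by simp [Arc.reverse]⟩

/-- The hypothesis `hdir` says that the arc enters the chart from the negative side, so continuing
along positive chart parameters creates no fold at the end point. Over the new piece the fibres are
parametrized by `f` precomposed with the transition `g` between the two parametrizations of the
fibre over the end point, so that the pieces agree there. -/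
theorem Arc.exists_extend (D : Arc p) (h : LocTriv p f c) (h0 : c 0 = D.γ D.b)
    (hdir : ∀ᶠ t in 𝓝[<] D.b, ∃ v < 0, D.γ t = c v) {L : ℝ} (hL : 0 ≤ L) :
    ∃ D' : Arc p, D.Le D' ∧ D'.a = D.a ∧ D'.b = D.b + L ∧
      ∀ u ∈ Icc 0 L, D'.γ (D.b + u) = c u := by
  obtain ⟨a, b, γ, F, hab, hD⟩ := D
  simp only at h0 hdir ⊢
  have hbI : b ∈ Icc a b := ⟨hab.le, le_rfl⟩
  set g : ℝ → ℝ := fun x => (Function.invFun f (F (x, b))).1 with hg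
  have hr : ∀ x, p (F (x, b)) ∈ range c := fun x => by
    rw [hD.comm b hbI, ← h0]; exact ⟨0, rfl⟩
  have hfg : ∀ x, f (g x, 0) = F (x, b) := fun x => by
    obtain ⟨h1, h2⟩ := h.mem_range (hr x)
    conv_rhs => rw [← h1]
    congr 1
    refine Prod.ext rfl ?_
    rw [h2, hD.comm b hbI, ← h0, h.invFun_base_apply]
  have hgc : Continuous g := by
    have h1 : Continuous fun x => F (x, b) :=
      hD.cont.comp_continuous (by fun_prop) fun x => ⟨mem_univ _, hbI⟩
    exact continuous_iff_continuousAt.2 fun x =>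
      continuousAt_fst.comp (ContinuousAt.comp (f := fun x => F (x, b)) (h.continuousAt (hr x))
        h1.continuousAt)
  have hgi : Function.Injective g := fun x y hxy =>
    hD.inj b hbI (show F (x, b) = F (y, b) by rw [← hfg, ← hfg, hxy])
  have hgs : Function.Surjective g := fun y => by
    obtain ⟨x, hx⟩ := hD.surj b hbI (f (y, 0)) (by rw [h.comm, h0])
    exact ⟨x, by rw [hg]; simp only; rw [hx, h.invFun_apply]⟩
  have e1 : ∀ t ∈ Icc a b, ∀ x, (if t ≤ b then F (x, t) else f (g x, t - b)) = F (x, t) :=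
    fun t ht x => if_pos ht.2
  have e2 : ∀ t, b ≤ t → ∀ x, (if t ≤ b then F (x, t) else f (g x, t - b)) = f (g x, t - b) := by
    intro t ht x
    split_ifs with h'
    · obtain rfl := le_antisymm ht h'
      rw [sub_self, hfg]
    · rfl
  have e3 : ∀ t ∈ Icc a b, (if t ≤ b then γ t else c (t - b)) = γ t := fun t ht => if_pos ht.2
  have e4 : ∀ t, b ≤ t → (if t ≤ b then γ t else c (t - b)) = c (t - b) := by
    intro t ht
    split_ifs with h'
    · obtain rfl := le_antisymm ht h'
      rw [sub_self, h0]
    · rfl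
  have hcases : ∀ t ∈ Icc a (b + L), t ∈ Icc a b ∨ b ≤ t := fun t ht =>
    (le_total t b).imp (fun h => ⟨ht.1, h⟩) id
  refine ⟨⟨a, b + L, fun t => if t ≤ b then γ t else c (t - b),
    fun q => if q.2 ≤ b then F q else f (g q.1, q.2 - b), by linarith, ?_⟩,
    ⟨le_rfl, by simpa using hL, fun t ht => e3 t ht, fun q hq => e1 q.2 hq.2 q.1⟩, rfl, rfl,
    fun u hu => ?_⟩
  · constructor
    · have h1 : (univ : Set ℝ) ×ˢ Icc a (b + L) = univ ×ˢ Icc a b ∪ univ ×ˢ Icc b (b + L) := by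
        rw [← prod_union, Icc_union_Icc_eq_Icc hab.le (by linarith)]
      rw [h1]
      refine ContinuousOn.union_of_isClosed (hD.cont.congr fun q hq => e1 q.2 hq.2 q.1) ?_
        (isClosed_univ.prod isClosed_Icc) (isClosed_univ.prod isClosed_Icc)
      have h2 : Continuous fun q : ℝ × ℝ => f (g q.1, q.2 - b) := by
        have := h.emb.continuous
        fun_prop
      exact h2.continuousOn.congr fun q hq => e2 q.2 hq.2.1 q.1
    · intro t ht x
      rcases hcases t ht with h' | h'
      · simp only [e1 t h', e3 t h', hD.comm t h']
      · simp only [e2 t h', e4 t h', h.comm]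
    · intro t ht x y hxy
      rcases hcases t ht with h' | h'
      · simp only [e1 t h'] at hxy
        exact hD.inj t h' hxy
      · simp only [e2 t h'] at hxy
        exact hgi (Prod.mk.inj (h.emb.injective hxy)).1
    · intro t ht e he
      rcases hcases t ht with h' | h'
      · simp only [e1 t h', e3 t h'] at he ⊢
        exact hD.surj t h' e he
      · simp only [e2 t h', e4 t h'] at he ⊢
        obtain ⟨y, hy⟩ := h.surj _ e he
        obtain ⟨x, rfl⟩ := hgs y
        exact ⟨x, hy⟩
    · intro t ht
      rcases lt_trichotomy t b with h' | rfl | h'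
      · obtain ⟨N, hN, hinj⟩ := hD.locinj t ⟨ht.1, h'.le⟩
        obtain ⟨O, hO, htO, hON⟩ := mem_nhdsWithin.1 hN
        refine ⟨O ∩ Iio b ∩ Icc a (b + L), inter_mem (mem_nhdsWithin_of_mem_nhds
          ((hO.inter isOpen_Iio).mem_nhds ⟨htO, h'⟩)) self_mem_nhdsWithin, ?_⟩
        intro x hx y hy hxy
        have hx' : x ∈ Icc a b := ⟨hx.2.1, (show x < b from hx.1.2).le⟩
        have hy' : y ∈ Icc a b := ⟨hy.2.1, (show y < b from hy.1.2).le⟩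
        simp only [e3 x hx', e3 y hy'] at hxy
        exact hinj (hON ⟨hx.1.1, hx'⟩) (hON ⟨hy.1.1, hy'⟩) hxy
      · obtain ⟨N, hN, hinj⟩ := hD.locinj t hbI
        obtain ⟨O, hO, htO, hON⟩ := mem_nhdsWithin.1 hN
        obtain ⟨l, hl, hl'⟩ := mem_nhdsLT_iff_exists_Ioo_subset.1 hdir
        refine ⟨O ∩ Ioi l ∩ Icc a (t + L), inter_mem (mem_nhdsWithin_of_mem_nhds
          ((hO.inter isOpen_Ioi).mem_nhds ⟨htO, hl⟩)) self_mem_nhdsWithin, ?_⟩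
        -- At the junction the old piece has chart parameters `≤ 0` and the new piece has positive
        -- ones, so no point is taken on both sides.
        have hle : ∀ x ∈ O ∩ Ioi l ∩ Icc a (t + L), x ≤ t → ∃ v ≤ 0, γ x = c v := by
          intro x hx hxt
          rcases hxt.lt_or_eq with h3 | rfl
          · obtain ⟨v, hv, hv'⟩ := hl' ⟨hx.1.2, h3⟩
            exact ⟨v, hv.le, hv'⟩
          · exact ⟨0, le_rfl, h0.symm⟩
        intro x hx y hy hxy
        rcases le_or_gt x t with hx' | hx' <;> rcases le_or_gt y t with hy' | hy'
        · simp only [if_pos hx', if_pos hy'] at hxy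
          exact hinj (hON ⟨hx.1.1, hx.2.1, hx'⟩) (hON ⟨hy.1.1, hy.2.1, hy'⟩) hxy
        · simp only [if_pos hx', if_neg hy'.not_ge] at hxy
          obtain ⟨v, hv, hv'⟩ := hle x hx hx'
          rw [hv'] at hxy
          have := h.base.injective hxy
          linarith
        · simp only [if_pos hy', if_neg hx'.not_ge] at hxy
          obtain ⟨v, hv, hv'⟩ := hle y hy hy'
          rw [hv'] at hxy
          have := h.base.injective hxy
          linarith
        · simp only [if_neg hy'.not_ge, if_neg hx'.not_ge] at hxy
          have := h.base.injective hxy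
          linarith
      · refine ⟨Ioi b, mem_nhdsWithin_of_mem_nhds (Ioi_mem_nhds h'), ?_⟩
        intro x hx y hy hxy
        simp only [if_neg (mem_Ioi.1 hx).not_ge, if_neg (mem_Ioi.1 hy).not_ge] at hxy
        have := h.base.injective hxy
        linarith
  · exact (e4 (b + u) (by linarith [hu.1])).trans (by rw [add_sub_cancel_left])

/-- Local direction of an arc in a chart. -/
theorem Arc.local_direction (hp : Continuous p) (D : Arc p) (h : LocTriv p f c) {t₀ : ℝ}
    (ht₀ : t₀ ∈ Icc D.a D.b) (hr : D.γ t₀ ∈ range c) :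
    ∃ N ∈ 𝓝[Icc D.a D.b] t₀, N ⊆ Icc D.a D.b ∧
      (∀ t ∈ N, c (Function.invFun c (D.γ t)) = D.γ t) ∧
      (StrictMonoOn (Function.invFun c ∘ D.γ) N ∨ StrictAntiOn (Function.invFun c ∘ D.γ) N) := by
  obtain ⟨N, hN, hNI, hcont, hinj, hcN⟩ := D.dev.invFun_injOn h ht₀ hp hr
  obtain ⟨O, hO, htO, hON⟩ := mem_nhdsWithin.1 hN
  obtain ⟨ε, hε, hball⟩ := Metric.isOpen_iff.1 hO t₀ htO
  have hsub : Metric.ball t₀ ε ∩ Icc D.a D.b ⊆ N := fun t ht => hON ⟨hball ht.1, ht.2⟩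
  refine ⟨Metric.ball t₀ ε ∩ Icc D.a D.b, inter_mem (mem_nhdsWithin_of_mem_nhds
    (Metric.ball_mem_nhds _ hε)) self_mem_nhdsWithin, inter_subset_right,
    fun t ht => hcN t (hsub ht), ?_⟩
  refine strictMonoOn_or_strictAntiOn_of_injOn ?_ (hcont.mono hsub) (hinj.mono hsub)
  rw [Real.ball_eq_Ioo]
  exact ordConnected_Ioo.inter ordConnected_Icc

/-- Any chart centred at the end point will do, after reversing it when the arc arrives from its
positive side. -/
theorem Arc.exists_extend_length (hp : Continuous p) (hloc : ∀ b, ∃ f c, LocTriv p f c ∧ c 0 = b)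
    (D : Arc p) {L : ℝ} (hL : 0 ≤ L) :
    ∃ D' : Arc p, D.Le D' ∧ D'.a = D.a ∧ D'.b = D.b + L := by
  obtain ⟨f, c, hfc, hc0⟩ := hloc (D.γ D.b)
  have hbI : D.b ∈ Icc D.a D.b := ⟨D.lt.le, le_rfl⟩
  obtain ⟨N, hN, hNI, hcN, hdir⟩ := D.local_direction hp hfc hbI ⟨0, hc0⟩
  have h0 : Function.invFun c (D.γ D.b) = 0 := by rw [← hc0, hfc.invFun_base_apply]
  have hbN : D.b ∈ N := mem_of_mem_nhdsWithin hbI hN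
  have hN' : N ∩ Iio D.b ∈ 𝓝[<] D.b := by
    refine inter_mem ?_ self_mem_nhdsWithin
    rw [← nhdsWithin_Ico_eq_nhdsLT D.lt]
    exact nhdsWithin_mono _ Ico_subset_Icc_self hN
  rcases hdir with hdir | hdir
  · have hd : ∀ᶠ t in 𝓝[<] D.b, ∃ v < 0, D.γ t = c v := by
      filter_upwards [hN'] with t ht
      refine ⟨Function.invFun c (D.γ t), ?_, (hcN t ht.1).symm⟩
      have := hdir ht.1 hbN ht.2
      simpa [h0] using this
    obtain ⟨D', h1, h2, h3, -⟩ := D.exists_extend hfc hc0 hd hL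
    exact ⟨D', h1, h2, h3⟩
  · have hd : ∀ᶠ t in 𝓝[<] D.b, ∃ v < 0, D.γ t = (c ∘ Homeomorph.neg ℝ) v := by
      filter_upwards [hN'] with t ht
      refine ⟨-Function.invFun c (D.γ t), ?_, by simp [hcN t ht.1]⟩
      have := hdir ht.1 hbN ht.2
      simpa [h0] using this
    obtain ⟨D', h1, h2, h3, -⟩ := D.exists_extend (hfc.comp (Homeomorph.neg ℝ))
      (by simpa using hc0) hd hL
    exact ⟨D', h1, h2, h3⟩

theorem Arc.exists_extend_both (hp : Continuous p) (hloc : ∀ b, ∃ f c, LocTriv p f c ∧ c 0 = b)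
    (D : Arc p) : ∃ D' : Arc p, D.Le D' ∧ D'.a = D.a - 1 ∧ D'.b = D.b + 1 := by
  obtain ⟨D₁, h1, h2, h3⟩ := D.exists_extend_length hp hloc zero_le_one
  obtain ⟨D₂, k1, k2, k3⟩ := D₁.reverse.exists_extend_length hp hloc zero_le_one
  refine ⟨D₂.reverse, h1.trans k1.reverse, ?_, ?_⟩
  · have : D₂.b = -D₁.a + 1 := k3
    change -D₂.b = _
    rw [this, h2]; ring
  · have : D₂.a = -D₁.b := k2
    change -D₂.a = _
    rw [this, h3]; ring

end Arc

/-! ### Arcs reach every point of a connected base. -/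

section Reach

variable {E B : Type*} [TopologicalSpace E] [TopologicalSpace B]
variable {p : E → B} {f : ℝ × ℝ → E} {c : ℝ → B}

theorem exists_ne_mem_of_mem_nhdsWithin_Icc {a b t₀ : ℝ} (hab : a < b) (ht₀ : t₀ ∈ Icc a b)
    {N : Set ℝ} (hN : N ∈ 𝓝[Icc a b] t₀) : ∃ s ∈ N ∩ Icc a b, ∃ t ∈ N ∩ Icc a b, s < t ∧
      Icc s t ⊆ N ∧ (s = t₀ ∨ t = t₀) := by
  obtain ⟨O, hO, htO, hON⟩ := mem_nhdsWithin.1 hN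
  obtain ⟨ε, hε, hball⟩ := Metric.isOpen_iff.1 hO t₀ htO
  rw [Real.ball_eq_Ioo] at hball
  have key : ∀ s ∈ Icc a b, t₀ - ε < s → s < t₀ + ε → s ∈ N := fun s hs h1 h2 =>
    hON ⟨hball ⟨h1, h2⟩, hs⟩
  rcases ht₀.2.lt_or_eq with h | h
  · refine ⟨t₀, ⟨key t₀ ht₀ (by linarith) (by linarith), ht₀⟩, min (t₀ + ε / 2) b, ?_, ?_, ?_,
      Or.inl rfl⟩
    · have h1 : min (t₀ + ε / 2) b ∈ Icc a b :=
        ⟨le_min (by linarith [ht₀.1]) hab.le, min_le_right _ _⟩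
      have h2 : t₀ ≤ min (t₀ + ε / 2) b := le_min (by linarith) h.le
      exact ⟨key _ h1 (by linarith) (by linarith [min_le_left (t₀ + ε / 2) b]), h1⟩
    · exact lt_min (by linarith) h
    · intro x hx
      have := hx.2.trans (min_le_left _ _)
      exact key x ⟨ht₀.1.trans hx.1, hx.2.trans (min_le_right _ _)⟩ (by linarith [hx.1])
        (by linarith)
  · subst h
    refine ⟨max (t₀ - ε / 2) a, ?_, t₀, ⟨key t₀ ht₀ (by linarith) (by linarith), ht₀⟩, ?_, ?_,
      Or.inr rfl⟩
    · have h1 : max (t₀ - ε / 2) a ∈ Icc a t₀ :=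
        ⟨le_max_right _ _, max_le (by linarith) hab.le⟩
      exact ⟨key _ h1 (by linarith [le_max_left (t₀ - ε / 2) a]) (by linarith [h1.2]), h1⟩
    · exact max_lt (by linarith) hab
    · intro x hx
      have := (le_max_left _ _).trans hx.1
      exact key x ⟨(le_max_right _ _).trans hx.1, hx.2⟩ (by linarith) (by linarith [hx.2])

/-- Let `K` be the maximal parameter interval around `t₀` on which the arc stays in the chart; there
the chart parameter `τ` is increasing. If `τ` reaches `u₁` on `K`, the arc already covers the
segment. If not, `τ` stays below `u₁`, which keeps the arc from leaving the chart before its end, so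
`K` contains the end point and the arc can be continued along the chart up to `u₁`. -/
theorem Arc.exists_cover_up [T2Space B] (hp : Continuous p) (D : Arc p) (h : LocTriv p f c)
    {t₀ u₀ u₁ : ℝ} (ht₀ : t₀ ∈ Icc D.a D.b) (hu₀ : D.γ t₀ = c u₀) (hu : u₀ ≤ u₁) {N : Set ℝ}
    (hN : N ∈ 𝓝[Icc D.a D.b] t₀) (hmono : StrictMonoOn (Function.invFun c ∘ D.γ) N) :
    ∃ D' : Arc p, D.Le D' ∧ c '' Icc u₀ u₁ ⊆ D'.carrier := by
  set τ := Function.invFun c ∘ D.γ with hτ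
  have hγ := D.dev.continuousOn hp
  set S := Icc D.a D.b ∩ D.γ ⁻¹' range c with hS
  have hcτ : ∀ t ∈ S, c (τ t) = D.γ t := by
    rintro t ⟨-, u, hu⟩
    simp only [hτ, Function.comp]
    rw [← hu, h.invFun_base_apply]
  have hSnhds : ∀ t ∈ S, S ∈ 𝓝[Icc D.a D.b] t := fun t ht =>
    inter_mem self_mem_nhdsWithin (hγ t ht.1 (h.base.isOpen_range.mem_nhds ht.2))
  have hτc : ContinuousOn τ S := by
    intro t ht
    refine ContinuousAt.comp_continuousWithinAt (g := Function.invFun c) ?_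
      ((hγ t ht.1).mono inter_subset_left)
    rw [← hcτ t ht]
    exact continuousAt_invFun h.base _
  have ht₀S : t₀ ∈ S := ⟨ht₀, u₀, hu₀.symm⟩
  have hτ₀ : τ t₀ = u₀ := by simp only [hτ, Function.comp]; rw [hu₀, h.invFun_base_apply]
  set K := connectedComponentIn S t₀ with hK
  have hKS : K ⊆ S := connectedComponentIn_subset _ _
  have htK : t₀ ∈ K := mem_connectedComponentIn ht₀S
  have hKo : K.OrdConnected := isPreconnected_connectedComponentIn.ordConnected
  have hmax : ∀ t t' : ℝ, t₀ ∈ Icc t t' → Icc t t' ⊆ S → Icc t t' ⊆ K := fun t t' h1 h2 =>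
    isPreconnected_Icc.subset_connectedComponentIn h1 h2
  have hinj : InjOn τ K := by
    refine injOn_of_locally_injOn hKo (hτc.mono hKS) fun t ht => ?_
    obtain ⟨M, hM, hMinj⟩ := D.dev.locinj t (hKS ht).1
    refine ⟨M ∩ K, inter_mem (nhdsWithin_mono _ (fun x hx => (hKS hx).1) hM)
      self_mem_nhdsWithin, fun x hx y hy hxy => hMinj hx.1 hy.1 ?_⟩
    rw [← hcτ x (hKS hx.2), ← hcτ y (hKS hy.2), hxy]
  have hmK : StrictMonoOn τ K := by
    rcases strictMonoOn_or_strictAntiOn_of_injOn hKo (hτc.mono hKS) hinj with h1 | h1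
    · exact h1
    · exfalso
      obtain ⟨s, hs, t, ht, hst, hsub, hor⟩ :=
        exists_ne_mem_of_mem_nhdsWithin_Icc D.lt ht₀ (inter_mem hN (hSnhds t₀ ht₀S))
      have hsub' : Icc s t ⊆ K := hmax s t (by
        rcases hor with rfl | rfl
        · exact ⟨le_rfl, hst.le⟩
        · exact ⟨hst.le, le_rfl⟩) fun x hx => (hsub hx).2
      have e1 := hmono hs.1.1 ht.1.1 hst
      have e2 := h1 (hsub' ⟨le_rfl, hst.le⟩) (hsub' ⟨hst.le, le_rfl⟩) hst
      exact lt_asymm e1 e2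
  have hivt : ∀ t ∈ K, t₀ ≤ t → c '' Icc u₀ (τ t) ⊆ D.carrier := by
    rintro t ht htt _ ⟨u, hu, rfl⟩
    have hsub : Icc t₀ t ⊆ K := hKo.out htK ht
    have := intermediate_value_Icc htt ((hτc.mono hKS).mono hsub)
    rw [hτ₀] at this
    obtain ⟨s, hs, rfl⟩ := this hu
    exact ⟨s, (hKS (hsub hs)).1, (hcτ s (hKS (hsub hs))).symm⟩
  by_cases hex : ∃ t ∈ K, u₁ ≤ τ t
  · obtain ⟨t, ht, htu⟩ := hex
    have htt : t₀ ≤ t := (hmK.le_iff_le htK ht).1 (by rw [hτ₀]; exact hu.trans htu)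
    exact ⟨D, Arc.Le.refl D, (image_mono (Icc_subset_Icc le_rfl htu)).trans (hivt t ht htt)⟩
  · push Not at hex
    set s := sSup K with hs
    have hbdd : BddAbove K := ⟨D.b, fun t ht => (hKS ht).1.2⟩
    have hsb : s ≤ D.b := csSup_le ⟨t₀, htK⟩ fun t ht => (hKS ht).1.2
    have hts : t₀ ≤ s := le_csSup hbdd htK
    have hsI : s ∈ Icc D.a D.b := ⟨ht₀.1.trans hts, hsb⟩
    have hIco : ∀ t, t₀ ≤ t → t < s → t ∈ K := by
      intro t h1 h2
      obtain ⟨k, hk, hk'⟩ := exists_lt_of_lt_csSup ⟨t₀, htK⟩ h2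
      exact hKo.out htK hk ⟨h1, hk'.le⟩
    have hsK : s ∈ K := by
      rcases hts.lt_or_eq with hlt | heq
      · have hIco' : Ico t₀ s ⊆ K := fun t ht => hIco t ht.1 ht.2
        have hm' : MonotoneOn τ (Ico t₀ s) := hmK.monotoneOn.mono hIco'
        -- `τ` is monotone and bounded by `u₁`, so it converges. Since the base is Hausdorff, `D.γ
        -- s` is the chart point at the limit, and the arc is still in the chart at `s`.
        have hlim : Tendsto τ (𝓝[<] s) (𝓝 (sSup (τ '' Ioo t₀ s))) := by
          refine MonotoneOn.tendsto_nhdsWithin_Ioo_left ⟨(t₀ + s) / 2, by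
            constructor <;> linarith⟩ (hm'.mono Ioo_subset_Ico_self) ?_
          exact ⟨u₁, by rintro _ ⟨t, ht, rfl⟩; exact (hex t (hIco t ht.1.le ht.2)).le⟩
        have hlim1 : Tendsto (fun t => c (τ t)) (𝓝[<] s) (𝓝 (c (sSup (τ '' Ioo t₀ s)))) :=
          h.base.continuous.continuousAt.tendsto.comp hlim
        have hmem : Ioo t₀ s ∈ 𝓝[<] s := Ioo_mem_nhdsLT hlt
        have hlim2 : Tendsto D.γ (𝓝[<] s) (𝓝 (D.γ s)) := by
          rw [← nhdsWithin_Ioo_eq_nhdsLT hlt]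
          exact (hγ s hsI).mono fun t ht => (hKS (hIco t ht.1.le ht.2)).1
        have hlim3 : Tendsto D.γ (𝓝[<] s) (𝓝 (c (sSup (τ '' Ioo t₀ s)))) :=
          hlim1.congr' (by
            filter_upwards [hmem] with t ht using hcτ t (hKS (hIco t ht.1.le ht.2)))
        have heq := tendsto_nhds_unique hlim2 hlim3
        refine hmax t₀ s ⟨le_rfl, hts⟩ ?_ ⟨hts, le_rfl⟩
        intro t ht
        rcases ht.2.lt_or_eq with h1 | rfl
        · exact hKS (hIco t ht.1 h1)
        · exact ⟨hsI, _, heq.symm⟩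
      · rw [← heq]; exact htK
    have hsb' : s = D.b := by
      by_contra hne
      have hlt : s < D.b := lt_of_le_of_ne hsb hne
      obtain ⟨O, hO, hsO, hOS⟩ := mem_nhdsWithin.1 (hSnhds s (hKS hsK))
      obtain ⟨ε, hε, hball⟩ := Metric.isOpen_iff.1 hO s hsO
      rw [Real.ball_eq_Ioo] at hball
      have : min (s + ε / 2) D.b ∈ K := by
        refine hmax t₀ _ ⟨le_rfl, hts.trans (le_min (by linarith) hsb)⟩ ?_
          ⟨hts.trans (le_min (by linarith) hsb), le_rfl⟩
        intro t ht
        have h2 := ht.2.trans (min_le_left _ _)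
        rcases lt_or_ge t s with h1 | h1
        · exact hKS (hIco t ht.1 h1)
        · exact hOS ⟨hball ⟨by linarith, by linarith⟩, ht₀.1.trans ht.1,
            ht.2.trans (min_le_right _ _)⟩
      have := le_csSup hbdd this
      have h3 : s < min (s + ε / 2) D.b := lt_min (by linarith) hlt
      exact absurd h3 (not_lt.2 this)
    have hbK : D.b ∈ K := hsb' ▸ hsK
    have hd : ∀ᶠ t in 𝓝[<] D.b, ∃ v < 0, D.γ t = (c ∘ Homeomorph.addRight (τ D.b)) v := by
      obtain ⟨l, hl, hl'⟩ := mem_nhdsLT_iff_exists_Ioo_subset.1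
        (show S ∩ Iio D.b ∈ 𝓝[<] D.b from inter_mem (by
          rw [← nhdsWithin_Ico_eq_nhdsLT D.lt]
          exact nhdsWithin_mono _ Ico_subset_Icc_self (hSnhds _ (hKS hbK))) self_mem_nhdsWithin)
      have : Ioo l D.b ∈ 𝓝[<] D.b := Ioo_mem_nhdsLT hl
      filter_upwards [this] with t ht
      have htK' : t ∈ K := by
        rcases lt_or_ge t t₀ with h1 | h1
        · refine hmax t t₀ ⟨h1.le, le_rfl⟩ ?_ ⟨le_rfl, h1.le⟩
          intro x hx
          rcases (hx.2.trans ht₀.2).lt_or_eq with h2 | rfl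
          · exact (hl' ⟨ht.1.trans_le hx.1, h2⟩).1
          · exact hKS hbK
        · exact hIco t h1 (hsb' ▸ ht.2)
      refine ⟨τ t - τ D.b, sub_neg.2 (hmK htK' hbK ht.2), ?_⟩
      simp [hcτ t (hKS htK')]
    -- Translating the chart by `τ D.b` gives the end point the parameter `0`, and `u₁ - τ D.b` is
    -- the length still missing.
    obtain ⟨D', h1, h2, h3, h4⟩ := D.exists_extend (h.comp (Homeomorph.addRight (τ D.b)))
      (by simpa using hcτ _ (hKS hbK)) hd (L := u₁ - τ D.b) (by linarith [hex _ hbK])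
    refine ⟨D', h1, ?_⟩
    rintro _ ⟨u, hu', rfl⟩
    rcases le_total u (τ D.b) with h5 | h5
    · exact h1.carrier_subset (hivt _ hbK (hsb' ▸ hts) ⟨u, ⟨hu'.1, h5⟩, rfl⟩)
    · refine ⟨D.b + (u - τ D.b), ?_, ?_⟩
      · rw [h2, h3]
        exact ⟨by linarith [D.lt], by linarith [hu'.2]⟩
      · rw [h4 _ ⟨by linarith, by linarith [hu'.2]⟩]
        simp

theorem Arc.exists_cover_segment [T2Space B] (hp : Continuous p) (D : Arc p)
    (h : LocTriv p f c) {u₀ u₁ : ℝ} (hu₀ : c u₀ ∈ D.carrier) (hu : u₀ ≤ u₁) :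
    ∃ D' : Arc p, D.Le D' ∧ c '' Icc u₀ u₁ ⊆ D'.carrier := by
  obtain ⟨t₀, ht₀, heq⟩ := hu₀
  obtain ⟨N, hN, hNI, hcN, hdir⟩ := D.local_direction hp h ht₀ ⟨u₀, heq.symm⟩
  rcases hdir with hdir | hdir
  · exact D.exists_cover_up hp h ht₀ heq hu hN hdir
  -- When the arc runs against the chart, the reversed arc runs along it.
  · have hN' : Neg.neg ⁻¹' N ∈ 𝓝[Icc D.reverse.a D.reverse.b] (-t₀) := by
      have hc : ContinuousWithinAt (fun t : ℝ => -t) (Icc D.reverse.a D.reverse.b) (-t₀) :=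
        continuous_neg.continuousWithinAt
      have := hc.tendsto_nhdsWithin (t := Icc D.a D.b) fun t ht =>
        ⟨le_neg.1 (show t ≤ -D.a from ht.2), neg_le.1 (show -D.b ≤ t from ht.1)⟩
      rw [neg_neg] at this
      exact this hN
    obtain ⟨D', h1, h2⟩ := D.reverse.exists_cover_up hp h (t₀ := -t₀) (u₀ := u₀)
      ⟨neg_le_neg ht₀.2, neg_le_neg ht₀.1⟩ (by simpa [Arc.reverse] using heq) hu
      hN' fun x hx y hy hxy => hdir (a := -y) hy hx (neg_lt_neg hxy)
    exact ⟨D'.reverse, h1.reverse, by rwa [Arc.carrier_reverse]⟩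

theorem Arc.exists_cover [T2Space B] (hp : Continuous p) (D : Arc p)
    (h : LocTriv p f c) {u₀ : ℝ} (hu₀ : c u₀ ∈ D.carrier) (k : ℝ) :
    ∃ D' : Arc p, D.Le D' ∧ c '' Icc (-k) k ⊆ D'.carrier := by
  obtain ⟨D₁, h1, h2⟩ := D.exists_cover_segment hp h hu₀ (le_max_left u₀ k)
  obtain ⟨D₂, h3, h4⟩ := D₁.exists_cover_segment hp (h.comp (Homeomorph.neg ℝ)) (u₀ := -u₀)
    (by simpa using h1.carrier_subset hu₀) (le_max_left (-u₀) k)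
  refine ⟨D₂, h1.trans h3, ?_⟩
  rintro _ ⟨u, hu, rfl⟩
  rcases le_total u₀ u with h5 | h5
  · exact h3.carrier_subset (h2 ⟨u, ⟨h5, hu.2.trans (le_max_right _ _)⟩, rfl⟩)
  · exact h4 ⟨-u, ⟨neg_le_neg h5, (neg_le.1 hu.1).trans (le_max_right _ _)⟩, by simp⟩

/-- Every point of a connected base can be reached from a given arc. -/
theorem Arc.exists_reach [T2Space B] [ConnectedSpace B] (hp : Continuous p)
    (hloc : ∀ b, ∃ f c, LocTriv p f c ∧ c 0 = b) (D : Arc p) (y : B) :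
    ∃ D' : Arc p, D.Le D' ∧ y ∈ D'.carrier := by
  set R : Set B := {y | ∃ D' : Arc p, D.Le D' ∧ y ∈ D'.carrier} with hR
  -- A chart that meets the set of reachable points lies in it, so this set is open and closed.
  have key : ∀ y f c, LocTriv p f c → c 0 = y → (range c ∩ R).Nonempty → range c ⊆ R := by
    rintro y f c h hc0 ⟨_, ⟨u, rfl⟩, D', hD', hu⟩ _ ⟨v, rfl⟩
    obtain ⟨D'', h1, h2⟩ := D'.exists_cover hp h hu |v|
    exact ⟨D'', hD'.trans h1, h2 ⟨v, ⟨neg_abs_le v, le_abs_self v⟩, rfl⟩⟩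
  have hclopen : IsClopen R := by
    constructor
    · refine isClosed_of_closure_subset fun y hy => ?_
      obtain ⟨f, c, h, hc0⟩ := hloc y
      have hy' : y ∈ range c := ⟨0, hc0⟩
      exact key y f c h hc0 (mem_closure_iff.1 hy _ h.base.isOpen_range hy') hy'
    · refine isOpen_iff_mem_nhds.2 fun y hy => ?_
      obtain ⟨f, c, h, hc0⟩ := hloc y
      have hy' : y ∈ range c := ⟨0, hc0⟩
      exact mem_of_superset (h.base.isOpen_range.mem_nhds hy') (key y f c h hc0 ⟨y, hy', hy⟩)
  have hne : R.Nonempty := ⟨D.γ D.a, D, Arc.Le.refl D, D.a, ⟨le_rfl, D.lt.le⟩, rfl⟩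
  have := hclopen.eq_univ hne
  exact (this ▸ mem_univ y : y ∈ R)

/-- One stage of the exhaustion: the core of a prescribed chart is swallowed, and each end grows by
at least one so that the parameter intervals fill `ℝ`. -/
theorem Arc.exists_step [T2Space B] [ConnectedSpace B] (hp : Continuous p)
    (hloc : ∀ b, ∃ f c, LocTriv p f c ∧ c 0 = b) (h : LocTriv p f c) (D : Arc p) :
    ∃ D' : Arc p, D.Le D' ∧ c '' Icc (-1) 1 ⊆ D'.carrier ∧ D'.a ≤ D.a - 1 ∧ D.b + 1 ≤ D'.b := by
  obtain ⟨D₁, h1, h2⟩ := D.exists_reach hp hloc (c 0)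
  obtain ⟨D₂, h3, h4⟩ := D₁.exists_cover hp h h2 1
  obtain ⟨D₃, h5, h6, h7⟩ := D₂.exists_extend_both hp hloc
  refine ⟨D₃, (h1.trans h3).trans h5, h4.trans h5.carrier_subset, ?_, ?_⟩
  · rw [h6]; linarith [(h1.trans h3).ha]
  · rw [h7]; linarith [(h1.trans h3).hb]

end Reach

/-! ### The base is a line or a circle. -/

section Classification

variable {E B : Type*} [TopologicalSpace E] [TopologicalSpace B]
variable {p : E → B} {f : ℝ × ℝ → E} {c : ℝ → B}

theorem LocTriv.dev (h : LocTriv p f c) (I : Set ℝ) : Dev p I c f where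
  cont := h.emb.continuous.continuousOn
  comm t _ x := h.comm x t
  inj _ _ _ _ hxy := (Prod.mk.inj (h.emb.injective hxy)).1
  surj t _ := h.surj t
  locinj _ _ := ⟨univ, univ_mem, h.base.injective.injOn⟩

/-- The arc carried by a trivialization. -/
def LocTriv.arc (h : LocTriv p f c) : Arc p := ⟨-1, 1, c, f, by norm_num, h.dev _⟩

/-- Countably many chart cores cover the base. A chain of arcs absorbs them one by one while its
parameter intervals exhaust `ℝ`, so the union is a surjective path `γ` with parametrized fibres. It
is injective because every arc is, and the map of total spaces is open by `Dev.nhds_le_map`. -/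
theorem exists_homeomorph_of_injOn [T2Space B] [ConnectedSpace B] [SecondCountableTopology B]
    (hp : Continuous p) (hloc : ∀ b, ∃ f c, LocTriv p f c ∧ c 0 = b)
    (hinj : ∀ D : Arc p, InjOn D.γ (Icc D.a D.b)) :
    ∃ (Φ : ℝ × ℝ ≃ₜ E) (γ : ℝ → B), Function.Injective γ ∧ ∀ x t, p (Φ (x, t)) = γ t := by
  choose f c hfc hc0 using hloc
  have hcov : ∀ b, c b '' Icc (-1) 1 ∈ 𝓝 b := fun b => by
    have h : Icc (-1) 1 ∈ 𝓝 (0 : ℝ) := Icc_mem_nhds (by norm_num) (by norm_num)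
    have := image_mem_map (m := c b) h
    rwa [(hfc b).base.map_nhds_eq, hc0] at this
  obtain ⟨s, hs, hsU⟩ := TopologicalSpace.countable_cover_nhds hcov
  have hsne : s.Nonempty := by
    obtain ⟨b⟩ := (inferInstance : Nonempty B)
    have : b ∈ ⋃ x ∈ s, c x '' Icc (-1) 1 := hsU ▸ mem_univ b
    simp only [mem_iUnion] at this
    obtain ⟨x, hx, -⟩ := this
    exact ⟨x, hx⟩
  obtain ⟨e, he⟩ := hs.exists_eq_range hsne
  have hloc : ∀ b, ∃ f c, LocTriv p f c ∧ c 0 = b := fun b => ⟨f b, c b, hfc b, hc0 b⟩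
  choose G hG1 hG2 hG3 hG4 using fun (n : ℕ) (D : Arc p) =>
    D.exists_step hp hloc (hfc (e n))
  let A : ℕ → Arc p := fun n => Nat.rec (hfc (e 0)).arc (fun n D => G n D) n
  have hA : ∀ n, A (n + 1) = G n (A n) := fun n => rfl
  have hle : ∀ n m, n ≤ m → (A n).Le (A m) := by
    intro n m hnm
    induction m, hnm using Nat.le_induction with
    | base => exact Arc.Le.refl _
    | succ m _ ih => exact ih.trans (hA m ▸ hG1 m (A m))
  have ha : ∀ n : ℕ, (A n).a ≤ -n - 1 ∧ (n : ℝ) + 1 ≤ (A n).b := by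
    intro n
    induction n with
    | zero =>
      change (-1 : ℝ) ≤ -((0 : ℕ) : ℝ) - 1 ∧ ((0 : ℕ) : ℝ) + 1 ≤ 1
      simp
    | succ n ih =>
      rw [hA]
      have h1 := hG3 n (A n)
      have h2 := hG4 n (A n)
      push_cast
      constructor <;> linarith [ih.1, ih.2]
  have hmem : ∀ (n : ℕ) (t : ℝ), |t| ≤ n → t ∈ Ioo (A n).a (A n).b := fun n t ht => by
    obtain ⟨h1, h2⟩ := abs_le.1 ht
    exact ⟨by linarith [(ha n).1], by linarith [(ha n).2]⟩
  -- The arc with index `⌈|t|⌉₊` is defined at `t`; by coherence of the chain any other arc defined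
  -- there gives the same value.
  let γ : ℝ → B := fun t => (A ⌈|t|⌉₊).γ t
  let F : ℝ × ℝ → E := fun q => (A ⌈|q.2|⌉₊).F q
  have hcoh : ∀ n m t, t ∈ Icc (A n).a (A n).b → t ∈ Icc (A m).a (A m).b →
      (A n).γ t = (A m).γ t ∧ ∀ x, (A n).F (x, t) = (A m).F (x, t) := by
    intro n m t h1 h2
    rcases le_total n m with h | h
    · exact ⟨((hle n m h).hγ h1).symm, fun x => ((hle n m h).hF ⟨mem_univ _, h1⟩).symm⟩
    · exact ⟨(hle m n h).hγ h2, fun x => (hle m n h).hF ⟨mem_univ _, h2⟩⟩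
  have hγ : ∀ n t, t ∈ Icc (A n).a (A n).b → γ t = (A n).γ t ∧ ∀ x, F (x, t) = (A n).F (x, t) :=
    fun n t ht => hcoh _ n t (Ioo_subset_Icc_self (hmem _ t (Nat.le_ceil _))) ht
  have hdevn : ∀ n, Dev p (Icc (A n).a (A n).b) γ F := fun n =>
    (A n).dev.congr (fun t ht => (hγ n t ht).1) fun q hq => (hγ n q.2 hq.2).2 q.1
  have hex : ∀ t : ℝ, ∃ n : ℕ, t ∈ Ioo (A n).a (A n).b := fun t =>
    ⟨⌈|t|⌉₊, hmem _ t (Nat.le_ceil _)⟩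
  have hγinj : Function.Injective γ := by
    intro t t' htt
    have h1 := hmem ⌈max |t| |t'|⌉₊ t ((le_max_left _ _).trans (Nat.le_ceil _))
    have h2 := hmem ⌈max |t| |t'|⌉₊ t' ((le_max_right _ _).trans (Nat.le_ceil _))
    refine hinj (A _) (Ioo_subset_Icc_self h1) (Ioo_subset_Icc_self h2) ?_
    rw [← (hγ _ _ (Ioo_subset_Icc_self h1)).1, ← (hγ _ _ (Ioo_subset_Icc_self h2)).1, htt]
  have hγs : Function.Surjective γ := by
    intro b
    have hb : b ∈ ⋃ x ∈ s, c x '' Icc (-1) 1 := hsU ▸ mem_univ b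
    simp only [mem_iUnion] at hb
    obtain ⟨x, hx, hb⟩ := hb
    rw [he] at hx
    obtain ⟨n, rfl⟩ := hx
    have h3 : b ∈ (A (n + 1)).carrier := hG2 n (A n) hb
    obtain ⟨t, ht, rfl⟩ := h3
    exact ⟨t, (hγ (n + 1) t ht).1⟩
  have hcomm : ∀ x t, p (F (x, t)) = γ t := fun x t => by
    obtain ⟨n, hn⟩ := hex t
    exact (hdevn n).comm t (Ioo_subset_Icc_self hn) x
  have hbij : Function.Bijective F := by
    constructor
    · rintro ⟨x, t⟩ ⟨x', t'⟩ heq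
      have : t = t' := hγinj (by rw [← hcomm x, ← hcomm x', heq])
      subst this
      obtain ⟨n, hn⟩ := hex t
      rw [(hdevn n).inj t (Ioo_subset_Icc_self hn) heq]
    · intro y
      obtain ⟨t, ht⟩ := hγs (p y)
      obtain ⟨n, hn⟩ := hex t
      obtain ⟨x, hx⟩ := (hdevn n).surj t (Ioo_subset_Icc_self hn) y ht.symm
      exact ⟨_, hx⟩
  have hFc : Continuous F := continuous_iff_continuousAt.2 fun q => by
    obtain ⟨n, hn⟩ := hex q.2
    refine (hdevn n).cont.continuousAt ?_
    rw [← Prod.mk.eta (p := q)]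
    exact prod_mem_nhds univ_mem (Icc_mem_nhds hn.1 hn.2)
  have hFo : IsOpenMap F := IsOpenMap.of_nhds_le fun q => by
    obtain ⟨n, hn⟩ := hex q.2
    exact ((hdevn n).nhds_le_map hp hloc (t₀ := q.2) (x₀ := q.1)
      (Icc_mem_nhds hn.1 hn.2)).1
  exact ⟨(Equiv.ofBijective F hbij).toHomeomorphOfContinuousOpen hFc hFo, γ, hγinj, hcomm⟩

/-- Local injectivity keeps double points away from the diagonal, so the pairs `s ≤ t` with equal
images outside a neighbourhood of the diagonal form a compact set. A pair minimizing `t - s` admits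
no double point inside `[s, t)`. -/
theorem exists_minimal_loop [T2Space B] (hp : Continuous p) (D : Arc p)
    (hD : ¬ InjOn D.γ (Icc D.a D.b)) : ∃ s t, s < t ∧ Icc s t ⊆ Icc D.a D.b ∧
      D.γ s = D.γ t ∧ InjOn D.γ (Ico s t) := by
  obtain ⟨a, b, γ, F, hab, hdev⟩ := D
  simp only at hD ⊢
  have hγ := hdev.continuousOn hp
  set P : Set (ℝ × ℝ) := (Icc a b ×ˢ Icc a b) ∩ (fun q : ℝ × ℝ => (γ q.1, γ q.2)) ⁻¹' diagonal B
  have hPc : IsClosed P := by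
    refine ContinuousOn.preimage_isClosed_of_isClosed ?_ (isClosed_Icc.prod isClosed_Icc)
      isClosed_diagonal
    exact (hγ.comp continuousOn_fst fun q hq => hq.1).prodMk
      (hγ.comp continuousOn_snd fun q hq => hq.2)
  have hPcomp : IsCompact P :=
    (isCompact_Icc.prod isCompact_Icc).of_isClosed_subset hPc inter_subset_left
  -- An open neighbourhood of the diagonal of `[a, b]` that contains no off-diagonal double point.
  set U : Set (ℝ × ℝ) := ⋃ O : {O : Set ℝ // IsOpen O ∧ InjOn γ (O ∩ Icc a b)}, O.1 ×ˢ O.1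
  have hU : IsOpen U := isOpen_iUnion fun O => O.2.1.prod O.2.1
  have hdiag : ∀ t ∈ Icc a b, (t, t) ∈ U := by
    intro t ht
    obtain ⟨N, hN, hinj⟩ := hdev.locinj t ht
    obtain ⟨O, hO, htO, hON⟩ := mem_nhdsWithin.1 hN
    exact mem_iUnion.2 ⟨⟨O, hO, hinj.mono hON⟩, htO, htO⟩
  have hoff : ∀ s ∈ Icc a b, ∀ t ∈ Icc a b, s < t → γ s = γ t →
      (s, t) ∈ (P \ U) ∩ {q | q.1 ≤ q.2} := by
    intro s hs t ht hst heq
    refine ⟨⟨⟨⟨hs, ht⟩, heq⟩, fun hU => ?_⟩, hst.le⟩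
    obtain ⟨O, hO⟩ := mem_iUnion.1 hU
    exact hst.ne (O.2.2 ⟨hO.1, hs⟩ ⟨hO.2, ht⟩ heq)
  have hQ : IsCompact ((P \ U) ∩ {q : ℝ × ℝ | q.1 ≤ q.2}) :=
    (hPcomp.diff hU).inter_right (isClosed_le continuous_fst continuous_snd)
  have hne : ((P \ U) ∩ {q : ℝ × ℝ | q.1 ≤ q.2}).Nonempty := by
    simp only [InjOn, not_forall] at hD
    obtain ⟨s, hs, t, ht, heq, hst⟩ := hD
    rcases lt_or_gt_of_ne hst with h | h
    · exact ⟨_, hoff s hs t ht h heq⟩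
    · exact ⟨_, hoff t ht s hs h heq.symm⟩
  obtain ⟨⟨s, t⟩, ⟨⟨⟨⟨hs, ht⟩, heq⟩, hstU⟩, hst⟩, hmin⟩ :=
    hQ.exists_isMinOn hne (f := fun q => q.2 - q.1) (by fun_prop)
  simp only [mem_ofPred_eq] at hst hs ht
  have hst' : s < t := lt_of_le_of_ne hst (by rintro rfl; exact hstU (hdiag s hs))
  have hno : ∀ x ∈ Ico s t, ∀ y ∈ Ico s t, x < y → γ x ≠ γ y := by
    intro x hx y hy hxy hxyeq
    have := hmin (hoff x ⟨hs.1.trans hx.1, hx.2.le.trans ht.2⟩ y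
      ⟨hs.1.trans hy.1, hy.2.le.trans ht.2⟩ hxy hxyeq)
    simp only [mem_ofPred_eq] at this
    linarith [hx.1, hy.2]
  refine ⟨s, t, hst', Icc_subset_Icc hs.1 ht.2, heq, fun x hx y hy hxy => ?_⟩
  rcases lt_trichotomy x y with h | h | h
  · exact (hno x hx y hy h hxy).elim
  · exact h
  · exact (hno y hy x hx h hxy.symm).elim

/-- The image is compact, hence closed. It is also open: at inner parameters by `Dev.nhds_le_map`,
and at the base point by reading the loop as the path `δ` that runs across the junction. -/
theorem image_loop_eq_univ [T2Space B] [ConnectedSpace B] (hp : Continuous p)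
    (hloc : ∀ b, ∃ f c, LocTriv p f c ∧ c 0 = b) {γ : ℝ → B} {F : ℝ × ℝ → E}
    (hD : Dev p (Icc 0 1) γ F) (hinj : InjOn γ (Ico 0 1)) (h01 : γ 0 = γ 1) :
    γ '' Icc 0 1 = univ := by
  have hγ := hD.continuousOn hp
  refine IsClopen.eq_univ ⟨(isCompact_Icc.image_of_continuousOn hγ).isClosed, ?_⟩
    ⟨γ 0, 0, by simp, rfl⟩
  have hend : γ '' Icc 0 1 ∈ 𝓝 (γ 0) := by
    obtain ⟨f, c, hfc, hc0⟩ := hloc (γ 0)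
    set δ : ℝ → B := fun t => if 0 ≤ t then γ t else γ (1 + t) with hδ
    have hδc : ContinuousOn δ (Icc (-1 / 2) (1 / 2)) := by
      rw [← Icc_union_Icc_eq_Icc (show (-1 / 2 : ℝ) ≤ 0 by norm_num) (by norm_num)]
      refine ContinuousOn.union_of_isClosed ?_ ?_ isClosed_Icc isClosed_Icc
      · have h1 : ContinuousOn (fun t => γ (1 + t)) (Icc (-1 / 2) 0) :=
          hγ.comp (by fun_prop) fun t ht => ⟨by linarith [ht.1], by linarith [ht.2]⟩
        refine h1.congr fun t ht => ?_
        simp only [hδ]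
        split_ifs with h
        · rw [le_antisymm ht.2 h, h01, add_zero]
        · rfl
      · exact (hγ.mono (Icc_subset_Icc le_rfl (by norm_num))).congr fun t ht => if_pos ht.1
    have hδI : ∀ t ∈ Ico (-1 / 2 : ℝ) (1 / 2), δ t ∈ γ '' Icc 0 1 := by
      intro t ht
      simp only [hδ]
      split_ifs with h
      · exact ⟨t, ⟨h, by linarith [ht.2]⟩, rfl⟩
      · exact ⟨1 + t, ⟨by linarith [ht.1], by linarith⟩, rfl⟩
    -- The interval is half-open because `δ` takes the value `γ (1 / 2)` at both `-1 / 2` and `1 /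
    -- 2`.
    have hδi : InjOn δ (Ico (-1 / 2) (1 / 2)) := by
      intro x hx y hy hxy
      simp only [hδ] at hxy
      split_ifs at hxy with h1 h2 h2
      · exact hinj ⟨h1, by linarith [hx.2]⟩ ⟨h2, by linarith [hy.2]⟩ hxy
      · have := hinj ⟨h1, by linarith [hx.2]⟩ ⟨by linarith [hy.1], by linarith⟩ hxy
        linarith [hx.2, hy.1]
      · have := hinj ⟨by linarith [hx.1], by linarith⟩ ⟨h2, by linarith [hy.2]⟩ hxy
        linarith [hx.1, hy.2]
      · have := hinj (x₁ := 1 + x) (x₂ := 1 + y) ⟨by linarith [hx.1], by linarith⟩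
          ⟨by linarith [hy.1], by linarith⟩ hxy
        linarith
    have hδ0 : δ 0 = c 0 := by simp only [hδ, le_refl, if_true]; rw [hc0]
    have hδn : ∀ t ∈ Ioo (-1 / 2 : ℝ) (1 / 2), ContinuousAt δ t := fun t ht =>
      hδc.continuousAt (Icc_mem_nhds ht.1 ht.2)
    have h00 : (0 : ℝ) ∈ Ioo (-1 / 2 : ℝ) (1 / 2) := by constructor <;> norm_num
    have hM : {t | t ∈ Ioo (-1 / 2 : ℝ) (1 / 2) ∧ δ t ∈ range c} ∈ 𝓝 (0 : ℝ) :=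
      inter_mem (Ioo_mem_nhds h00.1 h00.2) (hδn 0 h00
        (hfc.base.isOpen_range.mem_nhds ⟨0, hδ0.symm⟩))
    have hcδ : ∀ t, δ t ∈ range c → c (Function.invFun c (δ t)) = δ t := by
      rintro t ⟨u, hu⟩
      rw [← hu, hfc.invFun_base_apply]
    have key := nhds_le_map_of_injOn (f := Function.invFun c ∘ δ) (t₀ := 0) ?_ ⟨_, hM, ?_⟩
    · have h1 := map_mono (m := c) key
      rw [hfc.base.map_nhds_eq, map_map] at h1
      have h2 : c ((Function.invFun c ∘ δ) 0) = γ 0 := by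
        simp only [Function.comp]
        rw [hcδ 0 ⟨0, hδ0.symm⟩, hδ0, hc0]
      rw [h2] at h1
      refine h1 ?_
      rw [mem_map]
      filter_upwards [hM] with t ht
      simp only [mem_preimage, Function.comp]
      rw [hcδ t ht.2]
      exact hδI t ⟨ht.1.1.le, ht.1.2⟩
    · filter_upwards [hM] with t ht
      refine ContinuousAt.comp ?_ (hδn t ht.1)
      rw [← hcδ t ht.2]
      exact continuousAt_invFun hfc.base _
    · intro x hx y hy hxy
      refine hδi ⟨hx.1.1.le, hx.1.2⟩ ⟨hy.1.1.le, hy.1.2⟩ ?_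
      rw [← hcδ x hx.2, ← hcδ y hy.2]
      exact congrArg c hxy
  refine isOpen_iff_mem_nhds.2 ?_
  rintro _ ⟨t, ht, rfl⟩
  rcases ht.1.eq_or_lt with rfl | h0
  · exact hend
  rcases ht.2.eq_or_lt with rfl | h1
  · rw [← h01]; exact hend
  · exact (hD.nhds_le_map hp hloc (x₀ := 0) (Icc_mem_nhds h0 h1)).2
      (image_mem_map (Icc_mem_nhds h0 h1))

theorem exists_loop [T2Space B] [ConnectedSpace B] (hp : Continuous p)
    (hloc : ∀ b, ∃ f c, LocTriv p f c ∧ c 0 = b) (D : Arc p)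
    (hD : ¬ InjOn D.γ (Icc D.a D.b)) :
    ∃ (γ : ℝ → B) (F : ℝ × ℝ → E), Dev p (Icc 0 1) γ F ∧ InjOn γ (Ico 0 1) ∧ γ 0 = γ 1 ∧
      γ '' Icc 0 1 = univ := by
  obtain ⟨s, t, hst, hsub, heq, hinj⟩ := exists_minimal_loop hp D hD
  have hne : t - s ≠ 0 := by linarith
  let k := affineHomeomorph (t - s) s hne
  have hk : ∀ x, k x = (t - s) * x + s := fun x => rfl
  have hdev : Dev p (Icc 0 1) (D.γ ∘ k) (fun q => D.F (q.1, k q.2)) := by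
    refine (D.dev.comp k).mono fun x hx => hsub ?_
    rw [hk]
    constructor <;> nlinarith [hx.1, hx.2]
  have h0 : (D.γ ∘ k) 0 = (D.γ ∘ k) 1 := by
    simp only [Function.comp, hk]
    rw [show (t - s) * 0 + s = s by ring, show (t - s) * 1 + s = t by ring, heq]
  have hi : InjOn (D.γ ∘ k) (Ico 0 1) := by
    intro x hx y hy hxy
    refine k.injective (hinj ?_ ?_ hxy) <;> rw [hk]
    · constructor <;> nlinarith [hx.1, hx.2]
    · constructor <;> nlinarith [hy.1, hy.2]
  exact ⟨_, _, hdev, hi, h0, image_loop_eq_univ hp hloc hdev hi h0⟩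

end Classification

/-! ### Tubes around interior leaves, half-plane charts, and the interior of the surface. -/

section Leaves

variable {Z : Type*} [TopologicalSpace Z] (F : Foliation Z)

theorem Foliation.exists_leaf (z : Z) : ∃ ω ∈ F.leaves, z ∈ ω := by
  obtain ⟨ω, ⟨h1, h2⟩, -⟩ := F.isPartition.2 z
  exact ⟨ω, h1, h2⟩

variable {F}

theorem Foliation.leaf_eq {ω ω' : Set Z} (h : ω ∈ F.leaves) (h' : ω' ∈ F.leaves) {z : Z}
    (hz : z ∈ ω) (hz' : z ∈ ω') : ω = ω' :=
  (F.isPartition.2 z).unique ⟨h, hz⟩ ⟨h', hz'⟩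

theorem Foliation.leaf_nonempty {ω : Set Z} (h : ω ∈ F.leaves) : ω.Nonempty :=
  nonempty_iff_ne_empty.2 fun he => F.isPartition.1 (he ▸ h)

theorem Foliation.IsSaturated.compl {U : Set Z} (h : F.IsSaturated U) : F.IsSaturated Uᶜ := by
  rintro ω hω ⟨z, hz, hzU⟩ y hy hyU
  exact hzU (h ω hω ⟨y, hy, hyU⟩ hz)

theorem isSaturated_image {X : Type*} {T : Type*} {g : X × T → Z}
    (hg : ∀ t, g '' {q | q.2 = t} ∈ F.leaves) (A : Set T) :
    F.IsSaturated (g '' (univ ×ˢ A)) := by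
  rintro ω hω ⟨_, hz, ⟨x, t⟩, ⟨-, ht⟩, rfl⟩
  have : ω = g '' {q | q.2 = t} := F.leaf_eq hω (hg t) hz ⟨(x, t), rfl, rfl⟩
  rw [this]
  rintro _ ⟨⟨x', t'⟩, rfl, rfl⟩
  exact ⟨(x', t'), ⟨mem_univ _, ht⟩, rfl⟩

theorem mem_surfaceInterior_iff {z : Z} : z ∈ surfaceInterior Z ↔
    ∃ W : Set Z, IsOpen W ∧ z ∈ W ∧ ∃ V : Set (ℝ × ℝ), IsOpen V ∧ Nonempty (W ≃ₜ V) := by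
  simp [surfaceInterior, surfaceBoundary]

theorem isOpen_surfaceInterior : IsOpen (surfaceInterior Z) := by
  refine isOpen_iff_mem_nhds.2 fun z hz => ?_
  obtain ⟨W, hW, hzW, h⟩ := mem_surfaceInterior_iff.1 hz
  exact mem_of_superset (hW.mem_nhds hzW) fun y hy => mem_surfaceInterior_iff.2 ⟨W, hW, hy, h⟩

theorem range_subset_surfaceInterior {X : Type*} [TopologicalSpace X] {i : X → ℝ × ℝ}
    (hi : IsOpenEmbedding i) {g : X → Z} (hg : IsOpenEmbedding g) :
    range g ⊆ surfaceInterior Z := fun _ hz =>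
  mem_surfaceInterior_iff.2 ⟨range g, hg.isOpen_range, hz, range i, hi.isOpen_range,
    ⟨hg.toIsEmbedding.toHomeomorph.symm.trans hi.toIsEmbedding.toHomeomorph⟩⟩

/-- A continuous injective family of leaves is an open map. -/
theorem isOpenEmbedding_of_leaves {g : ℝ × ℝ → Z} (hc : Continuous g) (hi : Function.Injective g)
    (hleaf : ∀ t, g '' {q | q.2 = t} ∈ F.leaves) : IsOpenEmbedding g := by
  refine .of_continuous_injective_isOpenMap hc hi (IsOpenMap.of_nhds_le ?_)
  rintro ⟨x₀, t₀⟩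
  obtain ⟨J, -, φ, ⟨hφ, hplaque⟩, q₀, hq₀⟩ := F.exists_chart (g (x₀, t₀))
  have : Nonempty (Ioo (-1 : ℝ) 1 × J) := ⟨q₀⟩
  set ψ := Function.invFun φ with hψ
  have hψφ : ∀ q, ψ (φ q) = q := Function.leftInverse_invFun hφ.injective
  have hφψ : ∀ z ∈ range φ, φ (ψ z) = z := by rintro _ ⟨q, rfl⟩; rw [hψφ]
  have hψc : ∀ z ∈ range φ, ContinuousAt ψ z := by
    rintro _ ⟨q, rfl⟩; exact continuousAt_invFun hφ q
  have hr : g ⁻¹' range φ ∈ 𝓝 (x₀, t₀) :=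
    hc.continuousAt (hφ.isOpen_range.mem_nhds ⟨q₀, hq₀⟩)
  obtain ⟨ε, hε, hball⟩ := Metric.mem_nhds_iff.1 hr
  rw [← ball_prod_same] at hball
  have hbox : ∀ x ∈ Metric.ball x₀ ε, ∀ t ∈ Metric.ball t₀ ε, g (x, t) ∈ range φ :=
    fun x hx t ht => hball ⟨hx, ht⟩
  have hx₀ : x₀ ∈ Metric.ball x₀ ε := Metric.mem_ball_self hε
  have ht₀ : t₀ ∈ Metric.ball t₀ ε := Metric.mem_ball_self hε
  -- A connected piece of a leaf inside the chart stays in one plaque, so the transverse coordinate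
  -- of `g (x, t)` depends on `t` only.
  have hpl : ∀ x ∈ Metric.ball x₀ ε, ∀ t ∈ Metric.ball t₀ ε,
      (ψ (g (x, t))).2 = (ψ (g (x₀, t))).2 := by
    intro x hx t ht
    have h1 := hplaque _ (hleaf t) (ψ (g (x₀, t))) (by
      rw [hφψ _ (hbox x₀ hx₀ t ht)]; exact ⟨_, rfl, rfl⟩)
    rw [hφψ _ (hbox x₀ hx₀ t ht)] at h1
    have h2 : (fun x => g (x, t)) '' Metric.ball x₀ ε ⊆ φ '' {q | q.2 = (ψ (g (x₀, t))).2} := by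
      rw [← h1]
      refine IsPreconnected.subset_connectedComponentIn ?_ ⟨x₀, hx₀, rfl⟩ ?_
      · rw [Real.ball_eq_Ioo]
        exact isPreconnected_Ioo.image _ (hc.comp (by fun_prop)).continuousOn
      · rintro _ ⟨y, hy, rfl⟩
        exact ⟨⟨_, rfl, rfl⟩, hbox y hy t ht⟩
    obtain ⟨q, hq, hq'⟩ := h2 ⟨x, hx, rfl⟩
    simp only at hq'
    rw [← hq', hψφ, hq]
  have hcoord : ∀ x ∈ Metric.ball x₀ ε, ∀ t ∈ Metric.ball t₀ ε,
      ContinuousAt (fun q : ℝ × ℝ => ψ (g q)) (x, t) := fun x hx t ht =>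
    ContinuousAt.comp (hψc _ (hbox x hx t ht)) hc.continuousAt
  set s : ℝ → ℝ := fun t => (ψ (g (x₀, t))).2 with hs
  have hsn : 𝓝 (s t₀) ≤ map s (𝓝 t₀) := by
    refine nhds_le_map_of_injOn ?_ ⟨_, Metric.ball_mem_nhds t₀ hε, ?_⟩
    · filter_upwards [Metric.ball_mem_nhds t₀ hε] with t ht
      have h1 := (hcoord x₀ hx₀ t ht).comp (f := fun t => (x₀, t)) (by fun_prop)
      exact (continuous_subtype_val.comp continuous_snd).continuousAt.comp h1
    -- Equal transverse coordinates mean the same plaque, hence the same leaf `g '' {q | q.2 = t}`;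
    -- injectivity of `g` then gives `t' = t`.
    · intro t ht t' ht' heq
      have h1 := hplaque _ (hleaf t) (ψ (g (x₀, t))) (by
        rw [hφψ _ (hbox x₀ hx₀ t ht)]; exact ⟨_, rfl, rfl⟩)
      have h2 : g (x₀, t') ∈ φ '' {q | q.2 = (ψ (g (x₀, t))).2} :=
        ⟨ψ (g (x₀, t')), Subtype.ext heq.symm, hφψ _ (hbox x₀ hx₀ t' ht')⟩
      rw [← h1] at h2
      obtain ⟨⟨y, u⟩, hu, hyu⟩ := (connectedComponentIn_subset _ _ h2).1
      have h3 := congrArg Prod.snd (hi hyu)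
      simp only [mem_ofPred_eq] at hu h3
      rw [← hu, h3]
  -- With coordinates read in `ℝ × ℝ`, the image of `g` fills an open planar set, which is then
  -- pulled back to the domain `Ioo × J`. This treats both kinds of chart at once and serves as a
  -- foliated invariance of domain.
  have key := nhds_prod_le_map (r := fun q => ((ψ (g q)).1 : ℝ)) (x₀ := x₀) (t₀ := t₀) (s := s)
    ?_ ⟨_, Metric.ball_mem_nhds x₀ hε, ?_⟩ hsn
  · intro N hN
    have hN' : g ⁻¹' N ∩ (Metric.ball x₀ ε ×ˢ Metric.ball t₀ ε) ∈ 𝓝 (x₀, t₀) :=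
      inter_mem hN (prod_mem_nhds (Metric.ball_mem_nhds _ hε) (Metric.ball_mem_nhds _ hε))
    have h1 := key (image_mem_map hN')
    rw [← nhds_prod_eq] at h1
    have h2 : Continuous fun q : Ioo (-1 : ℝ) 1 × J => ((q.1 : ℝ), (q.2 : ℝ)) := by fun_prop
    have h3 := h2.continuousAt (x := ψ (g (x₀, t₀))) h1
    have h4 := image_mem_map (m := φ) h3
    rw [hφ.map_nhds_eq, hφψ _ (hbox x₀ hx₀ t₀ ht₀)] at h4
    refine mem_of_superset h4 ?_
    rintro _ ⟨q, ⟨⟨x, t⟩, ⟨hxN, hx, ht⟩, heq⟩, rfl⟩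
    simp only [Prod.mk.injEq] at heq
    have h5 : q = ψ (g (x, t)) := by
      refine Prod.ext (Subtype.ext heq.1.symm) ?_
      rw [hpl x hx t ht]
      exact Subtype.ext heq.2.symm
    rw [h5, hφψ _ (hbox x hx t ht)]
    exact hxN
  · filter_upwards [prod_mem_nhds (Metric.ball_mem_nhds x₀ hε) (Metric.ball_mem_nhds t₀ hε)]
      with q hq
    exact (continuous_subtype_val.comp continuous_fst).continuousAt.comp (hcoord q.1 hq.1 q.2 hq.2)
  · intro x hx y hy hxy
    have h1 : ψ (g (x, t₀)) = ψ (g (y, t₀)) :=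
      Prod.ext (Subtype.ext hxy) ((hpl x hx t₀ ht₀).trans (hpl y hy t₀ ht₀).symm)
    have h2 : g (x, t₀) = g (y, t₀) := by
      rw [← hφψ _ (hbox x hx t₀ ht₀), ← hφψ _ (hbox y hy t₀ ht₀), h1]
    exact congrArg Prod.fst (hi h2)

/-- Leaves are interior or boundary leaves. -/
theorem leaf_subset_or (hsb : ∀ ω ∈ F.singularLeaves, ω ⊆ surfaceBoundary Z) {ω : Set Z}
    (hω : ω ∈ F.leaves) :
    (ω ⊆ surfaceInterior Z ∧ F.HasModelNeighbourhood (Icc (-1) 1) (Ioo (-1) 1) ω) ∨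
      ω ⊆ surfaceBoundary Z := by
  by_cases h : F.IsRegular ω
  · rcases h with h | h
    · exact Or.inl h
    · exact Or.inr h.1
  · exact Or.inr (hsb ω ⟨hω, h⟩)

theorem leaf_subset_surfaceBoundary (hsb : ∀ ω ∈ F.singularLeaves, ω ⊆ surfaceBoundary Z)
    {ω : Set Z} (hω : ω ∈ F.leaves) {z : Z} (hz : z ∈ ω) (hzb : z ∈ surfaceBoundary Z) :
    ω ⊆ surfaceBoundary Z :=
  (leaf_subset_or hsb hω).resolve_left fun h => h.1 hz hzb

/-- Every interior leaf has a foliated tubular neighbourhood. -/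
theorem exists_tube (hsb : ∀ ω ∈ F.singularLeaves, ω ⊆ surfaceBoundary Z) {ω : Set Z}
    (hω : ω ∈ F.leaves) {z : Z} (hz : z ∈ ω) (hzi : z ∈ surfaceInterior Z) :
    ∃ g : ℝ × ℝ → Z, IsOpenEmbedding g ∧ (∀ t, g '' {q | q.2 = t} ∈ F.leaves) ∧
      g '' {q | q.2 = 0} = ω ∧ ∀ a : ℝ, IsClosed (g '' (univ ×ˢ Icc (-a) a)) := by
  rcases leaf_subset_or hsb hω with ⟨-, U, -, -, f, hf, hfr, -, hleaf, h0⟩ | h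
  -- The image of `f` is the closed set `closure U`. This makes the narrower tubes closed, on which
  -- the separation of leaves rests.
  · have hcl : IsClosedEmbedding f := ⟨hf, hfr ▸ isClosed_closure⟩
    let e₀ := (orderIsoIooNegOneOne ℝ).toHomeomorph
    -- The translation ensures `e 0 = 0`, so that the core of the tube is `ω`.
    let e : ℝ ≃ₜ Ioo (-1 : ℝ) 1 := (Homeomorph.addRight (e₀.symm ⟨0, by norm_num⟩)).trans e₀
    let j : ℝ → Icc (-1 : ℝ) 1 := fun u => ⟨e u, Ioo_subset_Icc_self (e u).2⟩
    have hj : Continuous j := (continuous_subtype_val.comp e.continuous).subtype_mk _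
    have hji : Function.Injective j := fun u v h =>
      by
      have h1 := Subtype.ext_iff.1 h
      exact e.injective (Subtype.ext h1)
    have hj0 : (j 0 : ℝ) = 0 := by simp [j, e]
    have hi : Function.Injective fun q : ℝ × ℝ => f (q.1, j q.2) := fun q q' h => by
      have := hf.injective h
      simp only [Prod.mk.injEq] at this
      exact Prod.ext this.1 (hji this.2)
    have himg : ∀ t, (fun q : ℝ × ℝ => f (q.1, j q.2)) '' {q | q.2 = t} = f '' {q | q.2 = j t} := by
      intro t
      ext y
      constructor
      · rintro ⟨q, rfl, rfl⟩; exact ⟨_, rfl, rfl⟩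
      · rintro ⟨⟨x, u⟩, rfl, rfl⟩; exact ⟨(x, t), rfl, rfl⟩
    have hl : ∀ t, (fun q : ℝ × ℝ => f (q.1, j q.2)) '' {q | q.2 = t} ∈ F.leaves := fun t => by
      rw [himg]; exact hleaf _
    refine ⟨fun q => f (q.1, j q.2), isOpenEmbedding_of_leaves
      (hf.continuous.comp (by fun_prop)) hi hl, hl, ?_, fun a => ?_⟩
    · rw [himg, ← h0]
      congr 1
      ext q
      simp only [mem_ofPred_eq]
      rw [Subtype.ext_iff, hj0]
    · have hcomp : IsCompact (j '' Icc (-a) a) := isCompact_Icc.image hj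
      have : (fun q : ℝ × ℝ => f (q.1, j q.2)) '' (univ ×ˢ Icc (-a) a) =
          f '' (univ ×ˢ (j '' Icc (-a) a)) := by
        ext y
        constructor
        · rintro ⟨q, hq, rfl⟩; exact ⟨_, ⟨mem_univ _, q.2, hq.2, rfl⟩, rfl⟩
        · rintro ⟨⟨x, u⟩, ⟨-, t, ht, rfl⟩, rfl⟩; exact ⟨(x, t), ⟨mem_univ _, ht⟩, rfl⟩
      rw [this]
      exact hcl.isClosedMap _ (isClosed_univ.prod hcomp.isClosed)
  · exact absurd (h hz) hzi

/-- Interior leaves are separated from all other points by saturated open sets. -/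
theorem exists_separation (hsb : ∀ ω ∈ F.singularLeaves, ω ⊆ surfaceBoundary Z) {ω : Set Z}
    (hω : ω ∈ F.leaves) {y : Z} (hy : y ∈ ω) (hyi : y ∈ surfaceInterior Z) {z : Z} (hz : z ∉ ω) :
    ∃ V W : Set Z, IsOpen V ∧ IsOpen W ∧ F.IsSaturated V ∧ F.IsSaturated W ∧ Disjoint V W ∧
      ω ⊆ V ∧ z ∈ W := by
  obtain ⟨g, hg, hleaf, h0, hcl⟩ := exists_tube hsb hω hy hyi
  -- The open tube of width `a` and the complement of the closed one are the two sets; it suffices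
  -- that `z` avoids some closed tube.
  have key : ∀ a : ℝ, 0 < a → z ∉ g '' (univ ×ˢ Icc (-a) a) →
      ∃ V W : Set Z, IsOpen V ∧ IsOpen W ∧ F.IsSaturated V ∧ F.IsSaturated W ∧ Disjoint V W ∧
      ω ⊆ V ∧ z ∈ W := by
    intro a ha hza
    refine ⟨g '' (univ ×ˢ Ioo (-a) a), (g '' (univ ×ˢ Icc (-a) a))ᶜ,
      hg.isOpenMap _ (isOpen_univ.prod isOpen_Ioo), (hcl a).isOpen_compl,
      isSaturated_image hleaf _, (isSaturated_image hleaf _).compl, ?_, ?_, hza⟩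
    · exact disjoint_compl_right_iff_subset.2 (image_mono (prod_mono le_rfl Ioo_subset_Icc_self))
    · rw [← h0]
      refine image_mono fun q hq => ⟨mem_univ _, ?_⟩
      rw [show q.2 = 0 from hq]
      exact ⟨by linarith, ha⟩
  by_cases hzr : z ∈ range g
  · obtain ⟨⟨x, t⟩, rfl⟩ := hzr
    have ht : t ≠ 0 := by
      rintro rfl
      exact hz (h0 ▸ ⟨_, rfl, rfl⟩)
    refine key (|t| / 2) (by positivity) ?_
    rintro ⟨q, ⟨-, hq⟩, heq⟩
    have := hg.injective heq
    subst this
    have h1 := abs_le.2 hq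
    have := abs_pos.2 ht
    linarith
  · exact key 1 one_pos fun h => hzr (image_subset_range _ _ h)

theorem isOpenEmbedding_expNN :
    IsOpenEmbedding fun u : ℝ => (⟨Real.exp u, (Real.exp_pos u).le⟩ : ℝ≥0) := by
  have hc : Continuous fun u : ℝ => (⟨Real.exp u, (Real.exp_pos u).le⟩ : ℝ≥0) :=
    Real.continuous_exp.subtype_mk _
  refine ⟨IsEmbedding.of_comp hc NNReal.continuous_coe Real.isOpenEmbedding_exp.isEmbedding, ?_⟩
  have : range (fun u : ℝ => (⟨Real.exp u, (Real.exp_pos u).le⟩ : ℝ≥0)) = Ioi 0 := by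
    ext s
    constructor
    · rintro ⟨u, rfl⟩; exact NNReal.coe_pos.1 (Real.exp_pos u)
    · intro hs; exact ⟨Real.log s, Subtype.ext (Real.exp_log (NNReal.coe_pos.2 hs))⟩
  rw [this]
  exact isOpen_Ioi

/-- A homeomorphism of the half-lines `[0, ∞)` and `[0, 1)`. -/
noncomputable def nnrealHomeoIco : ℝ≥0 ≃ₜ Ico (0 : ℝ) 1 where
  toFun t := ⟨t / (1 + t), by positivity, by
    rw [div_lt_one (by positivity)]; linarith⟩
  invFun s := ⟨s / (1 - s), div_nonneg s.2.1 (by linarith [s.2.2])⟩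
  left_inv t := by
    apply NNReal.eq
    have : (1 : ℝ) + t ≠ 0 := by positivity
    change (t / (1 + t) : ℝ) / (1 - t / (1 + t)) = t
    field_simp
    ring
  right_inv s := by
    apply Subtype.ext
    have : (1 : ℝ) - s ≠ 0 := by linarith [s.2.2]
    change (s / (1 - s) : ℝ) / (1 + s / (1 - s)) = s
    field_simp
    ring
  continuous_toFun := by
    refine Continuous.subtype_mk (Continuous.div (by fun_prop) (by fun_prop) fun t => ?_) _
    positivity
  continuous_invFun := by
    refine Continuous.subtype_mk (Continuous.div (by fun_prop) (by fun_prop) fun s => ?_) _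
    linarith [s.2.2]

/-- A foliated half-plane chart at a boundary point. -/
structure HalfChart (F : Foliation Z) (z : Z) (φ : ℝ × ℝ≥0 → Z) : Prop where
  emb : IsOpenEmbedding φ
  center : φ (0, 0) = z
  plaque : ∀ ω ∈ F.leaves, ∀ r r' s, φ (r, s) ∈ ω → φ (r', s) ∈ ω
  interior : ∀ r s, 0 < s → φ (r, s) ∈ surfaceInterior Z
  boundary : ∀ r, φ (r, 0) ∈ surfaceBoundary Z

/-- A chart modelled on an open square would make `z` an interior point, and so would a positive
height in a half-square, because the logarithm of the height turns the positive part into a plane.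
Thus `z` lies on the bottom line. The whole bottom line is in the boundary because it lies on the
leaf of `z`, and a leaf that touches the boundary is contained in it. -/
theorem exists_halfChart (hsb : ∀ ω ∈ F.singularLeaves, ω ⊆ surfaceBoundary Z) {z : Z}
    (hz : z ∈ surfaceBoundary Z) : ∃ φ, HalfChart F z φ := by
  obtain ⟨J, hJ, φ₀, ⟨hφ, hpl⟩, ⟨r₀, s₀⟩, rfl⟩ := F.exists_chart z
  have hplaque : ∀ ω ∈ F.leaves, ∀ p q, φ₀ p ∈ ω → q.2 = p.2 → φ₀ q ∈ ω := by
    intro ω hω p q hp hq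
    have : φ₀ q ∈ connectedComponentIn (ω ∩ range φ₀) (φ₀ p) := by
      rw [hpl ω hω p hp]; exact ⟨q, hq, rfl⟩
    exact (connectedComponentIn_subset _ _ this).1
  rcases hJ with rfl | rfl
  · exfalso
    have hi : IsOpenEmbedding fun q : Ioo (-1 : ℝ) 1 × Ioo (-1 : ℝ) 1 => ((q.1 : ℝ), (q.2 : ℝ)) :=
      isOpen_Ioo.isOpenEmbedding_subtypeVal.prodMap isOpen_Ioo.isOpenEmbedding_subtypeVal
    exact range_subset_surfaceInterior hi hφ ⟨_, rfl⟩ hz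
  · let e := (orderIsoIooNegOneOne ℝ).toHomeomorph
    let k : ℝ ≃ₜ Ioo (-1 : ℝ) 1 := (Homeomorph.addRight (e.symm r₀)).trans e
    have hk : k 0 = r₀ := by simp [k]
    let φ : ℝ × ℝ≥0 → Z := φ₀ ∘ (k.prodCongr nnrealHomeoIco)
    have hφe : IsOpenEmbedding φ := hφ.comp (Homeomorph.isOpenEmbedding _)
    have hint : ∀ r s, 0 < s → φ (r, s) ∈ surfaceInterior Z := by
      intro r s hs
      have h1 : IsOpenEmbedding fun q : ℝ × ℝ =>
          φ (q.1, (⟨Real.exp q.2, (Real.exp_pos q.2).le⟩ : ℝ≥0)) :=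
        hφe.comp (IsOpenEmbedding.id.prodMap isOpenEmbedding_expNN)
      refine range_subset_surfaceInterior IsOpenEmbedding.id h1 ⟨(r, Real.log s), ?_⟩
      simp only
      congr 2
      exact Subtype.ext (Real.exp_log (NNReal.coe_pos.2 hs))
    have hplφ : ∀ ω ∈ F.leaves, ∀ r r' s, φ (r, s) ∈ ω → φ (r', s) ∈ ω :=
      fun ω hω r r' s h => hplaque ω hω _ _ h rfl
    have hs₀ : s₀ = nnrealHomeoIco 0 := by
      obtain ⟨s, rfl⟩ := nnrealHomeoIco.surjective s₀
      rcases eq_or_ne s 0 with rfl | hs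
      · rfl
      · refine absurd (hint 0 s (pos_iff_ne_zero.2 hs)) ?_
        have : φ (0, s) = φ₀ (r₀, nnrealHomeoIco s) := by
          simp only [φ, Function.comp, Homeomorph.coe_prodCongr, Prod.map, hk]
        rw [this]
        exact fun h => h hz
    have hcen : φ (0, 0) = φ₀ (r₀, s₀) := by
      simp only [φ, Function.comp, Homeomorph.coe_prodCongr, Prod.map, hk, hs₀]
    refine ⟨φ, hφe, hcen, hplφ, hint, fun r => ?_⟩
    obtain ⟨ω, hω, hzω⟩ := F.exists_leaf (φ (0, 0))
    exact leaf_subset_surfaceBoundary hsb hω hzω (hcen ▸ hz) (hplφ ω hω 0 r 0 hzω)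

theorem HalfChart.mem_interior_iff {z : Z} {φ : ℝ × ℝ≥0 → Z} (h : HalfChart F z φ)
    (q : ℝ × ℝ≥0) : φ q ∈ surfaceInterior Z ↔ 0 < q.2 := by
  refine ⟨fun hq => ?_, fun hq => h.interior q.1 q.2 hq⟩
  rw [pos_iff_ne_zero]
  intro h0
  have := h.boundary q.1
  rw [← h0] at this
  exact hq this

/-- Points of a half-plane chart near the boundary line lie in the interior of the surface. -/
theorem HalfChart.range_inter {z : Z} {φ : ℝ × ℝ≥0 → Z} (h : HalfChart F z φ) (A : Set (ℝ × ℝ≥0)) :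
    φ '' A ∩ surfaceInterior Z = φ '' (A ∩ {q | 0 < q.2}) := by
  ext y
  constructor
  · rintro ⟨⟨q, hq, rfl⟩, hy⟩
    exact ⟨q, ⟨hq, (h.mem_interior_iff q).1 hy⟩, rfl⟩
  · rintro ⟨q, ⟨hq, hq'⟩, rfl⟩
    exact ⟨⟨q, hq, rfl⟩, (h.mem_interior_iff q).2 hq'⟩

theorem dense_surfaceInterior (hsb : ∀ ω ∈ F.singularLeaves, ω ⊆ surfaceBoundary Z) :
    Dense (surfaceInterior Z) := by
  intro z
  by_cases hz : z ∈ surfaceInterior Z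
  · exact subset_closure hz
  · have hz' : z ∈ surfaceBoundary Z := by simpa [surfaceInterior] using hz
    obtain ⟨φ, h⟩ := exists_halfChart hsb hz'
    rw [← h.center]
    have h1 : Tendsto (fun s : ℝ≥0 => φ (0, s)) (𝓝[>] 0) (𝓝 (φ (0, 0))) :=
      (h.emb.continuous.comp (by fun_prop : Continuous fun s : ℝ≥0 => ((0 : ℝ), s))).continuousAt
        |>.mono_left nhdsWithin_le_nhds
    refine mem_closure_of_tendsto h1 ?_
    filter_upwards [self_mem_nhdsWithin] with s hs using h.interior 0 s hs

/-- If the dense interior split into two open parts, their closures would cover the connected space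
`Z` and meet at some `z`. But `z` has a neighbourhood whose trace on the interior lies in one part,
when `z` is interior, or is connected, namely the open half-plane of a boundary chart. -/
theorem isConnected_surfaceInterior [ConnectedSpace Z]
    (hsb : ∀ ω ∈ F.singularLeaves, ω ⊆ surfaceBoundary Z) :
    IsConnected (surfaceInterior Z) := by
  have hd := dense_surfaceInterior hsb
  refine ⟨hd.nonempty, ?_⟩
  rw [isPreconnected_iff_subset_of_disjoint]
  intro A B hA hB hAB hdisj
  by_contra! hcon
  obtain ⟨hcA, hcB⟩ := hcon
  obtain ⟨a, ha, haA⟩ := not_subset.1 hcA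
  obtain ⟨b, hb, hbB⟩ := not_subset.1 hcB
  set A' := surfaceInterior Z ∩ A
  set B' := surfaceInterior Z ∩ B
  have hu : closure A' ∪ closure B' = univ := by
    rw [← closure_union, ← inter_union_distrib_left, inter_eq_left.2 hAB, hd.closure_eq]
  have hpre : IsPreconnected (univ : Set Z) := isPreconnected_univ
  rw [isPreconnected_closed_iff] at hpre
  obtain ⟨z, -, hzA, hzB⟩ := hpre _ _ isClosed_closure isClosed_closure hu.ge
    ⟨b, mem_univ _, subset_closure ⟨hb, (hAB hb).resolve_right hbB⟩⟩
    ⟨a, mem_univ _, subset_closure ⟨ha, (hAB ha).resolve_left haA⟩⟩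
  have key : ∀ N : Set Z, IsOpen N → z ∈ N → IsPreconnected (N ∩ surfaceInterior Z) → False := by
    intro N hN hzN hpc
    obtain ⟨x, hxN, hxi, hxA⟩ := mem_closure_iff.1 hzA N hN hzN
    obtain ⟨y, hyN, hyi, hyB⟩ := mem_closure_iff.1 hzB N hN hzN
    obtain ⟨w, ⟨-, hwi⟩, hwA, hwB⟩ := hpc A B hA hB (fun w hw => hAB hw.2) ⟨x, ⟨hxN, hxi⟩, hxA⟩
      ⟨y, ⟨hyN, hyi⟩, hyB⟩
    have : w ∈ surfaceInterior Z ∩ (A ∩ B) := ⟨hwi, hwA, hwB⟩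
    rw [hdisj] at this
    exact this
  by_cases hz : z ∈ surfaceInterior Z
  · rcases hAB hz with h | h
    · obtain ⟨y, hy, hyi, hyB⟩ := mem_closure_iff.1 hzB _ (isOpen_surfaceInterior.inter hA) ⟨hz, h⟩
      have : y ∈ surfaceInterior Z ∩ (A ∩ B) := ⟨hyi, hy.2, hyB⟩
      rw [hdisj] at this
      exact this
    · obtain ⟨y, hy, hyi, hyA⟩ := mem_closure_iff.1 hzA _ (isOpen_surfaceInterior.inter hB) ⟨hz, h⟩
      have : y ∈ surfaceInterior Z ∩ (A ∩ B) := ⟨hyi, hyA, hy.2⟩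
      rw [hdisj] at this
      exact this
  · have hz' : z ∈ surfaceBoundary Z := by simpa [surfaceInterior] using hz
    obtain ⟨φ, h⟩ := exists_halfChart hsb hz'
    refine key (φ '' univ) (h.emb.isOpenMap _ isOpen_univ) ⟨(0, 0), mem_univ _, h.center⟩ ?_
    rw [h.range_inter]
    refine IsPreconnected.image ?_ _ h.emb.continuous.continuousOn
    have : (univ ∩ {q : ℝ × ℝ≥0 | 0 < q.2}) = univ ×ˢ Ioi 0 := by
      ext q; simp
    rw [this]
    exact isPreconnected_univ.prod isPreconnected_Ioi

end Leaves

/-! ### The leaf space of the interior as the base of a line bundle. -/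

section LeafSpace

variable {Z : Type*} [TopologicalSpace Z]

/-- Points of the interior on a common leaf. -/
def interiorLeafSetoid (F : Foliation Z) : Setoid (surfaceInterior Z) where
  r x y := ∃ ω ∈ F.leaves, (x : Z) ∈ ω ∧ (y : Z) ∈ ω
  iseqv :=
    { refl := fun x => by
        obtain ⟨ω, h, hx⟩ := F.exists_leaf x
        exact ⟨ω, h, hx, hx⟩
      symm := fun ⟨ω, h, hx, hy⟩ => ⟨ω, h, hy, hx⟩
      trans := fun ⟨ω, h, hx, hy⟩ ⟨ω', h', hy', hz⟩ =>
        ⟨ω, h, hx, F.leaf_eq h h' hy hy' ▸ hz⟩ }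

/-- The space of interior leaves. -/
abbrev LeafSpace (F : Foliation Z) : Type _ := Quotient (interiorLeafSetoid F)

/-- The projection of the interior to its leaf space. -/
abbrev leafProj (F : Foliation Z) : surfaceInterior Z → LeafSpace F :=
  Quotient.mk (interiorLeafSetoid F)

variable {F : Foliation Z}

theorem leafProj_eq_iff {x y : surfaceInterior Z} :
    leafProj F x = leafProj F y ↔ ∃ ω ∈ F.leaves, (x : Z) ∈ ω ∧ (y : Z) ∈ ω :=
  Quotient.eq (r := interiorLeafSetoid F)

theorem continuous_leafProj : Continuous (leafProj F) := continuous_quotient_mk'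

theorem isQuotientMap_leafProj : IsQuotientMap (leafProj F) := isQuotientMap_quot_mk

/-- All leaves near a given leaf that crosses `O` also cross `O`: inside a tube, slide along the
leaf to a point of `O` and vary the level. -/
theorem isOpenMap_leafProj (hsb : ∀ ω ∈ F.singularLeaves, ω ⊆ surfaceBoundary Z) :
    IsOpenMap (leafProj F) := by
  intro O hO
  refine isQuotientMap_leafProj.isOpen_preimage.1 (isOpen_iff_mem_nhds.2 ?_)
  rintro e ⟨o, ho, hoe⟩
  obtain ⟨ω, hω, hoω, heω⟩ := leafProj_eq_iff.1 hoe
  obtain ⟨g, hg, hleaf, h0, -⟩ := exists_tube hsb hω hoω o.2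
  obtain ⟨O', hO', rfl⟩ := isOpen_induced_iff.1 hO
  rw [← h0] at hoω heω
  obtain ⟨⟨x, _⟩, rfl, hx⟩ := hoω
  obtain ⟨⟨x', t'⟩, ht', hx'⟩ := heω
  replace ht' : t' = 0 := ht'
  replace hx : g (x, 0) = o := hx
  have hgr := range_subset_surfaceInterior IsOpenEmbedding.id hg
  have hcx : Continuous fun t => g (x, t) := hg.continuous.comp (by fun_prop)
  have hopen : IsOpen (g '' (univ ×ˢ ((fun t => g (x, t)) ⁻¹' O'))) :=
    hg.isOpenMap _ (isOpen_univ.prod (hO'.preimage hcx))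
  refine mem_of_superset ((hopen.preimage continuous_subtype_val).mem_nhds ?_) ?_
  · refine ⟨(x', t'), ⟨mem_univ _, ?_⟩, hx'⟩
    rw [ht', mem_preimage, hx]
    exact ho
  · rintro w ⟨⟨y, s⟩, ⟨-, hs⟩, hw⟩
    refine ⟨⟨g (x, s), hgr ⟨_, rfl⟩⟩, hs, leafProj_eq_iff.2 ⟨_, hleaf s, ⟨_, rfl, rfl⟩, ?_⟩⟩
    exact ⟨_, rfl, hw⟩

theorem mem_of_leafProj_mem_image {V : Set Z} (hV : F.IsSaturated V) {x : surfaceInterior Z}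
    (hx : leafProj F x ∈ leafProj F '' (Subtype.val ⁻¹' V)) : (x : Z) ∈ V := by
  obtain ⟨y, hy, hyx⟩ := hx
  obtain ⟨ω, hω, hyω, hxω⟩ := leafProj_eq_iff.1 hyx
  exact hV ω hω ⟨y, hyω, hy⟩ hxω

/-- Saturated disjoint open sets have disjoint images, and these images are open. -/
theorem t2Space_leafSpace (hsb : ∀ ω ∈ F.singularLeaves, ω ⊆ surfaceBoundary Z) :
    T2Space (LeafSpace F) := by
  refine ⟨fun a b hab => ?_⟩
  induction a using Quotient.inductionOn with | h x => ?_
  induction b using Quotient.inductionOn with | h y => ?_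
  obtain ⟨ω, hω, hx⟩ := F.exists_leaf x
  have hy : (y : Z) ∉ ω := fun hy => hab (leafProj_eq_iff.2 ⟨ω, hω, hx, hy⟩)
  obtain ⟨V, W, hV, hW, hVs, hWs, hd, hωV, hyW⟩ := exists_separation hsb hω hx x.2 hy
  refine ⟨_, _, isOpenMap_leafProj hsb _ (hV.preimage continuous_subtype_val),
    isOpenMap_leafProj hsb _ (hW.preimage continuous_subtype_val), ⟨x, hωV hx, rfl⟩,
    ⟨y, hyW, rfl⟩, ?_⟩
  rw [disjoint_left]
  rintro _ h1 ⟨w, hw, rfl⟩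
  exact disjoint_left.1 hd (mem_of_leafProj_mem_image hVs h1) hw

/-- A tube is a trivialization, its base arc being the image of the transversal `x = 0`. -/
theorem exists_locTriv_leafProj (hsb : ∀ ω ∈ F.singularLeaves, ω ⊆ surfaceBoundary Z)
    (b : LeafSpace F) : ∃ f c, LocTriv (leafProj F) f c ∧ c 0 = b := by
  induction b using Quotient.inductionOn with | h y => ?_
  obtain ⟨ω, hω, hy⟩ := F.exists_leaf y
  obtain ⟨g, hg, hleaf, h0, -⟩ := exists_tube hsb hω hy y.2
  have hgr := range_subset_surfaceInterior IsOpenEmbedding.id hg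
  let f : ℝ × ℝ → surfaceInterior Z := fun q => ⟨g q, hgr ⟨q, rfl⟩⟩
  have hf : IsOpenEmbedding f :=
    (isOpen_surfaceInterior.isOpenEmbedding_subtypeVal.of_comp_iff f).1 hg
  let c : ℝ → LeafSpace F := fun t => leafProj F (f (0, t))
  have hcomm : ∀ x t, leafProj F (f (x, t)) = c t := fun x t =>
    leafProj_eq_iff.2 ⟨_, hleaf t, ⟨_, rfl, rfl⟩, ⟨_, rfl, rfl⟩⟩
  have hsurj : ∀ t e, leafProj F e = c t → ∃ x, f (x, t) = e := by
    intro t e he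
    obtain ⟨ω', hω', h1, h2⟩ := leafProj_eq_iff.1 he
    rw [F.leaf_eq hω' (hleaf t) h2 ⟨_, rfl, rfl⟩] at h1
    obtain ⟨⟨x, t'⟩, rfl, hx⟩ := h1
    exact ⟨x, Subtype.ext hx⟩
  refine ⟨f, c, ⟨hf, ?_, hcomm, hsurj⟩, ?_⟩
  · refine .of_continuous_injective_isOpenMap
      (continuous_leafProj.comp (hf.continuous.comp (by fun_prop))) ?_ ?_
    · intro t t' h
      obtain ⟨x, hx⟩ := hsurj t' (f (0, t)) h
      exact (congrArg Prod.snd (hf.injective hx)).symm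
    · intro O hO
      have : c '' O = leafProj F '' (f '' (univ ×ˢ O)) := by
        ext b
        constructor
        · rintro ⟨t, ht, rfl⟩; exact ⟨_, ⟨(0, t), ⟨mem_univ _, ht⟩, rfl⟩, rfl⟩
        · rintro ⟨_, ⟨⟨x, t⟩, ⟨-, ht⟩, rfl⟩, rfl⟩; exact ⟨t, ht, (hcomm x t).symm⟩
      rw [this]
      exact isOpenMap_leafProj hsb _ (hf.isOpenMap _ (isOpen_univ.prod hO))
  · rw [← h0] at hy
    obtain ⟨⟨x, t⟩, rfl, hx⟩ := hy
    refine leafProj_eq_iff.2 ⟨_, hleaf 0, ⟨(0, 0), rfl, rfl⟩, ⟨(x, _), rfl, hx⟩⟩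

theorem connectedSpace_leafSpace [ConnectedSpace Z]
    (hsb : ∀ ω ∈ F.singularLeaves, ω ⊆ surfaceBoundary Z) : ConnectedSpace (LeafSpace F) := by
  have := isConnected_iff_connectedSpace.1 (isConnected_surfaceInterior hsb)
  infer_instance

theorem secondCountable_leafSpace [SecondCountableTopology Z]
    (hsb : ∀ ω ∈ F.singularLeaves, ω ⊆ surfaceBoundary Z) :
    SecondCountableTopology (LeafSpace F) :=
  isQuotientMap_leafProj.secondCountableTopology (isOpenMap_leafProj hsb)

/-- The interior is foliated by a line or by a circle of leaves. -/
theorem interior_classification [ConnectedSpace Z] [SecondCountableTopology Z]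
    (hsb : ∀ ω ∈ F.singularLeaves, ω ⊆ surfaceBoundary Z) :
    (∃ Ψ : ℝ × ℝ → Z, IsOpenEmbedding Ψ ∧ range Ψ = surfaceInterior Z ∧
      ∀ t, Ψ '' {q | q.2 = t} ∈ F.leaves) ∨
    ∃ (γ : ℝ → LeafSpace F) (G : ℝ × ℝ → surfaceInterior Z), Dev (leafProj F) (Icc 0 1) γ G ∧
      InjOn γ (Ico 0 1) ∧ γ 0 = γ 1 ∧ γ '' Icc 0 1 = univ := by
  have := t2Space_leafSpace hsb
  have := connectedSpace_leafSpace hsb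
  have := secondCountable_leafSpace hsb
  have hp : Continuous (leafProj F) := continuous_leafProj
  have hloc := exists_locTriv_leafProj hsb
  by_cases h : ∀ D : Arc (leafProj F), InjOn D.γ (Icc D.a D.b)
  · left
    obtain ⟨Φ, γ, hγ, hcomm⟩ := exists_homeomorph_of_injOn hp hloc h
    refine ⟨fun q => Φ q, isOpen_surfaceInterior.isOpenEmbedding_subtypeVal.comp
      Φ.isOpenEmbedding, ?_, fun t => ?_⟩
    · rw [show (fun q => (Φ q : Z)) = Subtype.val ∘ Φ from rfl, range_comp, Φ.range_coe, image_univ,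
        Subtype.range_coe]
    · obtain ⟨ω, hω, hz⟩ := F.exists_leaf (Φ (0, t))
      have : (fun q => (Φ q : Z)) '' {q | q.2 = t} = ω := by
        ext y
        constructor
        · rintro ⟨⟨x, t'⟩, rfl, rfl⟩
          obtain ⟨ω', hω', h1, h2⟩ := leafProj_eq_iff.1 ((hcomm x t').trans (hcomm 0 t').symm)
          rwa [F.leaf_eq hω hω' hz h2]
        · intro hy
          have hyi : y ∈ surfaceInterior Z := by
            by_contra hyb
            exact (Φ (0, t)).2 (leaf_subset_surfaceBoundary hsb hω hy (not_not.1 hyb) hz)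
          obtain ⟨⟨x, t'⟩, hq⟩ := Φ.surjective ⟨y, hyi⟩
          refine ⟨(x, t'), hγ ?_, congrArg Subtype.val hq⟩
          rw [← hcomm x, hq, ← hcomm 0]
          exact leafProj_eq_iff.2 ⟨ω, hω, hy, hz⟩
      rw [this]
      exact hω
  · right
    push Not at h
    obtain ⟨D, hD⟩ := h
    exact exists_loop hp hloc D hD

end LeafSpace

/-! ### A circle of leaves: the cylinder and the Möbius band. -/

section Band

variable {Z : Type*} [TopologicalSpace Z]

/-- If the leaf space of the interior is compact, then the boundary is empty. -/
theorem surfaceInterior_eq_univ_of_compactSpace {F : Foliation Z} [CompactSpace (LeafSpace F)]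
    (hsb : ∀ ω ∈ F.singularLeaves, ω ⊆ surfaceBoundary Z) : surfaceInterior Z = univ := by
  refine eq_univ_of_forall fun z => ?_
  by_contra hz
  have hzb : z ∈ surfaceBoundary Z := not_not.1 hz
  obtain ⟨φ, hφ⟩ := exists_halfChart hsb hzb
  let a : ℝ → surfaceInterior Z := fun u =>
    ⟨φ (0, ⟨Real.exp u, (Real.exp_pos u).le⟩), hφ.interior _ _ (NNReal.coe_pos.1 (Real.exp_pos u))⟩
  have ha : Tendsto (fun u => (a u : Z)) atBot (𝓝 z) := by
    rw [← hφ.center]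
    have h1 : Tendsto (fun u : ℝ => (⟨Real.exp u, (Real.exp_pos u).le⟩ : ℝ≥0)) atBot (𝓝 0) :=
      NNReal.tendsto_coe.1 Real.tendsto_exp_atBot
    have h2 : Tendsto (fun s : ℝ≥0 => φ (0, s)) (𝓝 0) (𝓝 (φ (0, 0))) :=
      (hφ.emb.continuous.comp (by fun_prop : Continuous fun s : ℝ≥0 => ((0 : ℝ), s))).continuousAt
    exact h2.comp h1
  -- The points `a u` tend to `z`, while by compactness their leaves cluster at an interior leaf.
  -- Saturated neighbourhoods separating that leaf from `z` contradict this.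
  obtain ⟨b, hb⟩ := exists_clusterPt_of_compactSpace (map (fun u => leafProj F (a u)) atBot)
  induction b using Quotient.inductionOn with | h x => ?_
  obtain ⟨ω, hω, hx⟩ := F.exists_leaf x
  have hzω : z ∉ ω := fun h => leaf_subset_surfaceBoundary hsb hω h hzb hx |> x.2
  obtain ⟨V, W, hV, hW, hVs, hWs, hd, hωV, hzW⟩ := exists_separation hsb hω hx x.2 hzω
  have h1 : leafProj F '' (Subtype.val ⁻¹' V) ∈ 𝓝 (leafProj F x) :=
    (isOpenMap_leafProj hsb _ (hV.preimage continuous_subtype_val)).mem_nhds ⟨x, hωV hx, rfl⟩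
  have h2 : (fun u => leafProj F (a u)) '' {u | (a u : Z) ∈ W} ∈
      map (fun u => leafProj F (a u)) atBot := image_mem_map (ha (hW.mem_nhds hzW))
  obtain ⟨_, h3, u, hu, rfl⟩ := clusterPt_iff_nonempty.1 hb h1 h2
  exact disjoint_left.1 hd (mem_of_leafProj_mem_image hVs h3) hu

/-- This is the linear isotopy from the identity to `k`. If `k x = y`, its values at `x` and at `y`
lie on opposite sides of `y`, which gives surjectivity. -/
theorem surjective_convex_combination {k : ℝ → ℝ} (hk : StrictMono k) (hc : Continuous k)
    (hs : Function.Surjective k) {t : ℝ} (ht : t ∈ Icc (0 : ℝ) 1) :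
    StrictMono (fun x => (1 - t) * x + t * k x) ∧
      Function.Surjective fun x => (1 - t) * x + t * k x := by
  obtain ⟨h0, h1⟩ := ht
  constructor
  · intro x y hxy
    have := hk hxy
    simp only
    rcases h0.eq_or_lt with rfl | h0'
    · linarith
    · nlinarith
  · intro y
    obtain ⟨x, hx⟩ := hs y
    have hcc : Continuous fun x => (1 - t) * x + t * k x := by fun_prop
    have hmem : y ∈ uIcc ((1 - t) * x + t * k x) ((1 - t) * y + t * k y) := by
      rw [mem_uIcc]
      rcases le_total x y with h | h
      · have := hk.monotone h
        left; constructor <;> nlinarith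
      · have := hk.monotone h
        right; constructor <;> nlinarith
    obtain ⟨w, -, hw⟩ := intermediate_value_uIcc (hcc.continuousOn) hmem
    exact ⟨w, hw⟩

variable {B : Type*} [TopologicalSpace B]

/-- The gluing map of a loop of fibres can be made linear. -/
theorem exists_linear_gluing {E : Type*} [TopologicalSpace E] {p : E → B} (hp : Continuous p)
    (hloc : ∀ b, ∃ f c, LocTriv p f c ∧ c 0 = b) {γ : ℝ → B} {G : ℝ × ℝ → E}
    (hG : Dev p (Icc 0 1) γ G) (h01 : γ 0 = γ 1) :
    ∃ (ε : ℤˣ) (G' : ℝ × ℝ → E), Dev p (Icc 0 1) γ G' ∧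
      ∀ x, G' ((ε : ℤ) * x, 1) = G' (x, 0) := by
  have m0 : (0 : ℝ) ∈ Icc (0 : ℝ) 1 := by simp
  have m1 : (1 : ℝ) ∈ Icc (0 : ℝ) 1 := by simp
  -- `h` is the return map of the loop: `G (h x, 1) = G (x, 0)`.
  choose h hh using fun x => hG.surj 1 m1 (G (x, 0)) (by rw [hG.comm 0 m0, h01])
  have hi : Function.Injective h := fun x y hxy => hG.inj 0 m0 (by
    change G (x, 0) = G (y, 0)
    rw [← hh, ← hh, hxy])
  have hs : Function.Surjective h := fun y => by
    obtain ⟨x, hx⟩ := hG.surj 0 m0 (G (y, 1)) (by rw [hG.comm 1 m1, h01])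
    exact ⟨x, hG.inj 1 m1 ((hh x).trans hx)⟩
  have hc : Continuous h := continuous_iff_continuousAt.2 fun x₀ => by
    have h0c : Continuous fun x => G (x, 0) :=
      hG.cont.comp_continuous (by fun_prop) fun x => ⟨mem_univ _, m0⟩
    refine hG.tendsto_fst hp hloc (q := fun x => (h x, 1)) m1 ?_ ?_
    · simp only [hh]
      exact h0c.continuousAt
    · exact tendsto_nhdsWithin_iff.2 ⟨tendsto_const_nhds, Eventually.of_forall fun _ => m1⟩
  have key : ∃ ε : ℤˣ, StrictMono fun x => h (((ε : ℤ) : ℝ) * x) := by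
    rcases hc.strictMono_of_inj hi with hm | hm
    · exact ⟨1, by simpa using hm⟩
    · exact ⟨-1, fun x y hxy => hm (by simpa using hxy)⟩
  obtain ⟨ε, hε⟩ := key
  have hεε : ∀ x : ℝ, ((ε : ℤ) : ℝ) * (((ε : ℤ) : ℝ) * x) = x := fun x => by
    rcases Int.units_eq_one_or ε with rfl | rfl <;> simp
  set k : ℝ → ℝ := fun x => h (((ε : ℤ) : ℝ) * x) with hk
  have hkc : Continuous k := by fun_prop
  have hks : Function.Surjective k := fun y => by
    obtain ⟨x, hx⟩ := hs y
    exact ⟨((ε : ℤ) : ℝ) * x, by rw [hk]; simp only; rw [hεε, hx]⟩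
  -- The sign makes `k x = h (ε x)` increasing. Reparametrizing by the isotopy from the identity to
  -- `k` changes nothing at `t = 0` and turns the return map into `x ↦ ε x`, since `k (ε x) = h x`.
  refine ⟨ε, fun q => G ((1 - q.2) * q.1 + q.2 * k q.1, q.2), ⟨?_, ?_, ?_, ?_, hG.locinj⟩, ?_⟩
  · exact hG.cont.comp (by fun_prop) fun q hq => ⟨mem_univ _, hq.2⟩
  · exact fun t ht x => hG.comm t ht _
  · intro t ht x y hxy
    exact (surjective_convex_combination hε hkc hks ht).1.injective (hG.inj t ht hxy)
  · intro t ht e he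
    obtain ⟨y, hy⟩ := hG.surj t ht e he
    obtain ⟨x, hx⟩ := (surjective_convex_combination hε hkc hks ht).2 y
    exact ⟨x, by simp only at hx ⊢; rw [hx, hy]⟩
  · intro x
    simp only [hk, sub_self, zero_mul, zero_add, one_mul, sub_zero, add_zero, hεε]
    exact hh x

/-- A foliated surface without boundary over a circle of leaves is a cylinder or a Möbius band. -/
theorem foliatedHomeomorphic_band {F : Foliation Z}
    (hsb : ∀ ω ∈ F.singularLeaves, ω ⊆ surfaceBoundary Z)
    {γ : ℝ → LeafSpace F} {G : ℝ × ℝ → surfaceInterior Z} (hG : Dev (leafProj F) (Icc 0 1) γ G)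
    (hinj : InjOn γ (Ico 0 1)) (h01 : γ 0 = γ 1) (hsurj : γ '' Icc 0 1 = univ) :
    ∃ ε : ℤˣ, FoliatedHomeomorphic F.leaves (bandLeaves ε) := by
  have hp : Continuous (leafProj F) := continuous_leafProj
  have hloc := exists_locTriv_leafProj hsb
  have := t2Space_leafSpace hsb
  have hγ := hG.continuousOn hp
  have : CompactSpace (LeafSpace F) := ⟨hsurj ▸ isCompact_Icc.image_of_continuousOn hγ⟩
  have huniv := surfaceInterior_eq_univ_of_compactSpace hsb
  obtain ⟨ε, G, hG, hglue⟩ := exists_linear_gluing hp hloc hG h01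
  have m0 : (0 : ℝ) ∈ Icc (0 : ℝ) 1 := by simp
  have m1 : (1 : ℝ) ∈ Icc (0 : ℝ) 1 := by simp
  let Φ : ℝ × Icc (0 : ℝ) 1 → surfaceInterior Z := fun q => G (q.1, q.2)
  have hΦ : Continuous Φ := hG.cont.comp_continuous (by fun_prop) fun q => ⟨mem_univ _, q.2.2⟩
  have hpΦ : ∀ q, leafProj F (Φ q) = γ q.2 := fun q => hG.comm _ q.2.2 _
  have hΦs : Function.Surjective Φ := fun e => by
    obtain ⟨t, ht, hte⟩ : leafProj F e ∈ γ '' Icc 0 1 := hsurj ▸ mem_univ _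
    obtain ⟨x, hx⟩ := hG.surj t ht e hte.symm
    exact ⟨(x, ⟨t, ht⟩), hx⟩
  -- Along an ultrafilter whose image converges, the parameter converges by compactness of `[0, 1]`
  -- and the fibre position by `Dev.tendsto_fst`. Properness makes the induced bijection from the
  -- quotient closed, hence a homeomorphism.
  have hΦp : IsProperMap Φ := by
    refine isProperMap_iff_ultrafilter.2 ⟨hΦ, fun 𝒰 y hy => ?_⟩
    obtain ⟨t, ht⟩ : ∃ t, Tendsto Prod.snd (𝒰 : Filter (ℝ × Icc (0 : ℝ) 1)) (𝓝 t) := by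
      obtain ⟨t, -, ht⟩ := isCompact_univ.ultrafilter_le_nhds (𝒰.map Prod.snd) (by simp)
      exact ⟨t, ht⟩
    have hpy : leafProj F y = γ t := by
      have h1 : Tendsto (fun q => leafProj F (Φ q)) 𝒰 (𝓝 (leafProj F y)) :=
        hp.continuousAt.tendsto.comp hy
      have h2 : Tendsto (fun q => leafProj F (Φ q)) 𝒰 (𝓝 (γ t)) := by
        simp only [hpΦ]
        exact (hγ.domRestrict.continuousAt (x := t)).tendsto.comp ht
      exact tendsto_nhds_unique h1 h2
    obtain ⟨x, rfl⟩ := hG.surj t t.2 y hpy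
    refine ⟨(x, t), rfl, ?_⟩
    have h1 : Tendsto (fun q : ℝ × Icc (0 : ℝ) 1 => q.1) 𝒰 (𝓝 x) :=
      hG.tendsto_fst hp hloc (q := fun q : ℝ × Icc (0 : ℝ) 1 => (q.1, (q.2 : ℝ))) t.2 hy
        (tendsto_nhdsWithin_iff.2 ⟨(continuous_subtype_val.tendsto t).comp ht,
          Eventually.of_forall fun q => q.2.2⟩)
    have h2 := h1.prodMk_nhds ht
    exact h2
  have hrel : ∀ a b, glueRel ε a b → Φ a = Φ b := by
    rintro ⟨x, s⟩ ⟨y, t⟩ ⟨hs, ht, hxy⟩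
    simp only at hs ht hxy
    subst hs ht hxy
    exact (hglue x).symm
  let Q : GluedBand ε → surfaceInterior Z := Quot.lift Φ hrel
  have hQc : Continuous Q := continuous_quot_lift hrel hΦ
  have hQcl : IsClosedMap Q := by
    intro C hC
    have : Q '' C = Φ '' (Quot.mk _ ⁻¹' C) := by
      ext y
      constructor
      · rintro ⟨c, hc, rfl⟩
        obtain ⟨q, rfl⟩ := Quot.exists_rep c
        exact ⟨q, hc, rfl⟩
      · rintro ⟨q, hq, rfl⟩
        exact ⟨_, hq, rfl⟩
    rw [this]
    exact hΦp.isClosedMap _ (hC.preimage continuous_quot_mk)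
  have hQs : Function.Surjective Q := fun y => by
    obtain ⟨q, rfl⟩ := hΦs y
    exact ⟨Quot.mk _ q, rfl⟩
  have hglueQ : ∀ x y (s t : Icc (0 : ℝ) 1), (s : ℝ) = 0 → (t : ℝ) = 1 → Φ (x, s) = Φ (y, t) →
      Quot.mk (glueRel ε) (x, s) = Quot.mk (glueRel ε) (y, t) := by
    intro x y s t hs ht h
    refine Quot.sound ⟨Subtype.ext hs, Subtype.ext ht, ?_⟩
    have h1 : G (y, 1) = G (((ε : ℤ) : ℝ) * x, 1) := by
      rw [hglue x]
      have : G (x, (s : ℝ)) = G (y, (t : ℝ)) := h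
      rw [← ht, ← this, hs]
    exact hG.inj 1 m1 h1
  have hQi : Function.Injective Q := by
    intro a b hab
    obtain ⟨⟨x, s⟩, rfl⟩ := Quot.exists_rep a
    obtain ⟨⟨y, t⟩, rfl⟩ := Quot.exists_rep b
    have hab' : Φ (x, s) = Φ (y, t) := hab
    have hst : γ s = γ t := by rw [← hpΦ (x, s), ← hpΦ (y, t), hab']
    rcases s.2.2.lt_or_eq with hs1 | hs1 <;> rcases t.2.2.lt_or_eq with ht1 | ht1
    · have : s = t := Subtype.ext (hinj ⟨s.2.1, hs1⟩ ⟨t.2.1, ht1⟩ hst)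
      subst this
      rw [show x = y from hG.inj _ s.2 hab']
    · rw [ht1, ← h01] at hst
      have := hinj ⟨s.2.1, hs1⟩ (by simp) hst
      exact hglueQ x y s t this ht1 hab'
    · rw [hs1, ← h01] at hst
      have := hinj (by simp) ⟨t.2.1, ht1⟩ hst
      exact (hglueQ y x t s this.symm hs1 hab'.symm).symm
    · have : s = t := Subtype.ext (hs1.trans ht1.symm)
      subst this
      rw [show x = y from hG.inj _ s.2 hab']
  have hQh : IsHomeomorph Q :=
    isHomeomorph_iff_continuous_isClosedMap_bijective.2 ⟨hQc, hQcl, hQi, hQs⟩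
  let e : GluedBand ε ≃ₜ Z := hQh.homeomorph.trans
    ((Homeomorph.setCongr huniv).trans (Homeomorph.Set.univ Z))
  have he : ∀ a, e a = Q a := fun a => rfl
  refine ⟨ε, e.symm, fun ω hω => ?_⟩
  obtain ⟨z, hz⟩ := F.leaf_nonempty hω
  obtain ⟨a, rfl⟩ := e.surjective z
  obtain ⟨⟨x, t⟩, rfl⟩ := Quot.exists_rep a
  refine ⟨t, ?_⟩
  ext b
  constructor
  · rintro ⟨z', hz', rfl⟩
    obtain ⟨a', rfl⟩ := e.surjective z'
    rw [e.symm_apply_apply]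
    rw [he] at hz hz'
    have h1 : leafProj F (Q a') = leafProj F (Φ (x, t)) := leafProj_eq_iff.2 ⟨ω, hω, hz', hz⟩
    rw [hpΦ] at h1
    obtain ⟨y, hy⟩ := hG.surj t t.2 _ h1
    exact ⟨(y, t), rfl, hQi hy⟩
  · rintro ⟨⟨y, s⟩, hs, rfl⟩
    obtain rfl : s = t := hs
    refine ⟨e (Quot.mk _ (y, s)), ?_, e.symm_apply_apply _⟩
    rw [he] at hz ⊢
    have h1 : leafProj F (Φ (y, s)) = leafProj F (Φ (x, s)) := by rw [hpΦ, hpΦ]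
    obtain ⟨ω', hω', h2, h3⟩ := leafProj_eq_iff.1 h1
    rw [F.leaf_eq hω hω' hz h3]
    exact h2

end Band

/-! ### A line of leaves: boundary points lie at the end `-∞` or at the end `+∞`. -/

section Ends

variable {Z : Type*} [TopologicalSpace Z] {F : Foliation Z} {Ψ : ℝ × ℝ → Z}

/-- The leaves of the interior form a trivial family parametrized by the line. -/
structure LineFoliated (F : Foliation Z) (Ψ : ℝ × ℝ → Z) : Prop where
  emb : IsOpenEmbedding Ψ
  range_eq : range Ψ = surfaceInterior Z
  leaf : ∀ t, Ψ '' {q | q.2 = t} ∈ F.leaves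

/-- The coordinates of points in the interior. -/
noncomputable abbrev coords (Ψ : ℝ × ℝ → Z) : Z → ℝ × ℝ := Function.invFun Ψ

/-- A boundary point adjacent to the leaves with parameters near `-∞`. -/
def IsLower (Ψ : ℝ × ℝ → Z) (z : Z) : Prop :=
  Tendsto (fun y => (coords Ψ y).2) (𝓝[surfaceInterior Z] z) atBot

/-- A boundary point adjacent to the leaves with parameters near `+∞`. -/
def IsUpper (Ψ : ℝ × ℝ → Z) (z : Z) : Prop :=
  Tendsto (fun y => (coords Ψ y).2) (𝓝[surfaceInterior Z] z) atTop

theorem LineFoliated.coords_apply (h : LineFoliated F Ψ) (q : ℝ × ℝ) : coords Ψ (Ψ q) = q :=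
  Function.leftInverse_invFun h.emb.injective q

theorem LineFoliated.apply_coords (h : LineFoliated F Ψ) {z : Z} (hz : z ∈ surfaceInterior Z) :
    Ψ (coords Ψ z) = z := by
  rw [← h.range_eq] at hz
  obtain ⟨q, rfl⟩ := hz
  rw [h.coords_apply]

theorem LineFoliated.mem_interior (h : LineFoliated F Ψ) (q : ℝ × ℝ) : Ψ q ∈ surfaceInterior Z :=
  h.range_eq ▸ mem_range_self q

theorem LineFoliated.continuousAt_coords (h : LineFoliated F Ψ) {z : Z}
    (hz : z ∈ surfaceInterior Z) : ContinuousAt (coords Ψ) z := by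
  rw [← h.apply_coords hz]
  exact continuousAt_invFun h.emb _

theorem LineFoliated.level_eq (h : LineFoliated F Ψ) {ω : Set Z} (hω : ω ∈ F.leaves) {y z : Z}
    (hy : y ∈ ω) (hz : z ∈ ω) (hyi : y ∈ surfaceInterior Z) :
    (coords Ψ y).2 = (coords Ψ z).2 := by
  have h1 : ω = Ψ '' {q | q.2 = (coords Ψ y).2} :=
    F.leaf_eq hω (h.leaf _) hy ⟨coords Ψ y, rfl, h.apply_coords hyi⟩
  rw [h1] at hz
  obtain ⟨q, hq, rfl⟩ := hz
  rw [h.coords_apply, hq]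

/-- Reversing the levels exchanges the two ends, so that constructions at the lower end also serve
the upper one. -/
theorem LineFoliated.flip (h : LineFoliated F Ψ) : LineFoliated F fun q => Ψ (q.1, -q.2) where
  emb := h.emb.comp ((Homeomorph.refl ℝ).prodCongr (Homeomorph.neg ℝ)).isOpenEmbedding
  range_eq := by
    rw [← h.range_eq]
    ext z
    constructor
    · rintro ⟨q, rfl⟩; exact ⟨_, rfl⟩
    · rintro ⟨q, rfl⟩; exact ⟨(q.1, -q.2), by simp⟩
  leaf t := by
    convert h.leaf (-t) using 1
    ext z
    constructor
    · rintro ⟨q, rfl, rfl⟩; exact ⟨_, rfl, rfl⟩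
    · rintro ⟨q, hq, rfl⟩
      exact ⟨(q.1, -q.2), by simpa [neg_eq_iff_eq_neg] using hq, by simp⟩

theorem LineFoliated.coords_flip (h : LineFoliated F Ψ) {z : Z} (hz : z ∈ surfaceInterior Z) :
    coords (fun q => Ψ (q.1, -q.2)) z = ((coords Ψ z).1, -(coords Ψ z).2) := by
  have : z = (fun q : ℝ × ℝ => Ψ (q.1, -q.2)) ((coords Ψ z).1, -(coords Ψ z).2) := by
    simp only [neg_neg, Prod.mk.eta, h.apply_coords hz]
  conv_lhs => rw [this]
  exact h.flip.coords_apply _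

theorem LineFoliated.isLower_flip (h : LineFoliated F Ψ) {z : Z} :
    IsLower (fun q => Ψ (q.1, -q.2)) z ↔ IsUpper Ψ z := by
  have : (fun y => (coords (fun q => Ψ (q.1, -q.2)) y).2) =ᶠ[𝓝[surfaceInterior Z] z]
      fun y => -(coords Ψ y).2 := by
    filter_upwards [self_mem_nhdsWithin] with y hy
    rw [h.coords_flip hy]
  rw [IsLower, IsUpper, tendsto_congr' this, tendsto_neg_atBot_iff]

/-- The exponential as a map into the half-line. -/
noncomputable def expNN (u : ℝ) : ℝ≥0 := ⟨Real.exp u, (Real.exp_pos u).le⟩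

theorem continuous_expNN : Continuous expNN := isOpenEmbedding_expNN.continuous

theorem expNN_pos (u : ℝ) : 0 < expNN u := NNReal.coe_pos.1 (Real.exp_pos u)

theorem expNN_log {s : ℝ≥0} (hs : 0 < s) : expNN (Real.log s) = s :=
  Subtype.ext (Real.exp_log (NNReal.coe_pos.2 hs))

theorem tendsto_expNN_atBot : Tendsto expNN atBot (𝓝 0) :=
  NNReal.tendsto_coe.1 Real.tendsto_exp_atBot

variable {z : Z} {φ : ℝ × ℝ≥0 → Z}

theorem HalfChart.nhdsWithin_eq (hφ : HalfChart F z φ) (q : ℝ × ℝ≥0) :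
    𝓝[surfaceInterior Z] (φ q) = map φ (𝓝[{q | 0 < q.2}] q) := by
  rw [hφ.emb.isEmbedding.map_nhdsWithin_eq]
  have h1 : φ '' {q | 0 < q.2} = range φ ∩ surfaceInterior Z := by
    rw [← image_univ, hφ.range_inter, univ_inter]
  rw [h1, inter_comm]
  exact (nhdsWithin_inter_of_mem' (mem_nhdsWithin_of_mem_nhds
    (hφ.emb.isOpen_range.mem_nhds ⟨q, rfl⟩))).symm

theorem HalfChart.level_eq (hφ : HalfChart F z φ) (h : LineFoliated F Ψ) (r r' : ℝ) {s : ℝ≥0}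
    (hs : 0 < s) : (coords Ψ (φ (r, s))).2 = (coords Ψ (φ (r', s))).2 := by
  obtain ⟨ω, hω, hz⟩ := F.exists_leaf (φ (r, s))
  exact h.level_eq hω hz (hφ.plaque ω hω r r' s hz) (hφ.interior _ _ hs)

/-- The level of the plaques of a half-plane chart. -/
noncomputable def plaqueLevel (Ψ : ℝ × ℝ → Z) (φ : ℝ × ℝ≥0 → Z) (u : ℝ) : ℝ :=
  (coords Ψ (φ (0, expNN u))).2

theorem HalfChart.coords_eq (hφ : HalfChart F z φ) (h : LineFoliated F Ψ) (r : ℝ) {s : ℝ≥0}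
    (hs : 0 < s) : (coords Ψ (φ (r, s))).2 = plaqueLevel Ψ φ (Real.log s) := by
  rw [plaqueLevel, expNN_log hs, hφ.level_eq h r 0 hs]

theorem HalfChart.continuous_plaqueLevel (hφ : HalfChart F z φ) (h : LineFoliated F Ψ) :
    Continuous (plaqueLevel Ψ φ) := continuous_iff_continuousAt.2 fun u => by
  have h1 : Continuous fun u => φ (0, expNN u) :=
    hφ.emb.continuous.comp (continuous_const.prodMk continuous_expNN)
  exact continuousAt_snd.comp (ContinuousAt.comp (f := fun u => φ (0, expNN u))
    (h.continuousAt_coords (hφ.interior _ _ (expNN_pos u))) h1.continuousAt)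

/-- Local injectivity suffices. The height of the transversal `t ↦ Ψ (x₀, t)` in the half-plane
chart gives a map `σ` with `plaqueLevel ∘ σ = id`. As `σ` is continuous and injective it is open, so
its image is a neighbourhood on which `plaqueLevel` inverts it. -/
theorem HalfChart.injective_plaqueLevel (hφ : HalfChart F z φ) (h : LineFoliated F Ψ) :
    Function.Injective (plaqueLevel Ψ φ) := by
  rw [← injOn_univ]
  refine injOn_of_locally_injOn ordConnected_univ
    (hφ.continuous_plaqueLevel h).continuousOn fun u₀ _ => ?_
  rw [nhdsWithin_univ]
  set ψ := Function.invFun φ with hψ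
  have hψφ : ∀ q, ψ (φ q) = q := Function.leftInverse_invFun hφ.emb.injective
  obtain ⟨⟨x₀, t₀⟩, hq⟩ : ∃ q, coords Ψ (φ (0, expNN u₀)) = q := ⟨_, rfl⟩
  have hq' : Ψ (x₀, t₀) = φ (0, expNN u₀) := by
    rw [← hq, h.apply_coords (hφ.interior _ _ (expNN_pos u₀))]
  have hc : Continuous fun t => Ψ (x₀, t) := h.emb.continuous.comp (by fun_prop)
  set M := (fun t => Ψ (x₀, t)) ⁻¹' range φ with hM
  have hMo : IsOpen M := hφ.emb.isOpen_range.preimage hc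
  have ht₀ : t₀ ∈ M := ⟨_, hq'.symm⟩
  have hφψ : ∀ t ∈ M, φ (ψ (Ψ (x₀, t))) = Ψ (x₀, t) := by
    rintro t ⟨q, hq⟩
    rw [← show φ q = Ψ (x₀, t) from hq, hψφ]
  have hpos : ∀ t ∈ M, 0 < (ψ (Ψ (x₀, t))).2 := fun t ht => by
    rw [← hφ.mem_interior_iff, hφψ t ht]
    exact h.mem_interior _
  set σ : ℝ → ℝ := fun t => Real.log (ψ (Ψ (x₀, t))).2 with hσ
  have hinv : ∀ t ∈ M, plaqueLevel Ψ φ (σ t) = t := by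
    intro t ht
    rw [hσ, ← hφ.coords_eq h (ψ (Ψ (x₀, t))).1 (hpos t ht), Prod.mk.eta, hφψ t ht, h.coords_apply]
  have hσ₀ : σ t₀ = u₀ := by
    rw [hσ]
    simp only
    rw [hq', hψφ]
    exact Real.log_exp u₀
  have hσi : InjOn σ M := fun t ht t' ht' heq => by rw [← hinv t ht, ← hinv t' ht', heq]
  have hσn := nhds_le_map_of_injOn (f := σ) (t₀ := t₀) (by
    filter_upwards [hMo.mem_nhds ht₀] with t ht
    have h1 : ContinuousAt (fun t => ψ (Ψ (x₀, t))) t := by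
      refine ContinuousAt.comp (g := ψ) ?_ hc.continuousAt
      rw [← hφψ t ht]
      exact continuousAt_invFun hφ.emb _
    have h2 : ContinuousAt (fun t => ((ψ (Ψ (x₀, t))).2 : ℝ)) t :=
      (NNReal.continuous_coe.comp continuous_snd).continuousAt.comp h1
    exact h2.log (NNReal.coe_pos.2 (hpos t ht)).ne') ⟨M, hMo.mem_nhds ht₀, hσi⟩
  rw [hσ₀] at hσn
  refine ⟨σ '' M, hσn (image_mem_map (hMo.mem_nhds ht₀)), ?_⟩
  rintro _ ⟨t, ht, rfl⟩ _ ⟨t', ht', rfl⟩ heq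
  rw [hinv t ht, hinv t' ht'] at heq
  rw [heq]

/-- A finite limit `l` would make `z` inseparable, by saturated open sets, from the interior leaf at
level `l`. -/
theorem HalfChart.not_tendsto_plaqueLevel (hsb : ∀ ω ∈ F.singularLeaves, ω ⊆ surfaceBoundary Z)
    (hφ : HalfChart F z φ) (h : LineFoliated F Ψ) (l : ℝ) :
    ¬ Tendsto (plaqueLevel Ψ φ) atBot (𝓝 l) := by
  intro hl
  have hz : z ∈ surfaceBoundary Z := hφ.center ▸ hφ.boundary 0
  have h0 : Ψ (0, l) ∈ Ψ '' {q | q.2 = l} := ⟨_, rfl, rfl⟩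
  have hzn : z ∉ Ψ '' {q | q.2 = l} := by
    rintro ⟨q, -, rfl⟩
    exact h.mem_interior q hz
  obtain ⟨V, W, hV, hW, hVs, hWs, hd, hωV, hzW⟩ :=
    exists_separation hsb (h.leaf l) h0 (h.mem_interior _) hzn
  have hc : Continuous fun t => Ψ (0, t) := h.emb.continuous.comp (by fun_prop)
  have h1 : ∀ᶠ u in atBot, Ψ (0, plaqueLevel Ψ φ u) ∈ V :=
    hl.eventually ((hV.preimage hc).mem_nhds (hωV h0))
  have h2 : Tendsto (fun u => φ (0, expNN u)) atBot (𝓝 z) := by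
    have h3 : Tendsto (fun s : ℝ≥0 => φ (0, s)) (𝓝 0) (𝓝 (φ (0, 0))) :=
      (hφ.emb.continuous.comp (by fun_prop : Continuous fun s : ℝ≥0 => ((0 : ℝ), s))).continuousAt
    rw [hφ.center] at h3
    exact h3.comp tendsto_expNN_atBot
  obtain ⟨u, hu1, hu2⟩ := (h1.and (h2.eventually (hW.mem_nhds hzW))).exists
  refine disjoint_left.1 hd (hVs _ (h.leaf (plaqueLevel Ψ φ u))
    ⟨_, ⟨(0, plaqueLevel Ψ φ u), rfl, rfl⟩, hu1⟩ ?_) hu2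
  exact ⟨_, rfl, h.apply_coords (hφ.interior _ _ (expNN_pos u))⟩

theorem HalfChart.tendsto_log (hφ : HalfChart F z φ) (r : ℝ) :
    Tendsto (fun y => Real.log (Function.invFun φ y).2) (𝓝[surfaceInterior Z] (φ (r, 0))) atBot := by
  rw [hφ.nhdsWithin_eq, tendsto_map'_iff]
  have h1 : ((fun y => Real.log (Function.invFun φ y).2) ∘ φ) =
      fun q : ℝ × ℝ≥0 => Real.log q.2 := by
    ext q
    simp only [Function.comp, Function.leftInverse_invFun hφ.emb.injective q]
  rw [h1]
  refine Real.tendsto_log_nhdsGT_zero.comp (tendsto_nhdsWithin_iff.2 ⟨?_, ?_⟩)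
  · have : Continuous fun q : ℝ × ℝ≥0 => (q.2 : ℝ) := by fun_prop
    simpa using (this.continuousAt (x := (r, 0))).tendsto.mono_left nhdsWithin_le_nhds
  · filter_upwards [self_mem_nhdsWithin] with q hq using NNReal.coe_pos.2 hq

theorem HalfChart.eventually_level_eq (hφ : HalfChart F z φ) (h : LineFoliated F Ψ) (r : ℝ) :
    (fun y => (coords Ψ y).2) =ᶠ[𝓝[surfaceInterior Z] (φ (r, 0))]
      fun y => plaqueLevel Ψ φ (Real.log (Function.invFun φ y).2) := by
  rw [hφ.nhdsWithin_eq, EventuallyEq, eventually_map]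
  filter_upwards [self_mem_nhdsWithin] with q hq
  rw [Function.leftInverse_invFun hφ.emb.injective q]
  exact hφ.coords_eq h q.1 hq

theorem HalfChart.isLower_of_tendsto (hφ : HalfChart F z φ) (h : LineFoliated F Ψ)
    (ht : Tendsto (plaqueLevel Ψ φ) atBot atBot) (r : ℝ) : IsLower Ψ (φ (r, 0)) := by
  rw [IsLower, tendsto_congr' (hφ.eventually_level_eq h r)]
  exact ht.comp (hφ.tendsto_log r)

theorem HalfChart.isUpper_of_tendsto (hφ : HalfChart F z φ) (h : LineFoliated F Ψ)
    (ht : Tendsto (plaqueLevel Ψ φ) atBot atTop) (r : ℝ) : IsUpper Ψ (φ (r, 0)) := by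
  rw [IsUpper, tendsto_congr' (hφ.eventually_level_eq h r)]
  exact ht.comp (hφ.tendsto_log r)

/-- The plaque level is monotone in the height and has no finite limit at height `0`. -/
theorem isLower_or_isUpper (hsb : ∀ ω ∈ F.singularLeaves, ω ⊆ surfaceBoundary Z)
    (h : LineFoliated F Ψ) (hz : z ∈ surfaceBoundary Z) : IsLower Ψ z ∨ IsUpper Ψ z := by
  obtain ⟨φ, hφ⟩ := exists_halfChart hsb hz
  rw [← hφ.center]
  rcases (hφ.continuous_plaqueLevel h).strictMono_of_inj (hφ.injective_plaqueLevel h) with hm | hm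
  · rcases tendsto_atBot_of_monotone hm.monotone with h1 | ⟨l, h1⟩
    · exact Or.inl (hφ.isLower_of_tendsto h h1 0)
    · exact (hφ.not_tendsto_plaqueLevel hsb h l h1).elim
  · rcases tendsto_atBot_of_antitone hm.antitone with h1 | ⟨l, h1⟩
    · exact Or.inr (hφ.isUpper_of_tendsto h h1 0)
    · exact (hφ.not_tendsto_plaqueLevel hsb h l h1).elim

theorem HalfChart.tendsto_nhdsWithin {ι : Type*} {l : Filter ι} (hφ : HalfChart F z φ) (r : ℝ)
    {s : ι → ℝ≥0} (hs : Tendsto s l (𝓝 0)) (hs' : ∀ᶠ i in l, 0 < s i) :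
    Tendsto (fun i => φ (r, s i)) l (𝓝[surfaceInterior Z] (φ (r, 0))) := by
  refine tendsto_nhdsWithin_iff.2 ⟨?_, hs'.mono fun i hi => hφ.interior _ _ hi⟩
  have h3 : Tendsto (fun s : ℝ≥0 => φ (r, s)) (𝓝 0) (𝓝 (φ (r, 0))) :=
    (hφ.emb.continuous.comp (by fun_prop : Continuous fun s : ℝ≥0 => (r, s))).continuousAt
  exact h3.comp hs

theorem HalfChart.strictMono_plaqueLevel (hφ : HalfChart F z φ) (h : LineFoliated F Ψ)
    (hl : IsLower Ψ z) : StrictMono (plaqueLevel Ψ φ) ∧ Tendsto (plaqueLevel Ψ φ) atBot atBot := by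
  have h1 : Tendsto (plaqueLevel Ψ φ) atBot atBot := by
    have := hφ.tendsto_nhdsWithin 0 tendsto_expNN_atBot (Eventually.of_forall expNN_pos)
    rw [hφ.center] at this
    exact hl.comp this
  refine ⟨?_, h1⟩
  rcases (hφ.continuous_plaqueLevel h).strictMono_of_inj (hφ.injective_plaqueLevel h) with hm | hm
  · exact hm
  · exfalso
    obtain ⟨u, hu1, hu2⟩ := ((h1.eventually_lt_atBot (plaqueLevel Ψ φ 0)).and
      (eventually_le_atBot 0)).exists
    exact absurd hu1 (hm.antitone hu2).not_gt

theorem HalfChart.reflect (hφ : HalfChart F z φ) : HalfChart F z fun q => φ (-q.1, q.2) where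
  emb := hφ.emb.comp ((Homeomorph.neg ℝ).prodCongr (Homeomorph.refl ℝ≥0)).isOpenEmbedding
  center := by simp [hφ.center]
  plaque ω hω r r' s h := hφ.plaque ω hω _ _ s h
  interior r s hs := hφ.interior _ s hs
  boundary r := hφ.boundary _

/-- Half-plane charts can be oriented as the interior leaves. -/
theorem exists_oriented_halfChart (hsb : ∀ ω ∈ F.singularLeaves, ω ⊆ surfaceBoundary Z)
    (h : LineFoliated F Ψ) (hz : z ∈ surfaceBoundary Z) : ∃ φ, HalfChart F z φ ∧
      ∀ s, 0 < s → StrictMono fun r => (coords Ψ (φ (r, s))).1 := by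
  obtain ⟨φ, hφ⟩ := exists_halfChart hsb hz
  have hcont : ∀ r s, 0 < s → ContinuousAt (fun q => (coords Ψ (φ q)).1) (r, s) := fun r s hs =>
    continuousAt_fst.comp (ContinuousAt.comp (f := φ)
      (h.continuousAt_coords (hφ.interior _ _ hs)) hφ.emb.continuous.continuousAt)
  have hmono : ∀ s, 0 < s → StrictMono (fun r => (coords Ψ (φ (r, s))).1) ∨
      StrictAnti fun r => (coords Ψ (φ (r, s))).1 := by
    intro s hs
    refine Continuous.strictMono_of_inj ?_ ?_
    · exact continuous_iff_continuousAt.2 fun r =>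
        (hcont r s hs).comp (f := fun r => (r, s)) (by fun_prop)
    · intro r r' hr
      have h1 : coords Ψ (φ (r, s)) = coords Ψ (φ (r', s)) := Prod.ext hr (hφ.level_eq h r r' hs)
      have h2 : φ (r, s) = φ (r', s) := by
        rw [← h.apply_coords (hφ.interior r s hs), ← h.apply_coords (hφ.interior r' s hs), h1]
      exact congrArg Prod.fst (hφ.emb.injective h2)
  -- The sign of `d s` is the orientation of the plaque at height `s`. It is constant because `d`
  -- has no zero on the connected set of positive heights; if it is negative, the chart is
  -- reflected.
  set d : ℝ≥0 → ℝ := fun s => (coords Ψ (φ (1, s))).1 - (coords Ψ (φ (0, s))).1 with hd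
  have hdc : ContinuousOn d (Ioi 0) := fun s hs =>
    (((hcont 1 s hs).comp (f := fun s => (1, s)) (by fun_prop)).sub
      ((hcont 0 s hs).comp (f := fun s => (0, s)) (by fun_prop))).continuousWithinAt
  have hd0 : (0 : ℝ) ∉ d '' Ioi 0 := by
    rintro ⟨s, hs, h0⟩
    rcases hmono s hs with hm | hm
    · have := hm (zero_lt_one (α := ℝ))
      simp only [hd] at h0 this
      linarith
    · have := hm (zero_lt_one (α := ℝ))
      simp only [hd] at h0 this
      linarith
  have hdo : (d '' Ioi 0).OrdConnected := (isPreconnected_Ioi.image d hdc).ordConnected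
  by_cases hpos : 0 < d 1
  · refine ⟨φ, hφ, fun s hs => (hmono s hs).resolve_right fun hm => hd0 ?_⟩
    have := hm (zero_lt_one (α := ℝ))
    refine hdo.out ⟨s, hs, rfl⟩ ⟨1, zero_lt_one' ℝ≥0, rfl⟩ ⟨?_, hpos.le⟩
    simp only [hd] at this ⊢
    linarith
  · refine ⟨_, hφ.reflect, fun s hs => ?_⟩
    have hm : StrictAnti fun r => (coords Ψ (φ (r, s))).1 :=
      (hmono s hs).resolve_left fun hm => hd0 (by
        have := hm (zero_lt_one (α := ℝ))
        refine hdo.out ⟨1, zero_lt_one' ℝ≥0, rfl⟩ ⟨s, hs, rfl⟩ ⟨not_lt.1 hpos, ?_⟩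
        simp only [hd] at this ⊢
        linarith)
    exact fun r r' hr => hm (neg_lt_neg hr)

end Ends

/-! ### Clamping, and inversion of families of homeomorphisms of the line. -/

/-- The retraction of the line onto `[-1, 1]`. -/
noncomputable def clampUnit (r : ℝ) : ℝ := max (-1) (min r 1)

theorem continuous_clampUnit : Continuous clampUnit := by unfold clampUnit; fun_prop

theorem monotone_clampUnit : Monotone clampUnit := fun _ _ h =>
  max_le_max le_rfl (min_le_min h le_rfl)

theorem clampUnit_mem (r : ℝ) : clampUnit r ∈ Icc (-1 : ℝ) 1 :=
  ⟨le_max_left _ _, max_le (by norm_num) (min_le_right _ _)⟩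

theorem clampUnit_of_mem {r : ℝ} (hr : r ∈ Icc (-1 : ℝ) 1) : clampUnit r = r := by
  rw [clampUnit, min_eq_left hr.2, max_eq_right hr.1]

theorem clampUnit_of_one_le {r : ℝ} (hr : 1 ≤ r) : clampUnit r = 1 := by
  rw [clampUnit, min_eq_right hr, max_eq_right (by norm_num)]

theorem clampUnit_of_le_neg_one {r : ℝ} (hr : r ≤ -1) : clampUnit r = -1 := by
  rw [clampUnit, min_eq_left (by linarith), max_eq_left hr]

theorem monotone_sub_clampUnit : Monotone fun r => r - clampUnit r := by
  intro r r' h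
  simp only
  rcases le_total r (-1) with h1 | h1 <;> rcases le_total r' 1 with h2 | h2 <;>
    rcases le_total r 1 with h3 | h3 <;> rcases le_total r' (-1) with h4 | h4 <;>
    simp only [clampUnit, min_eq_left, min_eq_right, max_eq_left, max_eq_right, *] <;>
    first
      | linarith
      | norm_num
        try linarith

/-- A continuous family of increasing homeomorphisms of the line has a continuous inverse. -/
theorem exists_fibre_inverse {ξ : ℝ × ℝ → ℝ} (hc : Continuous ξ)
    (hm : ∀ t, StrictMono fun r => ξ (r, t)) (hs : ∀ t, Function.Surjective fun r => ξ (r, t)) :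
    ∃ ρ : ℝ × ℝ → ℝ, Continuous ρ ∧ (∀ t, StrictMono fun x => ρ (x, t)) ∧
      (∀ x t, ξ (ρ (x, t), t) = x) ∧ ∀ r t, ρ (ξ (r, t), t) = r := by
  let Φ : ℝ × ℝ → ℝ × ℝ := fun q => (ξ q, q.2)
  have hbij : Function.Bijective Φ := by
    constructor
    · rintro ⟨r, t⟩ ⟨r', t'⟩ h
      simp only [Φ, Prod.mk.injEq] at h
      obtain ⟨h1, rfl⟩ := h
      rw [(hm t).injective h1]
    · rintro ⟨x, t⟩
      obtain ⟨r, hr⟩ := hs t x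
      exact ⟨(r, t), Prod.ext hr rfl⟩
  have hopen : IsOpenMap Φ := IsOpenMap.of_nhds_le fun ⟨r, t⟩ => by
    have := nhds_prod_le_map (r := ξ) (s := id) (x₀ := r) (t₀ := t) (l := 𝓝 t)
      (Eventually.of_forall fun q => hc.continuousAt)
      ⟨univ, univ_mem, (hm t).injective.injOn⟩ (by simp)
    rw [← nhds_prod_eq] at this
    exact this
  let e := (Equiv.ofBijective Φ hbij).toHomeomorphOfContinuousOpen
    (show Continuous Φ from hc.prodMk continuous_snd) hopen
  have he : ∀ q, e q = (ξ q, q.2) := fun q => rfl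
  have h2 : ∀ q, (e.symm q).2 = q.2 := fun q => by
    conv_rhs => rw [← e.apply_symm_apply q, he]
  have h1 : ∀ x t, ξ ((e.symm (x, t)).1, t) = x := fun x t => by
    have := congrArg Prod.fst (e.apply_symm_apply (x, t))
    rw [he] at this
    simp only at this
    rwa [← Prod.mk.eta (p := e.symm (x, t)), h2] at this
  refine ⟨fun q => (e.symm q).1, by fun_prop, fun t x y hxy => ?_, h1, fun r t => ?_⟩
  · rw [← (hm t).lt_iff_lt]
    simpa only [h1] using hxy
  · exact (hm t).injective (h1 _ t)

/-! ### Fibre coordinates adapted to one boundary chart. -/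

section Adapted

variable {Z : Type*} [TopologicalSpace Z] {F : Foliation Z} {Ψ : ℝ × ℝ → Z} {z : Z}
  {φ : ℝ × ℝ≥0 → Z} {ρ : ℝ × ℝ → ℝ} {σ : ℝ → ℝ≥0} {t₀ : ℝ} {M : ℝ → ℝ}

/-- A fibre coordinate `ρ` on the interior, given by a half-plane chart near a boundary point. -/
structure AdaptedChart (F : Foliation Z) (Ψ : ℝ × ℝ → Z) (z : Z) (φ : ℝ × ℝ≥0 → Z)
    (ρ : ℝ × ℝ → ℝ) (σ : ℝ → ℝ≥0) (t₀ : ℝ) (M : ℝ → ℝ) : Prop where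
  half : HalfChart F z φ
  cont : Continuous ρ
  mono : ∀ t, StrictMono fun x => ρ (x, t)
  pos : ∀ t ≤ t₀, 0 < σ t
  le_one : ∀ t ≤ t₀, σ t ≤ 1
  lim : Tendsto σ atBot (𝓝 0)
  level : ∀ t ≤ t₀, ∀ r, (coords Ψ (φ (r, σ t))).2 = t
  clamp : ∀ r s, 0 < s → s ≤ 1 → clampUnit (ρ (coords Ψ (φ (r, s)))) = clampUnit r
  coord : ∀ r ∈ Icc (-1 : ℝ) 1, ∀ s, 0 < s → s ≤ 1 → ρ (coords Ψ (φ (r, s))) = r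
  contM : Continuous M
  bound : ∀ x t, |ρ (x, t)| ≤ 1 → |x| ≤ M t
  lower : ∀ r, IsLower Ψ (φ (r, 0))

/-- The coordinate `ρ` is the fibrewise inverse of a family `ξ`: for `|r| ≤ 1`, `ξ (r, t)` is the
`x`-coordinate of the chart point with abscissa `r` on the plaque of level `t`, and `ξ` continues
with slope one outside `[-1, 1]`. Here `σ t` is the height of that plaque, `t₀` is the level at
height `1`, and `M t` bounds the `x`-extent of the unit box at level `t`. -/
theorem exists_adaptedChart (hsb : ∀ ω ∈ F.singularLeaves, ω ⊆ surfaceBoundary Z)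
    (h : LineFoliated F Ψ) (hz : z ∈ surfaceBoundary Z) (hl : IsLower Ψ z) :
    ∃ φ ρ σ t₀ M, AdaptedChart F Ψ z φ ρ σ t₀ M := by
  obtain ⟨φ, hφ, hor⟩ := exists_oriented_halfChart hsb h hz
  obtain ⟨hκm, hκl⟩ := hφ.strictMono_plaqueLevel h hl
  have hκc := hφ.continuous_plaqueLevel h
  set κ := plaqueLevel Ψ φ with hκ
  have hκe : IsOpenEmbedding κ := .of_continuous_injective_isOpenMap hκc hκm.injective
    (IsOpenMap.of_nhds_le fun u => nhds_le_map_of_injOn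
      (Eventually.of_forall fun t => hκc.continuousAt) ⟨univ, univ_mem, hκm.injective.injOn⟩)
  have hrange : ∀ t, min t (κ 0) ∈ range κ := fun t => by
    obtain ⟨v, hv⟩ := (hκl.eventually_le_atBot (min t (κ 0))).exists
    exact mem_range_of_exists_le_of_exists_ge hκc ⟨v, hv⟩ ⟨0, min_le_right _ _⟩
  -- Levels above `κ 0` are treated as `κ 0`, that is, height `1`, so that `ξ` is defined and
  -- continuous for all `t`.
  set u : ℝ → ℝ := fun t => Function.invFun κ (min t (κ 0)) with hu
  have hκu : ∀ t, κ (u t) = min t (κ 0) := fun t => Function.invFun_eq (hrange t)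
  have huκ : ∀ v ≤ 0, u (κ v) = v := fun v hv => by
    refine hκm.injective ?_
    rw [hκu, min_eq_left (hκm.monotone hv)]
  have huc : Continuous u := continuous_iff_continuousAt.2 fun t => by
    refine ContinuousAt.comp (g := Function.invFun κ) ?_ (by fun_prop)
    obtain ⟨v, hv⟩ := hrange t
    rw [← hv]
    exact continuousAt_invFun hκe v
  have hul : Tendsto u atBot atBot := tendsto_atBot.2 fun b => by
    filter_upwards [eventually_le_atBot (κ b)] with t ht
    rw [← hκm.le_iff_le, hκu]
    exact (min_le_left _ _).trans ht
  set ξ : ℝ × ℝ → ℝ := fun q =>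
    (coords Ψ (φ (clampUnit q.1, expNN (u q.2)))).1 + (q.1 - clampUnit q.1) with hξ
  have hξc : Continuous ξ := by
    refine Continuous.add ?_ (continuous_fst.sub (continuous_clampUnit.comp continuous_fst))
    refine continuous_iff_continuousAt.2 fun q => continuousAt_fst.comp (ContinuousAt.comp
      (f := fun q : ℝ × ℝ => φ (clampUnit q.1, expNN (u q.2)))
      (h.continuousAt_coords (hφ.interior _ _ (expNN_pos _))) ?_)
    have h1 := continuous_clampUnit
    have h2 := continuous_expNN
    have h3 := hφ.emb.continuous
    fun_prop
  have hξm : ∀ t, StrictMono fun r => ξ (r, t) := by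
    intro t r r' hr
    have h1 := (hor _ (expNN_pos (u t))).monotone (monotone_clampUnit hr.le)
    have h2 := monotone_sub_clampUnit hr.le
    simp only at h1 h2
    rcases (monotone_clampUnit hr.le).lt_or_eq with h3 | h3
    · have h1' := hor _ (expNN_pos (u t)) h3
      simp only [hξ] at h1' ⊢
      linarith
    · simp only [hξ, h3]
      linarith
  have hξs : ∀ t, Function.Surjective fun r => ξ (r, t) := by
    intro t
    have hc : Continuous fun r => ξ (r, t) := hξc.comp (by fun_prop)
    refine hc.surjective ?_ ?_
    · refine tendsto_atTop.2 fun b => ?_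
      filter_upwards [eventually_ge_atTop 1, eventually_ge_atTop
        (b + 1 - (coords Ψ (φ (1, expNN (u t)))).1)] with r h1 h2
      simp only [hξ, clampUnit_of_one_le h1]
      linarith
    · refine tendsto_atBot.2 fun b => ?_
      filter_upwards [eventually_le_atBot (-1), eventually_le_atBot
        (b - 1 - (coords Ψ (φ (-1, expNN (u t)))).1)] with r h1 h2
      simp only [hξ, clampUnit_of_le_neg_one h1]
      linarith
  obtain ⟨ρ, hρc, hρm, hξρ, hρξ⟩ := exists_fibre_inverse hξc hξm hξs
  have hlog : ∀ s : ℝ≥0, s ≤ 1 → Real.log s ≤ 0 := fun s hs =>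
    Real.log_nonpos s.2 (NNReal.coe_le_one.2 hs)
  have hξφ : ∀ r s, 0 < s → s ≤ 1 → ξ (r, (coords Ψ (φ (r, s))).2) =
      (coords Ψ (φ (clampUnit r, s))).1 + (r - clampUnit r) := by
    intro r s hs hs1
    simp only [hξ]
    rw [hφ.coords_eq h r hs, ← hκ, huκ _ (hlog s hs1), expNN_log hs]
  have hcoord : ∀ r ∈ Icc (-1 : ℝ) 1, ∀ s, 0 < s → s ≤ 1 → ρ (coords Ψ (φ (r, s))) = r := by
    intro r hr s hs hs1
    have h1 := hξφ r s hs hs1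
    rw [clampUnit_of_mem hr, sub_self, add_zero] at h1
    have h2 := hρξ r (coords Ψ (φ (r, s))).2
    rwa [h1] at h2
  have hclamp : ∀ r s, 0 < s → s ≤ 1 → clampUnit (ρ (coords Ψ (φ (r, s)))) = clampUnit r := by
    intro r s hs hs1
    have hlev : ∀ r', coords Ψ (φ (r', s)) =
        ((coords Ψ (φ (r', s))).1, (coords Ψ (φ (r, s))).2) := fun r' =>
      Prod.ext rfl (hφ.level_eq h r' r hs)
    have hmono : ∀ r₁ r₂, r₁ ≤ r₂ → ρ (coords Ψ (φ (r₁, s))) ≤ ρ (coords Ψ (φ (r₂, s))) := by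
      intro r₁ r₂ h12
      rw [hlev r₁, hlev r₂]
      exact (hρm _).monotone ((hor s hs).monotone h12)
    rcases le_total 1 r with h1 | h1
    · have := hmono 1 r h1
      rw [hcoord 1 (by simp) s hs hs1] at this
      rw [clampUnit_of_one_le h1, clampUnit_of_one_le this]
    rcases le_total r (-1) with h2 | h2
    · have := hmono r (-1) h2
      rw [hcoord (-1) (by simp) s hs hs1] at this
      rw [clampUnit_of_le_neg_one h2, clampUnit_of_le_neg_one this]
    · rw [hcoord r ⟨h2, h1⟩ s hs hs1]
  refine ⟨φ, ρ, fun t => expNN (u t), κ 0, fun t => max |ξ (-1, t)| |ξ (1, t)|, hφ, hρc, hρm,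
    fun t _ => expNN_pos _, fun t ht => ?_, tendsto_expNN_atBot.comp hul, fun t ht r => ?_,
    hclamp, hcoord, by fun_prop, fun x t hx => ?_, hφ.isLower_of_tendsto h hκl⟩
  · have : u t ≤ 0 := by
      rw [← hκm.le_iff_le, hκu]
      exact min_le_right _ _
    exact NNReal.coe_le_coe.1 (Real.exp_le_one_iff.2 this)
  · rw [hφ.level_eq h r 0 (expNN_pos _)]
    change κ (u t) = t
    rw [hκu, min_eq_left ht]
  · obtain ⟨h1, h2⟩ := abs_le.1 hx
    have h3 := (hξm t).monotone h1
    have h4 := (hξm t).monotone h2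
    simp only [hξρ] at h3 h4
    rw [abs_le]
    constructor
    · have := (neg_abs_le (ξ (-1, t))).trans h3
      linarith [le_max_left |ξ (-1, t)| |ξ (1, t)|]
    · have := h4.trans (le_abs_self (ξ (1, t)))
      linarith [le_max_right |ξ (-1, t)| |ξ (1, t)|]

/-- The level determines the height of the plaque, and `ρ` the abscissa on it, so low interior
points with `ρ` in `[-1, 1]` lie in the chart box. -/
theorem AdaptedChart.eq_of_coord (h : AdaptedChart F Ψ z φ ρ σ t₀ M) (hΨ : LineFoliated F Ψ)
    {y : Z} (hy : y ∈ surfaceInterior Z) (ht : (coords Ψ y).2 ≤ t₀)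
    (hr : ρ (coords Ψ y) ∈ Icc (-1 : ℝ) 1) :
    y = φ (ρ (coords Ψ y), σ (coords Ψ y).2) := by
  set r := ρ (coords Ψ y)
  set t := (coords Ψ y).2 with htdef
  have hi := h.half.interior r (σ t) (h.pos t ht)
  have h1 : coords Ψ (φ (r, σ t)) = coords Ψ y := by
    have h2 := h.coord r hr _ (h.pos t ht) (h.le_one t ht)
    have h3 := h.level t ht r
    refine Prod.ext ?_ h3
    refine (h.mono t).injective ?_
    have e1 : ((coords Ψ (φ (r, σ t))).1, t) = coords Ψ (φ (r, σ t)) := Prod.ext rfl h3.symm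
    rw [e1, h2]
  rw [← hΨ.apply_coords hy, ← h1, hΨ.apply_coords hi]

/-- A boundary point off a box of an adapted chart lies on one side of this box. -/
theorem AdaptedChart.eventually_side [T2Space Z]
    (hsb : ∀ ω ∈ F.singularLeaves, ω ⊆ surfaceBoundary Z) (h : AdaptedChart F Ψ z φ ρ σ t₀ M)
    (hΨ : LineFoliated F Ψ) {α β : ℝ} (hα : -1 ≤ α) (hαβ : α ≤ β) (hβ : β ≤ 1) {z' : Z}
    (hz' : z' ∈ surfaceBoundary Z) (hl : IsLower Ψ z') (hC : z' ∉ φ '' (Icc α β ×ˢ Icc 0 1)) :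
    (∀ᶠ y in 𝓝[surfaceInterior Z] z', ρ (coords Ψ y) < α) ∨
      ∀ᶠ y in 𝓝[surfaceInterior Z] z', β < ρ (coords Ψ y) := by
  obtain ⟨φ', hφ'⟩ := exists_halfChart hsb hz'
  have hcomp : IsCompact (φ '' (Icc α β ×ˢ Icc 0 1)) :=
    (isCompact_Icc.prod isCompact_Icc).image h.half.emb.continuous
  have h1 : φ' ⁻¹' (φ '' (Icc α β ×ˢ Icc 0 1))ᶜ ∈ 𝓝 ((0 : ℝ), (0 : ℝ≥0)) := by
    refine hφ'.emb.continuous.continuousAt (hcomp.isClosed.isOpen_compl.mem_nhds ?_)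
    rw [hφ'.center]
    exact hC
  have h2 : ∀ᶠ y in 𝓝[surfaceInterior Z] (φ' (0, 0)), (coords Ψ y).2 ≤ t₀ := by
    rw [hφ'.center]
    exact hl.eventually_le_atBot t₀
  rw [hφ'.nhdsWithin_eq, eventually_map, eventually_nhdsWithin_iff] at h2
  obtain ⟨ε, hε, hball⟩ := Metric.mem_nhds_iff.1 (inter_mem h1 h2)
  -- A connected half-box above the bottom line around `z'`, low enough and disjoint from the
  -- compact chart box. On it `ρ` never takes values in `[α, β]`, so it stays on one side.
  set Q : Set (ℝ × ℝ≥0) := Metric.ball 0 ε ×ˢ (Ioo 0 ⟨ε, hε.le⟩) with hQ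
  have hQball : Q ⊆ Metric.ball (0, 0) ε ∩ {q | 0 < q.2} := by
    rintro ⟨x, s⟩ ⟨hx, hs⟩
    refine ⟨?_, hs.1⟩
    rw [← ball_prod_same]
    refine ⟨hx, ?_⟩
    rw [Metric.mem_ball, NNReal.dist_eq, NNReal.coe_zero, sub_zero]
    have h0 : |(s : ℝ)| < ε := by
      rw [NNReal.abs_eq]
      exact hs.2
    exact h0
  have hoff : ∀ q ∈ Q, ρ (coords Ψ (φ' q)) ∉ Icc α β := by
    intro q hq hr
    obtain ⟨hq1, hq2⟩ := hQball hq
    obtain ⟨h3, h4⟩ := hball hq1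
    have hi := hφ'.interior q.1 q.2 hq2
    have ht := h4 hq2
    have := h.eq_of_coord hΨ hi ht ⟨hα.trans hr.1, hr.2.trans hβ⟩
    exact h3 ⟨_, ⟨hr, zero_le, h.le_one _ ht⟩, this.symm⟩
  have hpre : IsPreconnected ((fun q => ρ (coords Ψ (φ' q))) '' Q) := by
    refine IsPreconnected.image ?_ _ fun q hq => ?_
    · rw [hQ, Real.ball_eq_Ioo]
      exact isPreconnected_Ioo.prod isPreconnected_Ioo
    · exact (ContinuousAt.comp (g := ρ) h.cont.continuousAt (ContinuousAt.comp (f := φ')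
        (hΨ.continuousAt_coords (hφ'.interior _ _ (hQball hq).2))
        hφ'.emb.continuous.continuousAt)).continuousWithinAt
  have hQn : φ' '' Q ∈ 𝓝[surfaceInterior Z] z' := by
    rw [← hφ'.center, hφ'.nhdsWithin_eq]
    refine image_mem_map ?_
    have h3 : Metric.ball 0 ε ×ˢ Iio ⟨ε, hε.le⟩ ∈ 𝓝 ((0 : ℝ), (0 : ℝ≥0)) :=
      prod_mem_nhds (Metric.ball_mem_nhds _ hε) (Iio_mem_nhds (NNReal.coe_pos.1 hε))
    filter_upwards [mem_nhdsWithin_of_mem_nhds h3, self_mem_nhdsWithin] with q hq hq'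
    exact ⟨hq.1, hq', hq.2⟩
  by_cases hex : ∃ q ∈ Q, ρ (coords Ψ (φ' q)) < α
  · left
    obtain ⟨q, hq, hqα⟩ := hex
    filter_upwards [hQn]
    rintro _ ⟨q', hq', rfl⟩
    by_contra hcon
    have h5 := hpre.ordConnected.out ⟨q, hq, rfl⟩ ⟨q', hq', rfl⟩
      (⟨hqα.le, not_lt.1 hcon⟩ : α ∈ Icc _ _)
    obtain ⟨q'', hq'', heq⟩ := h5
    exact hoff q'' hq'' (by rw [show ρ (coords Ψ (φ' q'')) = α from heq]; exact ⟨le_rfl, hαβ⟩)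
  · right
    push Not at hex
    filter_upwards [hQn]
    rintro _ ⟨q', hq', rfl⟩
    by_contra hcon
    exact hoff q' hq' ⟨hex q' hq', not_lt.1 hcon⟩

/-- The clamped fibre coordinate of an adapted chart extends to the lower boundary. -/
theorem AdaptedChart.exists_tendsto_clampUnit [T2Space Z]
    (hsb : ∀ ω ∈ F.singularLeaves, ω ⊆ surfaceBoundary Z) (h : AdaptedChart F Ψ z φ ρ σ t₀ M)
    (hΨ : LineFoliated F Ψ) {z' : Z} (hz' : z' ∈ surfaceBoundary Z) (hl : IsLower Ψ z') :
    ∃ l, Tendsto (fun y => clampUnit (ρ (coords Ψ y))) (𝓝[surfaceInterior Z] z') (𝓝 l) := by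
  by_cases hC : z' ∈ φ '' (Icc (-1) 1 ×ˢ Icc 0 1)
  · obtain ⟨⟨r, s⟩, -, rfl⟩ := hC
    have hs : s = 0 := by
      by_contra hs
      exact h.half.interior r s (pos_iff_ne_zero.2 hs) hz'
    subst hs
    refine ⟨clampUnit r, ?_⟩
    rw [h.half.nhdsWithin_eq, tendsto_map'_iff]
    have h1 : Tendsto (fun q : ℝ × ℝ≥0 => clampUnit q.1) (𝓝[{q | 0 < q.2}] (r, 0))
        (𝓝 (clampUnit r)) :=
      ((continuous_clampUnit.comp continuous_fst).continuousAt (x := (r, (0 : ℝ≥0)))).tendsto.mono_left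
        nhdsWithin_le_nhds
    refine h1.congr' ?_
    have h2 : {q : ℝ × ℝ≥0 | q.2 < 1} ∈ 𝓝 (r, (0 : ℝ≥0)) :=
      (isOpen_Iio.preimage continuous_snd).mem_nhds (zero_lt_one' ℝ≥0)
    filter_upwards [self_mem_nhdsWithin, mem_nhdsWithin_of_mem_nhds h2] with q hq hq'
    exact (h.clamp q.1 q.2 hq (show q.2 < 1 from hq').le).symm
  -- Off the full box the clamped coordinate is eventually constant, equal to `-1` or `1`.
  · rcases h.eventually_side hsb hΨ le_rfl (by norm_num) le_rfl hz' hl hC with h1 | h1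
    · refine ⟨-1, tendsto_const_nhds.congr' ?_⟩
      filter_upwards [h1] with y hy using (clampUnit_of_le_neg_one hy.le).symm
    · refine ⟨1, tendsto_const_nhds.congr' ?_⟩
      filter_upwards [h1] with y hy using (clampUnit_of_one_le hy.le).symm

end Adapted

/-! ### The fibre coordinate made of countably many clamped coordinates. -/

/-- Finitely many continuous functions on each half-line `[-n, ∞)` have a common continuous bound. -/
theorem exists_continuous_bound {M : ℕ → ℝ → ℝ} (hM : ∀ n, Continuous (M n)) :
    ∃ A : ℝ → ℝ, Continuous A ∧ (∀ t, 0 ≤ A t) ∧ ∀ t (n : ℕ), (n : ℝ) ≤ -t → M n t ≤ A t := by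
  -- The admissible bounds at `t` form a convex set, so locally constant choices can be averaged to
  -- a continuous one. Near `t₀` only the indices `n < -t₀ + 1` matter, and the sum of `|M n t₀| +
  -- 1` over them is admissible.
  obtain ⟨A, hA⟩ := exists_continuous_forall_mem_convex_of_local_const (X := ℝ) (E := ℝ)
    (t := fun t => {c | 0 ≤ c ∧ ∀ n : ℕ, (n : ℝ) ≤ -t → M n t ≤ c}) (fun t => by
      intro c hc d hd a b ha hb hab
      refine ⟨by have := mul_nonneg ha hc.1; have := mul_nonneg hb hd.1
                 simp only [smul_eq_mul]; linarith, fun n hn => ?_⟩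
      have h1 := mul_le_mul_of_nonneg_left (hc.2 n hn) ha
      have h2 := mul_le_mul_of_nonneg_left (hd.2 n hn) hb
      have h3 : M n t = a * M n t + b * M n t := by rw [← add_mul, hab, one_mul]
      simp only [smul_eq_mul]
      linarith) (fun t₀ => by
      refine ⟨∑ n ∈ Finset.range ⌈-t₀ + 1⌉₊, (|M n t₀| + 1), ?_⟩
      have h1 : ∀ᶠ t in 𝓝 t₀, ∀ n ∈ Finset.range ⌈-t₀ + 1⌉₊, M n t < |M n t₀| + 1 :=
        (Finset.eventually_all _).2 fun n _ => (hM n).continuousAt.eventually_lt_const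
          (lt_of_le_of_lt (le_abs_self _) (lt_add_one _))
      filter_upwards [h1, lt_mem_nhds (sub_one_lt t₀)] with t ht ht'
      have hnn : ∀ n ∈ Finset.range ⌈-t₀ + 1⌉₊, 0 ≤ |M n t₀| + 1 := fun n _ => by positivity
      refine ⟨Finset.sum_nonneg hnn, fun n hn => ?_⟩
      have hmem : n ∈ Finset.range ⌈-t₀ + 1⌉₊ := by
        rw [Finset.mem_range, Nat.lt_ceil]
        linarith
      exact (ht n hmem).le.trans (Finset.single_le_sum hnn hmem))
  exact ⟨A, A.continuous, fun t => (hA t).1, fun t => (hA t).2⟩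

/-- A weighted sum of clamped functions. -/
noncomputable def clampedSum (ρ : ℕ → ℝ × ℝ → ℝ) (q : ℝ × ℝ) : ℝ :=
  ∑' n, (1 / 2 : ℝ) ^ n * clampUnit (ρ n q)

theorem norm_clampedSum_term_le (n : ℕ) (r : ℝ) :
    ‖(1 / 2 : ℝ) ^ n * clampUnit r‖ ≤ (1 / 2 : ℝ) ^ n := by
  rw [norm_mul, Real.norm_of_nonneg (by positivity)]
  exact mul_le_of_le_one_right (by positivity) (abs_le.2 (clampUnit_mem r))

theorem summable_clampedSum (ρ : ℕ → ℝ × ℝ → ℝ) (q : ℝ × ℝ) :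
    Summable fun n => (1 / 2 : ℝ) ^ n * clampUnit (ρ n q) :=
  Summable.of_norm_bounded summable_geometric_two fun n => norm_clampedSum_term_le n _

theorem abs_clampedSum_le (ρ : ℕ → ℝ × ℝ → ℝ) (q : ℝ × ℝ) : |clampedSum ρ q| ≤ 2 := by
  have := tsum_of_norm_bounded hasSum_geometric_two
    fun n => norm_clampedSum_term_le n (ρ n q)
  exact this

theorem continuous_clampedSum {ρ : ℕ → ℝ × ℝ → ℝ} (hρ : ∀ n, Continuous (ρ n)) :
    Continuous (clampedSum ρ) :=
  continuous_tsum (fun n => continuous_const.mul (continuous_clampUnit.comp (hρ n)))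
    summable_geometric_two fun n _ => norm_clampedSum_term_le n _

theorem le_clampedSum_sub {ρ : ℕ → ℝ × ℝ → ℝ} {p q : ℝ × ℝ} (h : ∀ n, ρ n p ≤ ρ n q) (n : ℕ) :
    (1 / 2 : ℝ) ^ n * (clampUnit (ρ n q) - clampUnit (ρ n p)) ≤
      clampedSum ρ q - clampedSum ρ p := by
  have hs := (summable_clampedSum ρ q).sub (summable_clampedSum ρ p)
  rw [clampedSum, clampedSum, ← (summable_clampedSum ρ q).tsum_sub (summable_clampedSum ρ p),
    mul_sub]
  refine hs.le_tsum n fun k _ => ?_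
  rw [← mul_sub]
  exact mul_nonneg (by positivity) (sub_nonneg.2 (monotone_clampUnit (h k)))

/-- The fibre coordinate built from countably many fibre coordinates `ρ n`. -/
noncomputable def endCoord (ρ : ℕ → ℝ × ℝ → ℝ) (A : ℝ → ℝ) (q : ℝ × ℝ) : ℝ :=
  clampedSum ρ q + Real.exp q.2 * Real.arctan q.1 + (max 0 (q.1 - A q.2) + min 0 (q.1 + A q.2))

section EndCoord

variable {ρ : ℕ → ℝ × ℝ → ℝ} {A : ℝ → ℝ}

theorem continuous_endCoord (hρ : ∀ n, Continuous (ρ n)) (hA : Continuous A) :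
    Continuous (endCoord ρ A) := by
  have := continuous_clampedSum hρ
  unfold endCoord
  fun_prop

/-- Keeping a single summand `n` gives a lower bound for increments that survives the limit `t →
-∞`, where the arctangent term is lost. -/
theorem le_endCoord_sub (hρ : ∀ n t, Monotone fun x => ρ n (x, t)) {x y : ℝ} (hxy : x ≤ y)
    (t : ℝ) (n : ℕ) : (1 / 2 : ℝ) ^ n * (clampUnit (ρ n (y, t)) - clampUnit (ρ n (x, t))) +
      Real.exp t * (Real.arctan y - Real.arctan x) ≤ endCoord ρ A (y, t) - endCoord ρ A (x, t) := by
  have h1 := le_clampedSum_sub (ρ := ρ) (p := (x, t)) (q := (y, t)) (fun n => hρ n t hxy) n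
  have h2 : max 0 (x - A t) ≤ max 0 (y - A t) := max_le_max le_rfl (by linarith)
  have h3 : min 0 (x + A t) ≤ min 0 (y + A t) := min_le_min le_rfl (by linarith)
  simp only [endCoord]
  linarith

/-- The clamped sum and the last term are only weakly increasing; strictness comes from `exp t *
arctan x`. -/
theorem strictMono_endCoord (hρ : ∀ n t, Monotone fun x => ρ n (x, t)) (t : ℝ) :
    StrictMono fun x => endCoord ρ A (x, t) := by
  intro x y hxy
  have h1 := le_endCoord_sub (A := A) hρ hxy.le t 0
  have h2 := mul_pos (Real.exp_pos t) (sub_pos.2 (Real.arctan_strictMono hxy))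
  have h3 := monotone_clampUnit (hρ 0 t hxy.le)
  simp only [pow_zero, one_mul] at h1 h3
  simp only
  linarith

/-- The clamped sum and the arctangent term are bounded on each fibre, while the last term has slope
one outside `[-A t, A t]`. -/
theorem surjective_endCoord (hρ : ∀ n, Continuous (ρ n)) (hA : Continuous A) (hA0 : ∀ t, 0 ≤ A t)
    (t : ℝ) : Function.Surjective fun x => endCoord ρ A (x, t) := by
  have hc : Continuous fun x => endCoord ρ A (x, t) :=
    (continuous_endCoord hρ hA).comp (by fun_prop)
  refine hc.surjective ?_ ?_
  · refine tendsto_atTop.2 fun b => ?_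
    filter_upwards [eventually_ge_atTop (A t), eventually_ge_atTop (b + 2 + A t)] with x h1 h2
    have h3 := (abs_le.1 (abs_clampedSum_le ρ (x, t))).1
    have h4 : 0 ≤ Real.exp t * Real.arctan x := mul_nonneg (Real.exp_pos t).le
      (Real.arctan_nonneg.2 ((hA0 t).trans h1))
    have h5 : min 0 (x + A t) = 0 := min_eq_left (by linarith [hA0 t])
    have h6 := le_max_right 0 (x - A t)
    simp only [endCoord]
    linarith
  · refine tendsto_atBot.2 fun b => ?_
    filter_upwards [eventually_le_atBot (-A t), eventually_le_atBot (b - 2 - A t)] with x h1 h2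
    have h3 := (abs_le.1 (abs_clampedSum_le ρ (x, t))).2
    have h4 : Real.exp t * Real.arctan x ≤ 0 := mul_nonpos_of_nonneg_of_nonpos (Real.exp_pos t).le
      (Real.arctan_le_zero.2 (by linarith [hA0 t]))
    have h5 : max 0 (x - A t) = 0 := max_eq_left (by linarith [hA0 t])
    have h6 := min_le_right 0 (x + A t)
    simp only [endCoord]
    linarith

end EndCoord

/-! ### Extension of the fibre coordinate to the lower boundary. -/

section Lower

variable {Z : Type*} [TopologicalSpace Z] [T2Space Z] {F : Foliation Z} {Ψ : ℝ × ℝ → Z}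

/-- A countable family of adapted charts covering the lower boundary. -/
structure LowerAtlas (F : Foliation Z) (Ψ : ℝ × ℝ → Z) (φ : ℕ → ℝ × ℝ≥0 → Z)
    (ρ : ℕ → ℝ × ℝ → ℝ) (M : ℕ → ℝ → ℝ) : Prop where
  chart : ∀ n, ∃ z σ t₀, AdaptedChart F Ψ z (φ n) (ρ n) σ t₀ (M n)
  cover : ∀ z ∈ surfaceBoundary Z, IsLower Ψ z → ∃ n r, |r| < 1 ∧ φ n (r, 0) = z

/-- Second countability reduces the adapted charts at all lower boundary points to countably many,
enumerated with possible repetitions. -/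
theorem exists_lowerAtlas [SecondCountableTopology Z]
    (hsb : ∀ ω ∈ F.singularLeaves, ω ⊆ surfaceBoundary Z) (h : LineFoliated F Ψ)
    (hne : ∃ z ∈ surfaceBoundary Z, IsLower Ψ z) : ∃ φ ρ M, LowerAtlas F Ψ φ ρ M := by
  obtain ⟨z₀, hz₀, hl₀⟩ := hne
  have : Nonempty Z := ⟨z₀⟩
  have hex : ∀ z, z ∈ {z | z ∈ surfaceBoundary Z ∧ IsLower Ψ z} →
      ∃ φ ρ σ t₀ M, AdaptedChart F Ψ z φ ρ σ t₀ M := fun z hz =>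
    exists_adaptedChart hsb h hz.1 hz.2
  choose! φ ρ σ t₀ M hch using hex
  obtain ⟨c, hcs, hcc, hcov⟩ := TopologicalSpace.countable_cover_nhdsWithin
    (s := {z | z ∈ surfaceBoundary Z ∧ IsLower Ψ z}) (f := fun z => φ z '' {q | |q.1| < 1})
    fun z hz => mem_nhdsWithin_of_mem_nhds (by
      have h1 : {q : ℝ × ℝ≥0 | |q.1| < 1} ∈ 𝓝 ((0 : ℝ), (0 : ℝ≥0)) :=
        (isOpen_lt (by fun_prop) continuous_const).mem_nhds (by simp)
      have h2 := (hch z hz).half.emb.isOpenMap.image_mem_nhds h1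
      rwa [(hch z hz).half.center] at h2)
  have hcn : c.Nonempty := by
    obtain ⟨x, hx, -⟩ := mem_iUnion₂.1 (hcov (show z₀ ∈ _ from ⟨hz₀, hl₀⟩))
    exact ⟨x, hx⟩
  obtain ⟨e, rfl⟩ := hcc.exists_eq_range hcn
  refine ⟨fun n => φ (e n), fun n => ρ (e n), fun n => M (e n),
    fun n => ⟨_, _, _, hch _ (hcs (mem_range_self n))⟩, fun z hz hl => ?_⟩
  obtain ⟨_, ⟨n, rfl⟩, ⟨r, s⟩, hr, hq⟩ := mem_iUnion₂.1 (hcov (show z ∈ _ from ⟨hz, hl⟩))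
  have hs : s = 0 := by
    by_contra hs
    refine (hch _ (hcs (mem_range_self n))).half.interior r s (pos_iff_ne_zero.2 hs) ?_
    rwa [hq]
  subst hs
  exact ⟨n, r, hr, hq⟩

variable {φ : ℕ → ℝ × ℝ≥0 → Z} {ρ : ℕ → ℝ × ℝ → ℝ} {M : ℕ → ℝ → ℝ} {A : ℝ → ℝ}

theorem LowerAtlas.mono (h : LowerAtlas F Ψ φ ρ M) (n : ℕ) (t : ℝ) :
    Monotone fun x => ρ n (x, t) := by
  obtain ⟨z, σ, t₀, hch⟩ := h.chart n
  exact (hch.mono t).monotone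

/-- The clamped sum converges by dominated convergence. The arctangent term tends to `0` because
`exp t` does. The last term is eventually `0`: if `z` lies in the open unit box of chart `n`, then
nearby `|x| ≤ M n t ≤ A t` as soon as `t ≤ -n`. -/
theorem LowerAtlas.exists_tendsto (hsb : ∀ ω ∈ F.singularLeaves, ω ⊆ surfaceBoundary Z)
    (hΨ : LineFoliated F Ψ) (h : LowerAtlas F Ψ φ ρ M)
    (hA : ∀ t (n : ℕ), (n : ℝ) ≤ -t → M n t ≤ A t) {z : Z}
    (hz : z ∈ surfaceBoundary Z) (hl : IsLower Ψ z) :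
    ∃ l, Tendsto (fun y => endCoord ρ A (coords Ψ y)) (𝓝[surfaceInterior Z] z) (𝓝 l) := by
  have h1 : ∀ n, ∃ l, Tendsto (fun y => clampUnit (ρ n (coords Ψ y)))
      (𝓝[surfaceInterior Z] z) (𝓝 l) := fun n => by
    obtain ⟨z', σ, t₀, hch⟩ := h.chart n
    exact hch.exists_tendsto_clampUnit hsb hΨ hz hl
  choose l h1 using h1
  have h2 : Tendsto (fun y => clampedSum ρ (coords Ψ y)) (𝓝[surfaceInterior Z] z)
      (𝓝 (∑' n, (1 / 2 : ℝ) ^ n * l n)) :=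
    tendsto_tsum_of_dominated_convergence summable_geometric_two
      (fun n => (h1 n).const_mul _)
      (Eventually.of_forall fun y n => norm_clampedSum_term_le n _)
  have h3 : Tendsto (fun y => Real.exp (coords Ψ y).2 * Real.arctan (coords Ψ y).1)
      (𝓝[surfaceInterior Z] z) (𝓝 0) := by
    refine (Real.tendsto_exp_atBot.comp hl).zero_mul_isBoundedUnder_le
      ⟨Real.pi / 2, eventually_map.2 (Eventually.of_forall fun y => ?_)⟩
    exact abs_le.2 ⟨(Real.neg_pi_div_two_lt_arctan _).le, (Real.arctan_lt_pi_div_two _).le⟩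
  have h4 : (fun y => max 0 ((coords Ψ y).1 - A (coords Ψ y).2) +
      min 0 ((coords Ψ y).1 + A (coords Ψ y).2)) =ᶠ[𝓝[surfaceInterior Z] z] fun _ => 0 := by
    obtain ⟨n, r, hr, rfl⟩ := h.cover z hz hl
    obtain ⟨z', σ, t₀, hch⟩ := h.chart n
    have h5 := hl.eventually_le_atBot (-(n : ℝ))
    rw [hch.half.nhdsWithin_eq, eventually_map] at h5
    rw [hch.half.nhdsWithin_eq, EventuallyEq, eventually_map]
    have h6 : {q : ℝ × ℝ≥0 | |q.1| < 1} ∈ 𝓝 (r, (0 : ℝ≥0)) :=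
      (isOpen_lt (by fun_prop) continuous_const).mem_nhds hr
    have h7 : {q : ℝ × ℝ≥0 | q.2 < 1} ∈ 𝓝 (r, (0 : ℝ≥0)) :=
      (isOpen_Iio.preimage continuous_snd).mem_nhds (zero_lt_one' ℝ≥0)
    filter_upwards [h5, mem_nhdsWithin_of_mem_nhds h6, mem_nhdsWithin_of_mem_nhds h7,
      self_mem_nhdsWithin] with q hq5 hq6 hq7 hq
    have hq6' : |q.1| < 1 := hq6
    have h8 := hch.coord q.1 ⟨(abs_lt.1 hq6').1.le, (abs_lt.1 hq6').2.le⟩ q.2 hq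
      (show q.2 < 1 from hq7).le
    have h9 := hch.bound (coords Ψ (φ n q)).1 (coords Ψ (φ n q)).2
      (by rw [Prod.mk.eta, show q = (q.1, q.2) from rfl, h8]; exact hq6'.le)
    have h10 := abs_le.1 (h9.trans (hA _ n (by linarith)))
    rw [max_eq_left (by linarith), min_eq_left (by linarith), add_zero]
  refine ⟨_, (h2.add h3).add (tendsto_const_nhds.congr' h4.symm)⟩

/-- Along the bottom line of the chart containing `z`, the limit `ℓ` is strictly increasing. A
second point `z'` avoids a small box around `z` and lies on one side of it, so monotonicity on the
leaves puts `ℓ z'` beyond the value of `ℓ` at the corresponding edge of the box. -/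
theorem LowerAtlas.injOn (hsb : ∀ ω ∈ F.singularLeaves, ω ⊆ surfaceBoundary Z)
    (hΨ : LineFoliated F Ψ) (h : LowerAtlas F Ψ φ ρ M) {ℓ : Z → ℝ}
    (hℓ : ∀ z ∈ surfaceBoundary Z, IsLower Ψ z →
      Tendsto (fun y => endCoord ρ A (coords Ψ y)) (𝓝[surfaceInterior Z] z) (𝓝 (ℓ z))) :
    InjOn ℓ {z | z ∈ surfaceBoundary Z ∧ IsLower Ψ z} := by
  rintro z ⟨hz, hl⟩ z' ⟨hz', hl'⟩ heq
  by_contra hne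
  obtain ⟨n, r, hr, rfl⟩ := h.cover z hz hl
  obtain ⟨w, σ, t₀, hch⟩ := h.chart n
  have hlim : ∀ a, Tendsto (fun y => endCoord ρ A (coords Ψ y))
      (𝓝[surfaceInterior Z] (φ n (a, 0))) (𝓝 (ℓ (φ n (a, 0)))) := fun a =>
    hℓ _ (hch.half.boundary a) (hch.lower a)
  -- Approach to `φ n (a, 0)` along the vertical line of abscissa `a`, parametrized by the level
  -- `t`.
  have hmove : ∀ a : ℝ, Tendsto (fun t => endCoord ρ A (coords Ψ (φ n (a, σ t)))) atBot
      (𝓝 (ℓ (φ n (a, 0)))) :=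
    fun a => (hlim a).comp (hch.half.tendsto_nhdsWithin a hch.lim
      ((eventually_le_atBot t₀).mono fun t ht => hch.pos t ht))
  have hcoord : ∀ a t, t ≤ t₀ →
      ((coords Ψ (φ n (a, σ t))).1, t) = coords Ψ (φ n (a, σ t)) :=
    fun a t ht => Prod.ext rfl (hch.level t ht a).symm
  have hstrict : ∀ a b, -1 ≤ a → a < b → b ≤ 1 → ℓ (φ n (a, 0)) < ℓ (φ n (b, 0)) := by
    intro a b ha hab hb
    have hlow : (1 / 2 : ℝ) ^ n * (b - a) ≤ ℓ (φ n (b, 0)) - ℓ (φ n (a, 0)) := by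
      refine ge_of_tendsto ((hmove b).sub (hmove a)) ?_
      filter_upwards [eventually_le_atBot t₀] with t ht
      have ha' := hch.coord a ⟨ha, hab.le.trans hb⟩ _ (hch.pos t ht) (hch.le_one t ht)
      have hb' := hch.coord b ⟨ha.trans hab.le, hb⟩ _ (hch.pos t ht) (hch.le_one t ht)
      rw [← hcoord _ _ ht] at ha' hb'
      have hx : (coords Ψ (φ n (a, σ t))).1 ≤ (coords Ψ (φ n (b, σ t))).1 := by
        rw [← (hch.mono t).le_iff_le]
        simp only [ha', hb']
        exact hab.le
      have h1 := le_endCoord_sub (A := A) h.mono hx t n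
      rw [ha', hb', clampUnit_of_mem ⟨ha, hab.le.trans hb⟩,
        clampUnit_of_mem ⟨ha.trans hab.le, hb⟩, hcoord _ _ ht, hcoord _ _ ht] at h1
      have h2 := mul_nonneg (Real.exp_pos t).le
        (sub_nonneg.2 (Real.arctan_strictMono.monotone hx))
      linarith
    have : 0 < (1 / 2 : ℝ) ^ n * (b - a) := mul_pos (by positivity) (sub_pos.2 hab)
    linarith
  -- If `z'` is on the same bottom line, half its distance to `z` is allowed; `δ ≤ 1 - |r|` keeps
  -- the box in `[-1, 1]`.
  obtain ⟨δ, hδ, hδ1, hδ'⟩ : ∃ δ > 0, δ ≤ 1 - |r| ∧ ∀ r', φ n (r', 0) = z' → δ < |r' - r| := by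
    by_cases hex : ∃ r', φ n (r', 0) = z'
    · obtain ⟨r', rfl⟩ := hex
      have hr' : 0 < |r' - r| := abs_pos.2 (sub_ne_zero.2 fun h0 => hne (by rw [h0]))
      refine ⟨min (1 - |r|) (|r' - r| / 2), lt_min (by linarith) (by linarith), min_le_left _ _,
        fun r'' hr'' => ?_⟩
      rw [show r'' = r' from congrArg Prod.fst (hch.half.emb.injective hr'')]
      exact (min_le_right _ _).trans_lt (half_lt_self hr')
    · exact ⟨1 - |r|, by linarith, le_rfl, fun r' hr' => (hex ⟨r', hr'⟩).elim⟩
  have habs := abs_le.1 (show |r| ≤ 1 - δ by linarith)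
  have hC : z' ∉ φ n '' (Icc (r - δ) (r + δ) ×ˢ Icc 0 1) := by
    rintro ⟨⟨r', s⟩, ⟨hr', -⟩, rfl⟩
    have hs : s = 0 := by
      by_contra hs
      exact hch.half.interior r' s (pos_iff_ne_zero.2 hs) hz'
    subst hs
    refine (hδ' r' rfl).not_ge (abs_le.2 ⟨?_, ?_⟩)
    · linarith [hr'.1]
    · linarith [hr'.2]
  have : (𝓝[surfaceInterior Z] z').NeBot :=
    mem_closure_iff_nhdsWithin_neBot.1 (dense_surfaceInterior hsb z')
  rcases hch.eventually_side hsb hΨ (by linarith [habs.1]) (by linarith) (by linarith [habs.2])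
    hz' hl' hC with hside | hside
  -- Each `y` near `z'` is compared with the point of abscissa `r - δ` on the leaf of `y`, and both
  -- sides pass to the limit.
  · have h1 : ℓ z' ≤ ℓ (φ n (r - δ, 0)) := by
      refine le_of_tendsto_of_tendsto (hℓ z' hz' hl') ((hmove (r - δ)).comp hl') ?_
      filter_upwards [hside, hl'.eventually_le_atBot t₀] with y hy ht
      have h2 := hch.coord (r - δ) ⟨by linarith [habs.1], by linarith [habs.2]⟩ _
        (hch.pos _ ht) (hch.le_one _ ht)
      rw [← h2, ← hcoord _ _ ht] at hy
      have h3 := ((hch.mono _).lt_iff_lt).1 hy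
      have h4 := (strictMono_endCoord (A := A) h.mono (coords Ψ y).2) h3
      simp only [hcoord _ _ ht] at h4
      exact h4.le
    have h2 := hstrict (r - δ) r (by linarith [habs.1]) (by linarith) (by linarith [habs.2])
    linarith
  · have h1 : ℓ (φ n (r + δ, 0)) ≤ ℓ z' := by
      refine le_of_tendsto_of_tendsto ((hmove (r + δ)).comp hl') (hℓ z' hz' hl') ?_
      filter_upwards [hside, hl'.eventually_le_atBot t₀] with y hy ht
      have h2 := hch.coord (r + δ) ⟨by linarith [habs.1], by linarith [habs.2]⟩ _
        (hch.pos _ ht) (hch.le_one _ ht)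
      rw [← h2, ← hcoord _ _ ht] at hy
      have h3 := ((hch.mono _).lt_iff_lt).1 hy
      have h4 := (strictMono_endCoord (A := A) h.mono (coords Ψ y).2) h3
      simp only [hcoord _ _ ht] at h4
      exact h4.le
    have h2 := hstrict r (r + δ) (by linarith [habs.1]) (by linarith) (by linarith [habs.2])
    linarith

/-- There is a fibre coordinate on the interior that extends to the lower boundary. -/
theorem exists_endCoord [SecondCountableTopology Z]
    (hsb : ∀ ω ∈ F.singularLeaves, ω ⊆ surfaceBoundary Z) (hΨ : LineFoliated F Ψ) :
    ∃ H : ℝ × ℝ → ℝ, Continuous H ∧ (∀ t, StrictMono fun x => H (x, t)) ∧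
      (∀ t, Function.Surjective fun x => H (x, t)) ∧ ∃ ℓ : Z → ℝ,
        (∀ z ∈ surfaceBoundary Z, IsLower Ψ z →
          Tendsto (fun y => H (coords Ψ y)) (𝓝[surfaceInterior Z] z) (𝓝 (ℓ z))) ∧
        InjOn ℓ {z | z ∈ surfaceBoundary Z ∧ IsLower Ψ z} := by
  by_cases hne : ∃ z ∈ surfaceBoundary Z, IsLower Ψ z
  · obtain ⟨φ, ρ, M, h⟩ := exists_lowerAtlas hsb hΨ hne
    have hM : ∀ n, Continuous (M n) := fun n => by
      obtain ⟨z, σ, t₀, hch⟩ := h.chart n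
      exact hch.contM
    have hρ : ∀ n, Continuous (ρ n) := fun n => by
      obtain ⟨z, σ, t₀, hch⟩ := h.chart n
      exact hch.cont
    obtain ⟨A, hA, hA0, hAM⟩ := exists_continuous_bound hM
    have hex : ∀ z, z ∈ surfaceBoundary Z → IsLower Ψ z → ∃ l,
        Tendsto (fun y => endCoord ρ A (coords Ψ y)) (𝓝[surfaceInterior Z] z) (𝓝 l) :=
      fun z hz hl => h.exists_tendsto hsb hΨ hAM hz hl
    choose! ℓ hℓ using hex
    exact ⟨endCoord ρ A, continuous_endCoord hρ hA, strictMono_endCoord h.mono,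
      surjective_endCoord hρ hA hA0, ℓ, hℓ, h.injOn hsb hΨ hℓ⟩
  · push Not at hne
    exact ⟨Prod.fst, continuous_fst, fun t => strictMono_id, fun t x => ⟨x, rfl⟩,
      fun _ => 0,
      fun z hz hl => (hne z hz hl).elim, fun z hz => (hne z hz.1 hz.2).elim⟩

end Lower

/-! ### The embedding onto a strip. -/

section Strip

variable {Z : Type*} [TopologicalSpace Z] {F : Foliation Z} {Ψ : ℝ × ℝ → Z} {H : ℝ × ℝ → ℝ}

theorem neBot_nhdsWithin_surfaceInterior (hsb : ∀ ω ∈ F.singularLeaves, ω ⊆ surfaceBoundary Z)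
    (z : Z) : (𝓝[surfaceInterior Z] z).NeBot :=
  mem_closure_iff_nhdsWithin_neBot.1 (dense_surfaceInterior hsb z)

theorem IsUpper.not_isLower (hsb : ∀ ω ∈ F.singularLeaves, ω ⊆ surfaceBoundary Z) {z : Z}
    (hu : IsUpper Ψ z) : ¬ IsLower Ψ z := fun hl => by
  have := neBot_nhdsWithin_surfaceInterior hsb z
  obtain ⟨y, h1, h2⟩ := ((hu.eventually_gt_atTop 0).and (hl.eventually_lt_atBot 0)).exists
  exact lt_asymm h1 h2

/-- There is a fibre coordinate on the interior that extends to the whole boundary. -/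
theorem exists_fibreCoord [T2Space Z] [SecondCountableTopology Z]
    (hsb : ∀ ω ∈ F.singularLeaves, ω ⊆ surfaceBoundary Z) (hΨ : LineFoliated F Ψ) :
    ∃ H : ℝ × ℝ → ℝ, Continuous H ∧ (∀ t, StrictMono fun x => H (x, t)) ∧
      (∀ t, Function.Surjective fun x => H (x, t)) ∧ ∃ ℓ : Z → ℝ,
        (∀ z ∈ surfaceBoundary Z,
          Tendsto (fun y => H (coords Ψ y)) (𝓝[surfaceInterior Z] z) (𝓝 (ℓ z))) ∧
        InjOn ℓ {z | z ∈ surfaceBoundary Z ∧ IsLower Ψ z} ∧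
        InjOn ℓ {z | z ∈ surfaceBoundary Z ∧ IsUpper Ψ z} := by
  classical
  obtain ⟨L, hLc, hLm, hLs, l, hl, hli⟩ := exists_endCoord hsb hΨ
  obtain ⟨U, hUc, hUm, hUs, u, hu, hui⟩ := exists_endCoord hsb hΨ.flip
  -- `k` matches the coordinates of the two ends on the leaf `t = 0`. Being a homeomorphism, it
  -- preserves the limits and the injectivity obtained at the upper end.
  let k : ℝ ≃o ℝ := ((hUm 0).orderIsoOfSurjective _ (hUs 0)).symm.trans
    ((hLm 0).orderIsoOfSurjective _ (hLs 0))
  have hk : ∀ x, k (U (x, 0)) = L (x, 0) := fun x => by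
    have : ((hUm 0).orderIsoOfSurjective _ (hUs 0)).symm (U (x, 0)) = x :=
      ((hUm 0).orderIsoOfSurjective _ (hUs 0)).symm_apply_apply x
    change L (((hUm 0).orderIsoOfSurjective _ (hUs 0)).symm (U (x, 0)), 0) = L (x, 0)
    rw [this]
  have hkc : Continuous k := k.continuous
  refine ⟨fun q => if q.2 ≤ 0 then L q else k (U (q.1, -q.2)), ?_, fun t => ?_, fun t => ?_,
    fun z => if IsLower Ψ z then l z else k (u z), fun z hz => ?_, ?_, ?_⟩
  · refine Continuous.if_le hLc (by fun_prop) continuous_snd continuous_const fun q hq => ?_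
    rw [hq, neg_zero, hk, ← hq]
  · by_cases ht : t ≤ 0
    · simpa only [ht, if_true] using hLm t
    · simp only [ht, if_false]
      exact k.strictMono.comp (hUm (-t))
  · by_cases ht : t ≤ 0
    · simpa only [ht, if_true] using hLs t
    · simp only [ht, if_false]
      exact k.surjective.comp (hUs (-t))
  · by_cases hlow : IsLower Ψ z
    · simp only [hlow, if_true]
      refine (hl z hz hlow).congr' ?_
      filter_upwards [hlow.eventually_le_atBot 0] with y hy
      rw [if_pos hy]
    · have hup := (isLower_or_isUpper hsb hΨ hz).resolve_left hlow
      simp only [hlow, if_false]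
      refine ((hkc.tendsto _).comp (hu z hz (hΨ.isLower_flip.2 hup))).congr' ?_
      filter_upwards [hup.eventually_gt_atTop 0, self_mem_nhdsWithin] with y hy hyi
      rw [if_neg hy.not_ge, Function.comp, hΨ.coords_flip hyi]
  · rintro z ⟨hz, hz'⟩ y ⟨hy, hy'⟩ heq
    simp only [hz', hy', if_true] at heq
    exact hli ⟨hz, hz'⟩ ⟨hy, hy'⟩ heq
  · rintro z ⟨hz, hz'⟩ y ⟨hy, hy'⟩ heq
    simp only [hz'.not_isLower hsb, hy'.not_isLower hsb, if_false] at heq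
    exact hui ⟨hz, hΨ.isLower_flip.2 hz'⟩ ⟨hy, hΨ.isLower_flip.2 hy'⟩ (k.injective heq)

/-- An injective continuous map to the plane that is given by the fibre coordinate `H` and the
level on the interior, and maps the boundary to the lines `ℝ × {±π/2}`. -/
structure StripMap (F : Foliation Z) (Ψ : ℝ × ℝ → Z) (H : ℝ × ℝ → ℝ) (h : Z → ℝ × ℝ) : Prop where
  contH : Continuous H
  mono : ∀ t, StrictMono fun x => H (x, t)
  surj : ∀ t, Function.Surjective fun x => H (x, t)
  cont : Continuous h
  inj : Function.Injective h
  interior : ∀ q, h (Ψ q) = (H q, Real.arctan q.2)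
  lower : ∀ z ∈ surfaceBoundary Z, IsLower Ψ z → (h z).2 = -(Real.pi / 2)
  upper : ∀ z ∈ surfaceBoundary Z, IsUpper Ψ z → (h z).2 = Real.pi / 2

/-- The map `(H, arctan t)` on the dense interior has a limit at every point of `Z`, so it extends
continuously. The second coordinate tells the interior and the two ends apart; within each of these
classes injectivity comes from `H` on the fibres or from the boundary limits `ℓ`. -/
theorem exists_stripMap [T2Space Z] [SecondCountableTopology Z]
    (hsb : ∀ ω ∈ F.singularLeaves, ω ⊆ surfaceBoundary Z) (hΨ : LineFoliated F Ψ) :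
    ∃ H h, StripMap F Ψ H h := by
  obtain ⟨H, hHc, hHm, hHs, ℓ, hℓ, hlow, hup⟩ := exists_fibreCoord hsb hΨ
  set f : Z → ℝ × ℝ := fun y => (H (coords Ψ y), Real.arctan (coords Ψ y).2) with hf
  have hd := dense_surfaceInterior hsb
  have h1 : ∀ q, Tendsto f (𝓝[surfaceInterior Z] (Ψ q)) (𝓝 (H q, Real.arctan q.2)) := fun q => by
    have hc := hΨ.continuousAt_coords (hΨ.mem_interior q)
    have hg : Continuous fun q : ℝ × ℝ => (H q, Real.arctan q.2) := by fun_prop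
    have h2 := (ContinuousAt.comp (g := fun q : ℝ × ℝ => (H q, Real.arctan q.2))
      hg.continuousAt hc).tendsto.mono_left
      (nhdsWithin_le_nhds (s := surfaceInterior Z))
    rw [Function.comp, hΨ.coords_apply] at h2
    exact h2
  have h2 : ∀ z ∈ surfaceBoundary Z, IsLower Ψ z →
      Tendsto f (𝓝[surfaceInterior Z] z) (𝓝 (ℓ z, -(Real.pi / 2))) := fun z hz hl =>
    (hℓ z hz).prodMk_nhds ((Real.tendsto_arctan_atBot.mono_right nhdsWithin_le_nhds).comp hl)
  have h3 : ∀ z ∈ surfaceBoundary Z, IsUpper Ψ z →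
      Tendsto f (𝓝[surfaceInterior Z] z) (𝓝 (ℓ z, Real.pi / 2)) := fun z hz hu =>
    (hℓ z hz).prodMk_nhds ((Real.tendsto_arctan_atTop.mono_right nhdsWithin_le_nhds).comp hu)
  have e1 : ∀ q, extendFrom (surfaceInterior Z) f (Ψ q) = (H q, Real.arctan q.2) := fun q =>
    extendFrom_eq (hd _) (h1 q)
  have e2 : ∀ z ∈ surfaceBoundary Z, IsLower Ψ z →
      extendFrom (surfaceInterior Z) f z = (ℓ z, -(Real.pi / 2)) := fun z hz hl =>
    extendFrom_eq (hd _) (h2 z hz hl)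
  have e3 : ∀ z ∈ surfaceBoundary Z, IsUpper Ψ z →
      extendFrom (surfaceInterior Z) f z = (ℓ z, Real.pi / 2) := fun z hz hu =>
    extendFrom_eq (hd _) (h3 z hz hu)
  have hcases : ∀ z, (∃ q, Ψ q = z) ∨ (z ∈ surfaceBoundary Z ∧ IsLower Ψ z) ∨
      (z ∈ surfaceBoundary Z ∧ IsUpper Ψ z) := fun z => by
    by_cases hz : z ∈ surfaceBoundary Z
    · exact Or.inr ((isLower_or_isUpper hsb hΨ hz).imp (⟨hz, ·⟩) (⟨hz, ·⟩))
    · exact Or.inl ⟨_, hΨ.apply_coords hz⟩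
  have hpi := Real.pi_pos
  refine ⟨H, extendFrom (surfaceInterior Z) f, hHc, hHm, hHs, continuous_extendFrom hd fun z => ?_,
    fun z y hzy => ?_, e1, fun z hz hl => by rw [e2 z hz hl], fun z hz hu => by rw [e3 z hz hu]⟩
  · rcases hcases z with ⟨q, rfl⟩ | ⟨hz, hl⟩ | ⟨hz, hu⟩
    · exact ⟨_, h1 q⟩
    · exact ⟨_, h2 z hz hl⟩
    · exact ⟨_, h3 z hz hu⟩
  · rcases hcases z with ⟨⟨x, t⟩, rfl⟩ | ⟨hz, hl⟩ | ⟨hz, hl⟩ <;>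
      rcases hcases y with ⟨⟨x', t'⟩, rfl⟩ | ⟨hy, hl'⟩ | ⟨hy, hl'⟩
    · rw [e1, e1, Prod.mk.injEq] at hzy
      obtain ⟨h4, h5⟩ := hzy
      have h6 : t = t' := Real.arctan_injective h5
      subst h6
      rw [(hHm t).injective h4]
    · rw [e1, e2 y hy hl', Prod.mk.injEq] at hzy
      exact absurd hzy.2 (Real.neg_pi_div_two_lt_arctan _).ne'
    · rw [e1, e3 y hy hl', Prod.mk.injEq] at hzy
      exact absurd hzy.2 (Real.arctan_lt_pi_div_two _).ne
    · rw [e1, e2 z hz hl, Prod.mk.injEq] at hzy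
      exact absurd hzy.2 (Real.neg_pi_div_two_lt_arctan _).ne
    · rw [e2 z hz hl, e2 y hy hl', Prod.mk.injEq] at hzy
      exact hlow ⟨hz, hl⟩ ⟨hy, hl'⟩ hzy.1
    · rw [e2 z hz hl, e3 y hy hl', Prod.mk.injEq] at hzy
      linarith [hzy.2]
    · rw [e1, e3 z hz hl, Prod.mk.injEq] at hzy
      exact absurd hzy.2 (Real.arctan_lt_pi_div_two _).ne'
    · rw [e3 z hz hl, e2 y hy hl', Prod.mk.injEq] at hzy
      linarith [hzy.2]
    · rw [e3 z hz hl, e3 y hy hl', Prod.mk.injEq] at hzy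
      exact hup ⟨hz, hl⟩ ⟨hy, hl'⟩ hzy.1

theorem nhdsGE_le_map {s : ℝ≥0 → ℝ} (hs : Continuous s) (h0 : ∀ v, 0 < v → s 0 < s v) :
    𝓝[≥] (s 0) ≤ map s (𝓝 0) := by
  intro V hV
  obtain ⟨ε, hε, hsub⟩ := Metric.mem_nhds_iff.1 (mem_map.1 hV)
  have hv : (0 : ℝ≥0) < ⟨ε / 2, by linarith⟩ := NNReal.coe_pos.1 (half_pos hε)
  refine mem_of_superset (Icc_mem_nhdsGE (h0 _ hv)) ?_
  refine (intermediate_value_Icc hv.le hs.continuousOn).trans ?_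
  rintro _ ⟨w, hw, rfl⟩
  refine hsub ?_
  rw [Metric.mem_ball, NNReal.dist_eq, NNReal.coe_zero, sub_zero]
  have h1 : |(w : ℝ)| < ε := by
    rw [NNReal.abs_eq]
    have : (w : ℝ) ≤ ε / 2 := hw.2
    linarith
  exact h1

theorem nhdsLE_le_map {s : ℝ≥0 → ℝ} (hs : Continuous s) (h0 : ∀ v, 0 < v → s v < s 0) :
    𝓝[≤] (s 0) ≤ map s (𝓝 0) := by
  intro V hV
  obtain ⟨ε, hε, hsub⟩ := Metric.mem_nhds_iff.1 (mem_map.1 hV)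
  have hv : (0 : ℝ≥0) < ⟨ε / 2, by linarith⟩ := NNReal.coe_pos.1 (half_pos hε)
  refine mem_of_superset (Icc_mem_nhdsLE (h0 _ hv)) ?_
  refine (intermediate_value_Icc' hv.le hs.continuousOn).trans ?_
  rintro _ ⟨w, hw, rfl⟩
  refine hsub ?_
  rw [Metric.mem_ball, NNReal.dist_eq, NNReal.coe_zero, sub_zero]
  have h1 : |(w : ℝ)| < ε := by
    rw [NNReal.abs_eq]
    have : (w : ℝ) ≤ ε / 2 := hw.2
    linarith
  exact h1

variable {h : Z → ℝ × ℝ}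

theorem StripMap.mem_Ioo (hh : StripMap F Ψ H h) (hΨ : LineFoliated F Ψ) {z : Z}
    (hz : z ∈ surfaceInterior Z) : (h z).2 ∈ Ioo (-(Real.pi / 2)) (Real.pi / 2) := by
  rw [← hΨ.apply_coords hz, hh.interior]
  exact Real.arctan_mem_Ioo _

theorem StripMap.mem_pair (hsb : ∀ ω ∈ F.singularLeaves, ω ⊆ surfaceBoundary Z)
    (hh : StripMap F Ψ H h) (hΨ : LineFoliated F Ψ) {z : Z} (hz : z ∈ surfaceBoundary Z) :
    (h z).2 ∈ ({-(Real.pi / 2), Real.pi / 2} : Set ℝ) :=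
  (isLower_or_isUpper hsb hΨ hz).imp (hh.lower z hz) (hh.upper z hz)

theorem StripMap.mem_Icc (hsb : ∀ ω ∈ F.singularLeaves, ω ⊆ surfaceBoundary Z)
    (hh : StripMap F Ψ H h) (hΨ : LineFoliated F Ψ) (z : Z) :
    (h z).2 ∈ Icc (-(Real.pi / 2)) (Real.pi / 2) := by
  have hpi := Real.pi_pos
  by_cases hz : z ∈ surfaceBoundary Z
  · rcases hh.mem_pair hsb hΨ hz with h1 | h1
    · rw [h1]; constructor <;> linarith
    · rw [mem_singleton_iff.1 h1]; constructor <;> linarith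
  · exact Ioo_subset_Icc_self (hh.mem_Ioo hΨ hz)

/-- A strip map is open onto its image in the closed strip. -/
theorem StripMap.nhdsWithin_le_map (hsb : ∀ ω ∈ F.singularLeaves, ω ⊆ surfaceBoundary Z)
    (hh : StripMap F Ψ H h) (hΨ : LineFoliated F Ψ) (z : Z) :
    𝓝[univ ×ˢ Icc (-(Real.pi / 2)) (Real.pi / 2)] (h z) ≤ map h (𝓝 z) := by
  by_cases hz : z ∈ surfaceBoundary Z
  · obtain ⟨φ, hφ⟩ := exists_halfChart hsb hz
    have hc : Continuous fun q => h (φ q) := hh.cont.comp hφ.emb.continuous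
    have hside : (∀ r, IsLower Ψ (φ (r, 0))) ∨ ∀ r, IsUpper Ψ (φ (r, 0)) := by
      rcases isLower_or_isUpper hsb hΨ hz with hl | hu
      · exact Or.inl (hφ.isLower_of_tendsto hΨ (hφ.strictMono_plaqueLevel hΨ hl).2)
      · refine Or.inr (hφ.isUpper_of_tendsto hΨ ?_)
        have := hφ.tendsto_nhdsWithin 0 tendsto_expNN_atBot (Eventually.of_forall expNN_pos)
        rw [hφ.center] at this
        exact hu.comp this
    set s : ℝ≥0 → ℝ := fun v => (h (φ (0, v))).2 with hs
    have hsc : Continuous s := (continuous_snd.comp hc).comp (by fun_prop)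
    have hIoo : ∀ v, 0 < v → s v ∈ Ioo (-(Real.pi / 2)) (Real.pi / 2) := fun v hv =>
      hh.mem_Ioo hΨ (hφ.interior _ _ hv)
    -- In a half-plane chart the second coordinate of `h` depends on the height only, because
    -- plaques lie in leaves and the bottom line goes to a single end. Hence `nhds_prod_le_map`
    -- applies with a one-sided neighbourhood filter as its target.
    have hform : (fun q => h (φ q)) = fun q => ((h (φ q)).1, s q.2) := by
      ext ⟨r, v⟩
      · rfl
      · rcases (zero_le (a := v)).eq_or_lt with rfl | hv
        · rcases hside with hl | hl
          · simp only [hs, hh.lower _ (hφ.boundary _) (hl _)]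
          · simp only [hs, hh.upper _ (hφ.boundary _) (hl _)]
        · simp only [hs]
          rw [← hΨ.apply_coords (hφ.interior r v hv), ← hΨ.apply_coords (hφ.interior 0 v hv),
            hh.interior, hh.interior, hφ.level_eq hΨ r 0 hv]
    have hl : 𝓝[Icc (-(Real.pi / 2)) (Real.pi / 2)] (s 0) ≤ map s (𝓝 0) := by
      rcases hside with hl | hl
      · have h0 : s 0 = -(Real.pi / 2) := hh.lower _ (hφ.boundary _) (hl _)
        refine le_trans (nhdsWithin_mono _ fun x hx => ?_)
          (nhdsGE_le_map hsc fun v hv => h0 ▸ (hIoo v hv).1)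
        exact h0 ▸ hx.1
      · have h0 : s 0 = Real.pi / 2 := hh.upper _ (hφ.boundary _) (hl _)
        refine le_trans (nhdsWithin_mono _ fun x hx => ?_)
          (nhdsLE_le_map hsc fun v hv => h0 ▸ (hIoo v hv).2)
        exact h0 ▸ hx.2
    have key := nhds_prod_le_map (r := fun q => (h (φ q)).1) (s := s) (x₀ := 0) (t₀ := 0)
      (Eventually.of_forall fun q => (continuous_fst.comp hc).continuousAt)
      ⟨univ, univ_mem, fun r _ r' _ hr => by
        have h1 : h (φ (r, 0)) = h (φ (r', 0)) := by
          have h2 := congrFun hform (r, 0)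
          have h3 := congrFun hform (r', 0)
          simp only at h2 h3 hr
          rw [h2, h3, hr]
        exact congrArg Prod.fst (hφ.emb.injective (hh.inj h1))⟩ hl
    rw [← hform] at key
    have hz0 : h z = ((h (φ (0, 0))).1, s 0) := by rw [← hφ.center]
    rw [hz0, nhdsWithin_prod_eq, nhdsWithin_univ]
    refine key.trans ?_
    rw [show (fun q => h (φ q)) = h ∘ φ from rfl, ← map_map]
    have h4 := hφ.emb.continuous.continuousAt (x := ((0 : ℝ), (0 : ℝ≥0)))
    rw [ContinuousAt, hφ.center] at h4
    exact map_mono h4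
  · obtain ⟨⟨x, t⟩, rfl⟩ : ∃ q, Ψ q = z := ⟨_, hΨ.apply_coords hz⟩
    have key := nhds_prod_le_map (r := H) (s := Real.arctan) (x₀ := x) (t₀ := t)
      (Eventually.of_forall fun q => hh.contH.continuousAt)
      ⟨univ, univ_mem, (hh.mono t).injective.injOn⟩
      (nhds_le_map_of_injOn (Eventually.of_forall fun u => Real.continuous_arctan.continuousAt)
        ⟨univ, univ_mem, Real.arctan_injective.injOn⟩)
    rw [← nhds_prod_eq] at key
    refine nhdsWithin_le_nhds.trans ?_
    rw [hh.interior]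
    refine key.trans ?_
    rw [show (fun q : ℝ × ℝ => (H q, Real.arctan q.2)) = h ∘ Ψ from
      (funext hh.interior).symm, ← map_map]
    exact map_mono hΨ.emb.continuous.continuousAt

theorem StripMap.isEmbedding (hsb : ∀ ω ∈ F.singularLeaves, ω ⊆ surfaceBoundary Z)
    (hh : StripMap F Ψ H h) (hΨ : LineFoliated F Ψ) : IsEmbedding h := by
  refine ⟨isInducing_iff_nhds.2 fun z => le_antisymm (hh.cont.tendsto z).le_comap ?_, hh.inj⟩
  have h1 : comap h (𝓝 (h z)) =
      comap h (𝓝[univ ×ˢ Icc (-(Real.pi / 2)) (Real.pi / 2)] (h z)) := by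
    rw [nhdsWithin, comap_inf, comap_principal]
    have : h ⁻¹' (univ ×ˢ Icc (-(Real.pi / 2)) (Real.pi / 2)) = univ :=
      eq_univ_of_forall fun y => ⟨mem_univ _, hh.mem_Icc hsb hΨ y⟩
    rw [this, principal_univ, inf_top_eq]
  rw [h1]
  exact (comap_mono (hh.nhdsWithin_le_map hsb hΨ z)).trans (comap_map hh.inj).le

theorem StripMap.isStrip (hsb : ∀ ω ∈ F.singularLeaves, ω ⊆ surfaceBoundary Z)
    (hh : StripMap F Ψ H h) (hΨ : LineFoliated F Ψ) :
    IsStrip (-(Real.pi / 2)) (Real.pi / 2) (range h) := by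
  have hpi := Real.pi_pos
  have hsub : range h ⊆ univ ×ˢ Icc (-(Real.pi / 2)) (Real.pi / 2) := by
    rintro _ ⟨z, rfl⟩
    exact ⟨mem_univ _, hh.mem_Icc hsb hΨ z⟩
  -- The open set is the largest one whose trace on the closed strip lies in the image; it contains
  -- the image by `StripMap.nhdsWithin_le_map`.
  refine ⟨by linarith, ?_, hsub, _, isOpen_interior
    (s := {p | p ∈ univ ×ˢ Icc (-(Real.pi / 2)) (Real.pi / 2) → p ∈ range h}),
    Subset.antisymm (fun p hp => ⟨?_, hsub hp⟩) fun p hp => interior_subset hp.1 hp.2⟩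
  · rintro ⟨a, b⟩ ⟨-, hb⟩
    obtain ⟨x, hx⟩ := hh.surj (Real.tan b) a
    exact ⟨Ψ (x, Real.tan b), by
      rw [hh.interior, Real.arctan_tan hb.1 hb.2]
      exact Prod.ext hx rfl⟩
  · obtain ⟨z, rfl⟩ := hp
    exact mem_interior_iff_mem_nhds.2
      (mem_inf_principal.1 (hh.nhdsWithin_le_map hsb hΨ z range_mem_map))

theorem image_connectedComponentIn_of_isEmbedding {X Y : Type*} [TopologicalSpace X]
    [TopologicalSpace Y] {f : X → Y} (hf : IsEmbedding f) {s : Set X} {x : X} (hx : x ∈ s) :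
    f '' connectedComponentIn s x = connectedComponentIn (f '' s) (f x) := by
  refine Subset.antisymm ?_ ?_
  · exact (isPreconnected_connectedComponentIn.image f
      hf.continuous.continuousOn).subset_connectedComponentIn
        (mem_image_of_mem f (mem_connectedComponentIn hx))
        (image_mono (connectedComponentIn_subset s x))
  · have h1 : connectedComponentIn (f '' s) (f x) ⊆ f '' s := connectedComponentIn_subset _ _
    have h2 : f '' (f ⁻¹' connectedComponentIn (f '' s) (f x)) =
        connectedComponentIn (f '' s) (f x) :=
      image_preimage_eq_of_subset (h1.trans (image_subset_range f s))
    rw [← h2]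
    refine image_mono (IsPreconnected.subset_connectedComponentIn ?_
      (mem_connectedComponentIn (mem_image_of_mem f hx)) fun y hy => ?_)
    · rw [← hf.isInducing.isPreconnected_image, h2]
      exact isPreconnected_connectedComponentIn
    · exact hf.injective.mem_set_image.1 (h1 hy)

/-- A leaf meeting the boundary is a component of `∂Z`, and the embedding carries `∂Z` onto the
boundary of the strip, hence components to components. Any other leaf is a level of `Ψ`, which `H`
maps onto a full horizontal line. -/
theorem StripMap.foliatedHomeomorphic (hsb : ∀ ω ∈ F.singularLeaves, ω ⊆ surfaceBoundary Z)
    (hh : StripMap F Ψ H h) (hΨ : LineFoliated F Ψ) :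
    FoliatedHomeomorphic F.leaves (stripLeaves (-(Real.pi / 2)) (Real.pi / 2) (range h)) := by
  have hemb := hh.isEmbedding hsb hΨ
  refine ⟨hemb.toHomeomorph, fun ω hω => ?_⟩
  have himage : Subtype.val '' (hemb.toHomeomorph '' ω) = h '' ω := by
    rw [image_image]
    rfl
  obtain ⟨z, hz⟩ := F.leaf_nonempty hω
  by_cases hzb : z ∈ surfaceBoundary Z
  · right
    have hb : h '' surfaceBoundary Z =
        stripBoundary (-(Real.pi / 2)) (Real.pi / 2) (range h) := by
      ext p
      constructor
      · rintro ⟨y, hy, rfl⟩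
        exact ⟨mem_range_self y, mem_univ _, hh.mem_pair hsb hΨ hy⟩
      · rintro ⟨⟨y, rfl⟩, -, hy⟩
        refine ⟨y, by_contra fun hyi => ?_, rfl⟩
        have h1 := hh.mem_Ioo hΨ hyi
        rcases hy with h2 | h2
        · exact h1.1.ne' h2
        · exact h1.2.ne h2
    refine ⟨h z, hb ▸ mem_image_of_mem h hzb, ?_⟩
    rw [himage, ← hb, ← image_connectedComponentIn_of_isEmbedding hemb hzb,
      F.leaf_eq hω (F.boundary_component_mem z hzb) hz (mem_connectedComponentIn hzb)]
  · left
    refine ⟨Real.arctan (coords Ψ z).2, Real.arctan_mem_Ioo _, ?_⟩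
    rw [himage, F.leaf_eq hω (hΨ.leaf (coords Ψ z).2) hz ⟨_, rfl, hΨ.apply_coords hzb⟩]
    ext ⟨a, b⟩
    constructor
    · rintro ⟨_, ⟨⟨x, t⟩, ht, rfl⟩, hq⟩
      rw [hh.interior, Prod.mk.injEq] at hq
      refine ⟨mem_univ _, ?_⟩
      rw [mem_singleton_iff, ← hq.2]
      exact congrArg Real.arctan ht
    · rintro ⟨-, hb⟩
      obtain ⟨x, hx⟩ := hh.surj (coords Ψ z).2 a
      refine ⟨_, ⟨(x, (coords Ψ z).2), rfl, rfl⟩, ?_⟩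
      rw [hh.interior]
      exact Prod.ext hx (mem_singleton_iff.1 hb).symm

end Strip

end Striped

theorem mainTheorem3 {Z : Type*} [TopologicalSpace Z] [T2Space Z] [SecondCountableTopology Z]
    [ConnectedSpace Z] (F : Striped.Foliation Z)
    (hleaf_line : ∀ ω ∈ F.leaves, Nonempty (ω ≃ₜ ℝ))
    (hleaf_closed : ∀ ω ∈ F.leaves, IsClosed ω)
    (hsing_finite : LocallyFinite (fun ω : F.singularLeaves => (ω : Set Z)))
    (hsing_boundary : ∀ ω ∈ F.singularLeaves, ω ⊆ Striped.surfaceBoundary Z) :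
    Striped.FoliatedHomeomorphic F.leaves (Striped.bandLeaves 1) ∨
    Striped.FoliatedHomeomorphic F.leaves (Striped.bandLeaves (-1)) ∨
    ∃ (u v : ℝ) (S : Set (ℝ × ℝ)), Striped.IsStrip u v S ∧
      Striped.FoliatedHomeomorphic F.leaves (Striped.stripLeaves u v S) := by
  rcases Striped.interior_classification hsing_boundary with
    ⟨Ψ, h1, h2, h3⟩ | ⟨γ, G, hG, hinj, h01, hsurj⟩
  · right; right
    have hΨ : Striped.LineFoliated F Ψ := ⟨h1, h2, h3⟩
    obtain ⟨H, h, hh⟩ := Striped.exists_stripMap hsing_boundary hΨ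
    exact ⟨_, _, _, hh.isStrip hsing_boundary hΨ, hh.foliatedHomeomorphic hsing_boundary hΨ⟩
  · obtain ⟨ε, hε⟩ := Striped.foliatedHomeomorphic_band hsing_boundary hG hinj h01 hsurj
    rcases Int.units_eq_one_or ε with rfl | rfl
    · exact Or.inl hε
    · exact Or.inr (Or.inl hε)
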